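/- **Model.** Let $h$ be an integrable real random variable whose law $\nu$ is symmetric about $0$, and let $\theta_1>0$. For $S\subset[n]$ with $|S|=k$, an observation of the planted random field Curie–Weiss model with clique $S$ is a vector $\sigma\in\{-1,1\}^n$ generated as follows: $h_1,\dots,h_n$ are i.i.d. copies of $h$ and, given $h_1,\dots,h_n$, $$\mathbb P_S(\sigma\mid h_1,\dots,h_n)\ \propto\ \exp\Big(\frac{\theta_1}{2k}\Big(\sum_{i\in S}\sigma_i\Big)^2+\sum_{i=1}^n h_i\sigma_i\Big).$$ We observe $m$ i.i.d. such vectors $\sigma^{(1)},\dots,\sigma^{(m)}$ (with a fresh field for each). Put $H(x)=\frac{x^2}{2}-\mathbb E[\log\cosh(\sqrt{\theta_1}\,x+h)]$. The temperature is * *high* if $\theta_1\mathbb E[\operatorname{sech}^2 h]<1$ and $0$ is the unique global minimizer of $H$; * *critical with flatness $\tau\in\mathbb N$* if $\theta_1\mathbb E[\operatorname{sech}^2h]=1$, $0$ is the unique global minimizer of $H$, and $H(x)=H(0)+\frac{H^{(2\tau)}(0)}{(2\tau)!}x^{2\tau}+O(x^{2\tau+1})$ as $x\to0$ with $H^{(2\tau)}(0)>0$;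 in this case we also assume that $h$ is not almost surely $0$; * *low* if $\theta_1\mathbb E[\operatorname{sech}^2h]>1$, or $\theta_1\mathbb E[\operatorname{sech}^2h]=1$ and $0$ is not a global minimizer of $H$. **Screening.** Let $a_k=1$, $a_k=k^{\frac{2\tau-2}{2\tau-1}}$, $a_k=k$ and $r_k=k$, $r_k=k^{\frac1{2\tau-1}}$, $r_k=1$ at high, critical and low temperature respectively. Given a set $S'\subset[n]$ and a threshold $t$, the screening step computes, for every $i\in[n]$, $$\phi_i=\frac1{m\,a_k}\sum_{j=1}^m\sigma^{(j)}_i\sum_{l\in S'\setminus\{i\}}\sigma^{(j)}_l ,\qquad\text{and returns}\qquad S''=\{i\in[n]:\phi_i\ge t\}.$$ **Theorem.** At each of the high, critical and low temperatures the following holds. Let $\phi_i^\circ$ be the score $\phi_i$ computed with $S'=S$. 1. There is $\mu>0$ such that, for all sufficiently large $k$, $\mathbb E[\phi_i^\circ]\ge\mu$ for all $n$, all $S\subset[n]$ with $|S|=k$ and all $i\in S$. 2. For every $\mu$ as in 1 and every $t\in(0,\mu)$ there is a constant $C>0$, depending only on $\nu,\theta_1,\mu,t$ (and $\tau$ in the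 critical case), such that along every sequence of $(n,k,m,S)$ with $|S|=k\le n$, $k\to\infty$ and $m\ge C\,r_k\log n$ eventually, and for every random set $S'\subset[n]$ that is independent of the $m$ observations used in the screening step and satisfies $\mathbb P(|S'\,\triangle\,S|\le\varepsilon k)\to1$ for every fixed $\varepsilon>0$, $$\mathbb P(S''=S)=1-o(1).$$ Thus $m\gtrsim k\log n$ (high), $m\gtrsim k^{\frac1{2\tau-1}}\log n$ (critical), $m\gtrsim\log n$ (low) observations suffice. -/

import Mathlib

open MeasureTheory Filter Topology
open scoped symmDiff

noncomputable section

/-- The numerical value `±1` of a spin. -/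
def spin (b : Bool) : ℝ := if b then 1 else -1

/-- The unnormalised Gibbs weight of the configuration `x` given the external field `h`:
`exp (θ / (2 k) * (∑_{i ∈ S} σ_i)² + ∑_i h_i σ_i)` with `k = |S|`. -/
def gibbsWeight {n : ℕ} (θ : ℝ) (S : Finset (Fin n)) (h : Fin n → ℝ) (x : Fin n → Bool) : ℝ :=
  Real.exp (θ / (2 * (S.card : ℝ)) * (∑ i ∈ S, spin (x i)) ^ 2 + ∑ i, h i * spin (x i))

/-- The conditional probability of the configuration `x` given the external field `h`. -/
def gibbsProb {n : ℕ} (θ : ℝ) (S : Finset (Fin n)) (h : Fin n → ℝ) (x : Fin n → Bool) : ℝ :=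
  gibbsWeight θ S h x / ∑ y : Fin n → Bool, gibbsWeight θ S h y

/-- The law of one observation of the planted random field Curie-Weiss model with clique `S`:
the field has i.i.d. coordinates of law `ν`, and given the field the spins follow the Gibbs
distribution. -/
def plantedLaw {n : ℕ} (ν : Measure ℝ) (θ : ℝ) (S : Finset (Fin n)) :
    Measure (Fin n → Bool) :=
  ∑ x : Fin n → Bool,
    ENNReal.ofReal (∫ h, gibbsProb θ S h x ∂(Measure.pi fun _ : Fin n => ν)) • Measure.dirac x

theorem gibbsWeight_pos {n : ℕ} (θ : ℝ) (S : Finset (Fin n)) (h : Fin n → ℝ)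
    (x : Fin n → Bool) : 0 < gibbsWeight θ S h x := Real.exp_pos _

theorem gibbsProb_nonneg {n : ℕ} (θ : ℝ) (S : Finset (Fin n)) (h : Fin n → ℝ)
    (x : Fin n → Bool) : 0 ≤ gibbsProb θ S h x :=
  div_nonneg (gibbsWeight_pos θ S h x).le
    (Finset.sum_nonneg fun y _ => (gibbsWeight_pos θ S h y).le)

theorem sum_gibbsProb {n : ℕ} (θ : ℝ) (S : Finset (Fin n)) (h : Fin n → ℝ) :
    ∑ x : Fin n → Bool, gibbsProb θ S h x = 1 := by
  unfold gibbsProb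
  rw [← Finset.sum_div]
  exact div_self (Finset.sum_pos (fun y _ => gibbsWeight_pos θ S h y)
    Finset.univ_nonempty).ne'

theorem continuous_gibbsProb {n : ℕ} (θ : ℝ) (S : Finset (Fin n)) (x : Fin n → Bool) :
    Continuous fun h => gibbsProb θ S h x := by
  unfold gibbsProb
  have hc : ∀ y : Fin n → Bool, Continuous fun h => gibbsWeight θ S h y := by
    intro y
    unfold gibbsWeight
    fun_prop
  refine (hc x).div (continuous_finsetSum _ fun y _ => hc y) fun h => ?_
  exact (Finset.sum_pos (fun y _ => gibbsWeight_pos θ S h y) Finset.univ_nonempty).ne'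

theorem integrable_gibbsProb {n : ℕ} (ν : Measure ℝ) [IsProbabilityMeasure ν] (θ : ℝ)
    (S : Finset (Fin n)) (x : Fin n → Bool) :
    Integrable (fun h => gibbsProb θ S h x) (Measure.pi fun _ : Fin n => ν) := by
  refine Integrable.of_bound (continuous_gibbsProb θ S x).aestronglyMeasurable 1 ?_
  refine ae_of_all _ fun h => ?_
  rw [Real.norm_eq_abs, abs_of_nonneg (gibbsProb_nonneg θ S h x), ← sum_gibbsProb θ S h]
  exact Finset.single_le_sum (fun y _ => gibbsProb_nonneg θ S h y) (Finset.mem_univ x)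

instance isProbabilityMeasure_plantedLaw {n : ℕ} (ν : Measure ℝ) [IsProbabilityMeasure ν]
    (θ : ℝ) (S : Finset (Fin n)) : IsProbabilityMeasure (plantedLaw ν θ S) := by
  constructor
  unfold plantedLaw
  rw [Measure.finsetSum_apply]
  simp only [Measure.smul_apply, measure_univ, smul_eq_mul, mul_one]
  rw [← ENNReal.ofReal_sum_of_nonneg
    (fun x _ => integral_nonneg fun h => gibbsProb_nonneg θ S h x),
    ← integral_finsetSum _ (fun x _ => integrable_gibbsProb ν θ S x)]
  simp [sum_gibbsProb]

/-- `E[sech² h]`. -/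
def meanSechSq (ν : Measure ℝ) : ℝ := ∫ h, (1 / Real.cosh h ^ 2) ∂ν

/-- The limiting potential `x² / 2 - E[log cosh (√θ x + h)]`. -/
def potential (ν : Measure ℝ) (θ x : ℝ) : ℝ :=
  x ^ 2 / 2 - ∫ h, Real.log (Real.cosh (Real.sqrt θ * x + h)) ∂ν

/-- `0` is the unique global minimum of the potential. -/
def ZeroIsUniqueMinimum (ν : Measure ℝ) (θ : ℝ) : Prop :=
  ∀ x, x ≠ 0 → potential ν θ 0 < potential ν θ x

/-- High temperature. -/
def HighTemperature (ν : Measure ℝ) (θ : ℝ) : Prop :=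
  θ * meanSechSq ν < 1 ∧ ZeroIsUniqueMinimum ν θ

/-- Critical temperature, where the minimum at `0` has flatness `τ`: the leading term of the
Taylor expansion of the potential at its minimum is a positive multiple of `x ^ (2 τ)`. -/
def CriticalTemperature (ν : Measure ℝ) (θ : ℝ) (τ : ℕ) : Prop :=
  θ * meanSechSq ν = 1 ∧ ZeroIsUniqueMinimum ν θ ∧
    0 < iteratedDeriv (2 * τ) (potential ν θ) 0 ∧
    (fun x => potential ν θ x - potential ν θ 0 -
      iteratedDeriv (2 * τ) (potential ν θ) 0 / ((2 * τ).factorial : ℝ) * x ^ (2 * τ))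
      =O[𝓝 0] fun x => x ^ (2 * τ + 1)

/-- Low temperature (including the case that `θ E[sech² h] = 1` but the potential is smaller
elsewhere than at `0`). -/
def LowTemperature (ν : Measure ℝ) (θ : ℝ) : Prop :=
  1 < θ * meanSechSq ν ∨
    (θ * meanSechSq ν = 1 ∧ ∃ x, potential ν θ x < potential ν θ 0)

/-- The contribution of a single observation `x` to the screening score of the coordinate `i`:
`a⁻¹ σ_i ∑_{l ∈ T, l ≠ i} σ_l`. -/
def coordScore {n : ℕ} (a : ℝ) (T : Finset (Fin n)) (x : Fin n → Bool) (i : Fin n) : ℝ :=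
  spin (x i) * (∑ l ∈ T.erase i, spin (x l)) / a

/-- The screening score of the coordinate `i`: the average of the single contributions over the
`m` observations. -/
def score {n m : ℕ} (a : ℝ) (T : Finset (Fin n)) (X : Fin m → Fin n → Bool) (i : Fin n) : ℝ :=
  (∑ j, coordScore a T (X j) i) / (m : ℝ)

/-- The screening step: starting from the set `T`, return all coordinates whose score is at
least the threshold `t`. -/
def screen {n m : ℕ} (a t : ℝ) (T : Finset (Fin n)) (X : Fin m → Fin n → Bool) :
    Finset (Fin n) :=
  {i | t ≤ score a T X i}

/-- For large cliques, the expected score of every member of the clique, computed with the clique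
itself, is at least `μ`. -/
def SignalAtLeast (ν : Measure ℝ) (θ : ℝ) (a : ℕ → ℝ) (μ : ℝ) : Prop :=
  ∀ᶠ k : ℕ in atTop, ∀ (n : ℕ) (S : Finset (Fin n)), S.card = k → ∀ i ∈ S,
    μ ≤ ∫ x, coordScore (a k) S x i ∂(plantedLaw ν θ S)

/-- Screening at threshold `t` with normalisation `a k` is exact with probability `1 - o(1)` as
soon as `m ≥ C r(k) log n`, whenever the input set `S'` is independent of the `m` observations
used and satisfies `|S' ∆ S| = o(k)` with probability `1 - o(1)`. The probability space `Ω N`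
carries everything that the input set is computed from. -/
def ScreeningExact (ν : Measure ℝ) (θ : ℝ) (a r : ℕ → ℝ) (t C : ℝ) : Prop :=
  ∀ (n m : ℕ → ℕ) (S : ∀ N, Finset (Fin (n N)))
    (Ω : ℕ → Type) (_ : ∀ N, MeasurableSpace (Ω N)) (Q : ∀ N, Measure (Ω N))
    (S' : ∀ N, Ω N → Finset (Fin (n N))),
    (∀ N, IsProbabilityMeasure (Q N)) →
    (∀ N T, MeasurableSet {ω | S' N ω = T}) →
    Tendsto (fun N => (S N).card) atTop atTop →
    (∀ᶠ N in atTop, C * r (S N).card * Real.log (n N) ≤ (m N : ℝ)) →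
    (∀ ε : ℝ, 0 < ε → Tendsto
      (fun N => (Q N).real {ω | ((S' N ω ∆ S N).card : ℝ) ≤ ε * (S N).card}) atTop (𝓝 1)) →
    Tendsto (fun N => ((Q N).prod (Measure.pi fun _ : Fin (m N) => plantedLaw ν θ (S N))).real
      {p | screen (a (S N).card) t (S' N p.1) p.2 = S N}) atTop (𝓝 1)

/-- The screening guarantee with normalisation `a k` and sample size of order `r k * log n`: the
expected scores of clique members are bounded away from zero, and every threshold strictly
between zero and their lower limit gives exact recovery. -/
def ScreeningGuarantee (ν : Measure ℝ) (θ : ℝ) (a r : ℕ → ℝ) : Prop :=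
  (∃ μ : ℝ, 0 < μ ∧ SignalAtLeast ν θ a μ) ∧
    ∀ μ t : ℝ, SignalAtLeast ν θ a μ → 0 < t → t < μ →
      ∃ C : ℝ, 0 < C ∧ ScreeningExact ν θ a r t C

end

/-!
By the symmetry of the field, the score of a vertex outside the clique has mean zero, and the score
of a clique vertex has mean `(k - 1) / a_k` times the common correlation of two clique spins. The
point is therefore that this correlation is of order `a_k / k` at each temperature. This bounds the
means of the scores of clique members from below, and it bounds the second moment of a single score
by a multiple of its range, which is of order `k / a_k = r_k`. Bernstein's inequality for `m`
observations then gives an error probability `exp (-c m / r_k)` for each of the `n` vertices.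

The correlation is the second moment of the magnetization `M` of the clique up to a term of order
`1 / k`. At low temperature, Jensen's inequality compares the model with independent spins in a
shifted field, and a point where the potential lies below its value at zero forces `E[M²] ≥ c`.

When zero is the unique minimum, a large deviation bound first shows that `M` is close to zero.
Up to an error of order `1 / √k`, it solves the mean-field equation
`M = k⁻¹ ∑_{i ∈ S} tanh (θ M + h_i)`. The difference `M - E[tanh (θ M + h)]` is of order
`M ^ (2 τ - 1)` near zero, where `τ = 1` at high temperature, and the fluctuations of the random
field are of order `1 / √k`. Hence `M ^ (2 τ - 1)` is at most of order `1 / √k`, which is the upper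
bound on the correlation. At criticality the same equation also gives the lower bound, because the
fluctuation of `k⁻¹ ∑_{i ∈ S} tanh h_i` does not degenerate unless `h = 0`, and only
`M ^ (2 τ - 1)` can balance it. At high temperature the lower bound `c / k` comes from the
interaction of two clique spins alone: reversing the sign of the field at one vertex cancels the
contribution of unknown sign to its correlation with the others.
-/

noncomputable section

theorem integrable_of_continuous_of_abs_le {X : Type*} [TopologicalSpace X]
    [SecondCountableTopology X] [MeasurableSpace X] [OpensMeasurableSpace X] {P : Measure X}
    [IsFiniteMeasure P] {f : X → ℝ} (hf : Continuous f) {B : ℝ} (hB : ∀ x, |f x| ≤ B) :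
    Integrable f P :=
  Integrable.of_bound hf.aestronglyMeasurable B (ae_of_all _ hB)

/-! ### The quenched Gibbs average -/

section Spin

theorem abs_spin (b : Bool) : |spin b| = 1 := by cases b <;> simp [spin]

theorem spin_mul_self (b : Bool) : spin b * spin b = 1 := by cases b <;> simp [spin]

theorem spin_not (b : Bool) : spin (!b) = -spin b := by cases b <;> simp [spin]

theorem abs_sum_spin_le {ι : Type*} (T : Finset ι) (x : ι → Bool) :
    |∑ i ∈ T, spin (x i)| ≤ T.card := by
  simpa [abs_spin] using Finset.abs_sum_le_sum_abs (fun i => spin (x i)) T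

end Spin

/-- The law of an external field on the vertex set `ι` with independent coordinates of law `ν`. -/
abbrev iidField (ι : Type*) [Fintype ι] (ν : Measure ℝ) : Measure (ι → ℝ) :=
  Measure.pi fun _ : ι => ν

/-- The quenched Gibbs average of the observable `f`, that is, its mean given the external
field `h`. -/
def gibbsMean {n : ℕ} (θ : ℝ) (S : Finset (Fin n)) (h : Fin n → ℝ)
    (f : (Fin n → Bool) → ℝ) : ℝ := ∑ x, gibbsProb θ S h x * f x

section GibbsMean

variable {n : ℕ} {θ : ℝ} {S : Finset (Fin n)} {h : Fin n → ℝ}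

theorem gibbsMean_add (f g : (Fin n → Bool) → ℝ) :
    gibbsMean θ S h (fun x => f x + g x) = gibbsMean θ S h f + gibbsMean θ S h g := by
  simp [gibbsMean, mul_add, Finset.sum_add_distrib]

theorem gibbsMean_sub (f g : (Fin n → Bool) → ℝ) :
    gibbsMean θ S h (fun x => f x - g x) = gibbsMean θ S h f - gibbsMean θ S h g := by
  simp [gibbsMean, mul_sub, Finset.sum_sub_distrib]

theorem gibbsMean_const_mul (c : ℝ) (f : (Fin n → Bool) → ℝ) :
    gibbsMean θ S h (fun x => c * f x) = c * gibbsMean θ S h f := by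
  simp only [gibbsMean, Finset.mul_sum, mul_left_comm]

theorem gibbsMean_sum {ι : Type*} (s : Finset ι) (f : ι → (Fin n → Bool) → ℝ) :
    gibbsMean θ S h (fun x => ∑ i ∈ s, f i x) = ∑ i ∈ s, gibbsMean θ S h (f i) := by
  simp only [gibbsMean, Finset.mul_sum]
  exact Finset.sum_comm

theorem gibbsMean_const (c : ℝ) : gibbsMean θ S h (fun _ => c) = c := by
  simp [gibbsMean, ← Finset.sum_mul, sum_gibbsProb]

theorem gibbsMean_mono {f g : (Fin n → Bool) → ℝ} (hfg : ∀ x, f x ≤ g x) :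
    gibbsMean θ S h f ≤ gibbsMean θ S h g :=
  Finset.sum_le_sum fun x _ => mul_le_mul_of_nonneg_left (hfg x) (gibbsProb_nonneg _ _ _ _)

theorem abs_gibbsMean_le_gibbsMean_abs (f : (Fin n → Bool) → ℝ) :
    |gibbsMean θ S h f| ≤ gibbsMean θ S h (fun x => |f x|) := by
  refine (Finset.abs_sum_le_sum_abs _ _).trans (le_of_eq ?_)
  simp only [gibbsMean, abs_mul, abs_of_nonneg (gibbsProb_nonneg _ _ _ _)]

theorem abs_gibbsMean_le {f : (Fin n → Bool) → ℝ} {B : ℝ} (hf : ∀ x, |f x| ≤ B) :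
    |gibbsMean θ S h f| ≤ B :=
  (abs_gibbsMean_le_gibbsMean_abs f).trans
    ((gibbsMean_mono hf).trans (gibbsMean_const B).le)

theorem gibbsMean_eq_div (f : (Fin n → Bool) → ℝ) :
    gibbsMean θ S h f =
      (∑ x, gibbsWeight θ S h x * f x) / ∑ x, gibbsWeight θ S h x := by
  simp only [gibbsMean, gibbsProb, Finset.sum_div, div_mul_eq_mul_div]

theorem sum_gibbsWeight_pos : 0 < ∑ x, gibbsWeight θ S h x :=
  Finset.sum_pos (fun y _ => gibbsWeight_pos θ S h y) Finset.univ_nonempty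

theorem continuous_gibbsMean (θ : ℝ) (S : Finset (Fin n)) {f : (Fin n → ℝ) → (Fin n → Bool) → ℝ}
    (hf : ∀ x, Continuous fun h => f h x) :
    Continuous fun h => gibbsMean θ S h (f h) :=
  continuous_finsetSum _ fun x _ => (continuous_gibbsProb θ S x).mul (hf x)

variable (ν : Measure ℝ) [IsProbabilityMeasure ν]

theorem integrable_gibbsMean (θ : ℝ) (S : Finset (Fin n)) (f : (Fin n → Bool) → ℝ) :
    Integrable (fun h => gibbsMean θ S h f) (iidField (Fin n) ν) :=
  integrable_finsetSum _ fun x _ => (integrable_gibbsProb ν θ S x).mul_const _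

theorem integral_plantedLaw (θ : ℝ) (S : Finset (Fin n)) (f : (Fin n → Bool) → ℝ) :
    ∫ x, f x ∂(plantedLaw ν θ S) = ∫ h, gibbsMean θ S h f ∂(iidField (Fin n) ν) := by
  unfold plantedLaw gibbsMean
  rw [integral_finsetSum_measure fun x _ =>
      (Integrable.of_finite (μ := Measure.dirac x)).smul_measure ENNReal.ofReal_ne_top,
    integral_finsetSum _ fun x _ => (integrable_gibbsProb ν θ S x).mul_const _]
  refine Finset.sum_congr rfl fun x _ => ?_
  rw [integral_smul_measure, integral_dirac, integral_mul_const, ENNReal.toReal_ofReal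
    (integral_nonneg fun h => gibbsProb_nonneg θ S h x), smul_eq_mul]

end GibbsMean

/-! ### Symmetries of the planted law -/

/-- The configuration `x` with the spin at `i` reversed. -/
def flipAt {ι : Type*} [DecidableEq ι] (i : ι) (x : ι → Bool) : ι → Bool :=
  Function.update x i (!x i)

/-- The field `h` with the sign at `i` reversed. -/
def negAt {ι : Type*} [DecidableEq ι] (i : ι) (h : ι → ℝ) : ι → ℝ :=
  Function.update h i (-h i)

section Flip

variable {ι : Type*} [DecidableEq ι]

theorem flipAt_self (i : ι) (x : ι → Bool) : flipAt i x i = !x i :=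
  Function.update_self ..

theorem flipAt_of_ne {i j : ι} (hj : j ≠ i) (x : ι → Bool) : flipAt i x j = x j :=
  Function.update_of_ne hj ..

theorem involutive_flipAt (i : ι) : Function.Involutive (flipAt i) := fun x => by
  simp [flipAt]

theorem sum_spin_flipAt {i : ι} {T : Finset ι} (hi : i ∉ T) (x : ι → Bool) :
    ∑ l ∈ T, spin (flipAt i x l) = ∑ l ∈ T, spin (x l) :=
  Finset.sum_congr rfl fun l hl => by rw [flipAt_of_ne (ne_of_mem_of_not_mem hl hi)]

variable [Fintype ι]

theorem sum_comp_flipAt (i : ι) (f : (ι → Bool) → ℝ) : ∑ x, f (flipAt i x) = ∑ x, f x :=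
  Equiv.sum_comp (involutive_flipAt i).toPerm f

theorem sum_eq_sum_flip_average (i : ι) (f : (ι → Bool) → ℝ) :
    ∑ x, f x = ∑ x, (f x + f (flipAt i x)) / 2 := by
  rw [← Finset.sum_div, Finset.sum_add_distrib, sum_comp_flipAt, add_self_div_two]

variable {ν : Measure ℝ} [IsProbabilityMeasure ν] [ν.IsNegInvariant]

theorem measurePreserving_negAt (i : ι) :
    MeasurePreserving (negAt i) (iidField ι ν) (iidField ι ν) := by
  convert! measurePreserving_pi (fun _ : ι => ν) (fun _ : ι => ν)
    (f := fun j s => if j = i then -s else s) fun j => ?_ using 1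
  · ext h j
    by_cases hj : j = i <;> simp [negAt, hj]
  · by_cases hj : j = i
    · simpa only [hj, if_true] using Measure.measurePreserving_neg ν
    · simp only [hj, if_false]
      exact MeasurePreserving.id ν

theorem integral_comp_negAt (i : ι) {f : (ι → ℝ) → ℝ} (hf : Continuous f) :
    ∫ h, f (negAt i h) ∂(iidField ι ν) = ∫ h, f h ∂(iidField ι ν) := by
  have hmp := measurePreserving_negAt (ν := ν) i
  conv_rhs => rw [← hmp.map_eq]
  rw [integral_map hmp.measurable.aemeasurable hf.aestronglyMeasurable]

end Flip

section Symmetry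

variable {n : ℕ} {ν : Measure ℝ} [IsProbabilityMeasure ν] {θ : ℝ} {S : Finset (Fin n)}
  {π : Equiv.Perm (Fin n)} {i : Fin n}

theorem gibbsWeight_negAt_flipAt (hi : i ∉ S) (h : Fin n → ℝ) (x : Fin n → Bool) :
    gibbsWeight θ S (negAt i h) (flipAt i x) = gibbsWeight θ S h x := by
  have hfield : ∑ j, negAt i h j * spin (flipAt i x j) = ∑ j, h j * spin (x j) :=
    Finset.sum_congr rfl fun j _ => by
      by_cases hj : j = i <;> simp [negAt, flipAt, hj, spin_not]
  rw [gibbsWeight, gibbsWeight, sum_spin_flipAt hi, hfield]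

theorem gibbsProb_negAt_flipAt (hi : i ∉ S) (h : Fin n → ℝ) (x : Fin n → Bool) :
    gibbsProb θ S (negAt i h) (flipAt i x) = gibbsProb θ S h x := by
  unfold gibbsProb
  rw [← sum_comp_flipAt i (gibbsWeight θ S (negAt i h))]
  simp only [gibbsWeight_negAt_flipAt hi]

theorem integral_spin_mul_eq_zero [ν.IsNegInvariant] (hi : i ∉ S) {f : (Fin n → Bool) → ℝ}
    (hf : ∀ x, f (flipAt i x) = f x) :
    ∫ x, spin (x i) * f x ∂(plantedLaw ν θ S) = 0 := by
  rw [integral_plantedLaw]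
  have hodd : ∀ h, gibbsMean θ S (negAt i h) (fun x => spin (x i) * f x) =
      -gibbsMean θ S h (fun x => spin (x i) * f x) := by
    intro h
    unfold gibbsMean
    rw [← sum_comp_flipAt i, ← Finset.sum_neg_distrib]
    refine Finset.sum_congr rfl fun x _ => ?_
    beta_reduce
    rw [gibbsProb_negAt_flipAt hi, hf, flipAt_self, spin_not]
    ring
  have hinv := integral_comp_negAt (ν := ν) i
    (continuous_gibbsMean θ S (f := fun _ x => spin (x i) * f x) fun x => continuous_const)
  simp only [hodd, integral_neg] at hinv
  linarith

theorem measurePreserving_comp_perm {ι : Type*} [Fintype ι] (ν : Measure ℝ)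
    [IsProbabilityMeasure ν] (π : Equiv.Perm ι) :
    MeasurePreserving (fun h : ι → ℝ => h ∘ π) (iidField ι ν) (iidField ι ν) :=
  measurePreserving_arrowCongr' (fun _ => ν) (fun _ => ν) π.symm (MeasurableEquiv.refl ℝ)
    fun _ => MeasurePreserving.id ν

theorem gibbsWeight_comp_perm (hπ : ∀ i, π i ∈ S ↔ i ∈ S) (h : Fin n → ℝ) (x : Fin n → Bool) :
    gibbsWeight θ S (h ∘ π) (x ∘ π) = gibbsWeight θ S h x := by
  have hclique : ∑ i ∈ S, spin ((x ∘ π) i) = ∑ i ∈ S, spin (x i) :=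
    Finset.sum_bijective π π.bijective (fun i => (hπ i).symm) fun i _ => rfl
  have hfield : ∑ i, (h ∘ π) i * spin ((x ∘ π) i) = ∑ i, h i * spin (x i) :=
    Equiv.sum_comp π fun i => h i * spin (x i)
  rw [gibbsWeight, gibbsWeight, hclique, hfield]

theorem sum_comp_perm {ι : Type*} [Fintype ι] [DecidableEq ι] (π : Equiv.Perm ι)
    (f : (ι → Bool) → ℝ) : ∑ x, f (x ∘ π) = ∑ x, f x :=
  Equiv.sum_comp (π.symm.arrowCongr (Equiv.refl Bool)) f

theorem gibbsMean_comp_perm (hπ : ∀ i, π i ∈ S ↔ i ∈ S) (h : Fin n → ℝ)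
    (f : (Fin n → Bool) → ℝ) :
    gibbsMean θ S (h ∘ π) f = gibbsMean θ S h fun x => f (x ∘ π) := by
  rw [gibbsMean_eq_div, gibbsMean_eq_div, ← sum_comp_perm π,
    ← sum_comp_perm π (gibbsWeight θ S (h ∘ π))]
  simp only [gibbsWeight_comp_perm hπ]

theorem integral_comp_perm (hπ : ∀ i, π i ∈ S ↔ i ∈ S) (f : (Fin n → Bool) → ℝ) :
    ∫ x, f (x ∘ π) ∂(plantedLaw ν θ S) = ∫ x, f x ∂(plantedLaw ν θ S) := by
  have hmp := measurePreserving_comp_perm ν π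
  have hcont : Continuous fun h => gibbsMean θ S h f :=
    continuous_gibbsMean θ S (f := fun _ => f) fun x => continuous_const
  rw [integral_plantedLaw, integral_plantedLaw]
  conv_rhs => rw [← hmp.map_eq]
  rw [integral_map hmp.measurable.aemeasurable hcont.aestronglyMeasurable]
  simp only [gibbsMean_comp_perm hπ]

end Symmetry

/-! ### Correlations -/

/-- The correlation of the spins at `i` and `j` under the planted law. -/
def pairCorr {n : ℕ} (ν : Measure ℝ) (θ : ℝ) (S : Finset (Fin n)) (i j : Fin n) :
    ℝ := ∫ x, spin (x i) * spin (x j) ∂(plantedLaw ν θ S)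

section PairCorr

theorem pairCorr_comm {n : ℕ} (ν : Measure ℝ) (θ : ℝ) (S : Finset (Fin n)) (i j : Fin n) :
    pairCorr ν θ S i j = pairCorr ν θ S j i := by
  simp only [pairCorr, mul_comm]

variable {n : ℕ} {ν : Measure ℝ} [IsProbabilityMeasure ν] {θ : ℝ} {S : Finset (Fin n)}

theorem pairCorr_self (i : Fin n) : pairCorr ν θ S i i = 1 := by
  simp [pairCorr, spin_mul_self]

theorem abs_pairCorr_le_one (i j : Fin n) : |pairCorr ν θ S i j| ≤ 1 := by
  simpa [pairCorr] using norm_integral_le_of_norm_le_const (μ := plantedLaw ν θ S)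
    (f := fun x => spin (x i) * spin (x j)) (C := 1)
    (ae_of_all _ fun x => by simp [abs_spin])

theorem pairCorr_of_notMem [ν.IsNegInvariant] {i j : Fin n} (hij : i ≠ j) (hi : i ∉ S) :
    pairCorr ν θ S i j = 0 :=
  integral_spin_mul_eq_zero hi fun x => by rw [flipAt_of_ne hij.symm]

theorem pairCorr_perm {π : Equiv.Perm (Fin n)} (hπ : ∀ i, π i ∈ S ↔ i ∈ S) (i j : Fin n) :
    pairCorr ν θ S (π i) (π j) = pairCorr ν θ S i j :=
  integral_comp_perm hπ fun x => spin (x i) * spin (x j)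

theorem pairCorr_eq_of_mem_right {i j l : Fin n} (hj : j ∈ S) (hl : l ∈ S)
    (hij : i ≠ j) (hil : i ≠ l) : pairCorr ν θ S i j = pairCorr ν θ S i l := by
  have hswap : ∀ a, Equiv.swap j l a ∈ S ↔ a ∈ S := by grind
  have hperm := pairCorr_perm (ν := ν) (θ := θ) hswap i j
  rwa [Equiv.swap_apply_of_ne_of_ne hij hil, Equiv.swap_apply_left, eq_comm] at hperm

theorem pairCorr_eq_of_mem {i j i' j' : Fin n} (hi : i ∈ S) (hj : j ∈ S) (hi' : i' ∈ S)
    (hj' : j' ∈ S) (hij : i ≠ j) (hij' : i' ≠ j') :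
    pairCorr ν θ S i j = pairCorr ν θ S i' j' := by
  by_cases hcross : i = j'
  · rw [pairCorr_comm ν θ S i' j', ← hcross]
    exact pairCorr_eq_of_mem_right hj hi' hij fun e => hij' (e ▸ hcross)
  · rw [pairCorr_eq_of_mem_right hj hj' hij hcross, pairCorr_comm ν θ S i j',
      pairCorr_comm ν θ S i' j']
    exact pairCorr_eq_of_mem_right hi hi' (Ne.symm hcross) hij'.symm

theorem sum_erase_pairCorr {T : Finset (Fin n)} (hT : T ⊆ S) {i j l : Fin n} (hi : i ∈ S)
    (hj : j ∈ S) (hij : i ≠ j) (hl : l ∈ T) :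
    ∑ l' ∈ T.erase l, pairCorr ν θ S l l' = ((T.card : ℝ) - 1) * pairCorr ν θ S i j := by
  rw [Finset.sum_congr rfl fun l' hl' => pairCorr_eq_of_mem (hT hl)
    (hT (Finset.mem_of_mem_erase hl')) hi hj (Finset.ne_of_mem_erase hl').symm hij,
    Finset.sum_const, nsmul_eq_mul, Finset.cast_card_erase_of_mem hl]

theorem integral_coordScore (a : ℝ) (T : Finset (Fin n)) (i : Fin n) :
    ∫ x, coordScore a T x i ∂(plantedLaw ν θ S) =
      (∑ l ∈ T.erase i, pairCorr ν θ S i l) / a := by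
  unfold coordScore pairCorr
  rw [integral_div, ← integral_finsetSum _ fun l _ => Integrable.of_finite]
  simp only [Finset.mul_sum]

theorem integral_coordScore_clique (a : ℝ) {i j l : Fin n} (hi : i ∈ S) (hj : j ∈ S)
    (hij : i ≠ j) (hl : l ∈ S) :
    ∫ x, coordScore a S x l ∂(plantedLaw ν θ S) =
      ((S.card : ℝ) - 1) * pairCorr ν θ S i j / a := by
  rw [integral_coordScore, sum_erase_pairCorr subset_rfl hi hj hij hl]

theorem integral_sq_sum_spin (T : Finset (Fin n)) :
    ∫ x, (∑ i ∈ T, spin (x i)) ^ 2 ∂(plantedLaw ν θ S) =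
      ∑ i ∈ T, ∑ j ∈ T, pairCorr ν θ S i j := by
  unfold pairCorr
  simp_rw [← integral_finsetSum T fun _ _ => Integrable.of_finite (μ := plantedLaw ν θ S)]
  simp only [sq, Finset.sum_mul_sum]

theorem integral_sq_sum_spin_of_subset {T : Finset (Fin n)} (hT : T ⊆ S) {i j : Fin n}
    (hi : i ∈ S) (hj : j ∈ S) (hij : i ≠ j) :
    ∫ x, (∑ l ∈ T, spin (x l)) ^ 2 ∂(plantedLaw ν θ S) =
      T.card + T.card * ((T.card : ℝ) - 1) * pairCorr ν θ S i j := by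
  have hrow : ∀ l ∈ T, ∑ l' ∈ T, pairCorr ν θ S l l' =
      1 + ((T.card : ℝ) - 1) * pairCorr ν θ S i j := fun l hl => by
    rw [← Finset.add_sum_erase _ _ hl, pairCorr_self, sum_erase_pairCorr hT hi hj hij hl]
  rw [integral_sq_sum_spin, Finset.sum_congr rfl hrow, Finset.sum_const, nsmul_eq_mul]
  ring

end PairCorr

/-! ### A Bernstein inequality -/

section Bernstein

variable {α : Type*} [MeasurableSpace α] {P : Measure α} [IsProbabilityMeasure P]

theorem integrable_of_measurable_of_abs_le {f : α → ℝ} (hf : Measurable f) {B : ℝ}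
    (hB : ∀ x, |f x| ≤ B) : Integrable f P :=
  Integrable.of_bound hf.aestronglyMeasurable B (ae_of_all _ hB)

theorem integral_exp_mul_le {Z : α → ℝ} (hZ : Measurable Z) {B l : ℝ} (hB : ∀ x, |Z x| ≤ B)
    (hl : 0 ≤ l) (hlB : l * B ≤ 1) :
    ∫ x, Real.exp (l * Z x) ∂P ≤ 1 + l * ∫ x, Z x ∂P + l ^ 2 * ∫ x, Z x ^ 2 ∂P := by
  have hlZ : ∀ x, |l * Z x| ≤ 1 := fun x => by
    rw [abs_mul, abs_of_nonneg hl]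
    exact (mul_le_mul_of_nonneg_left (hB x) hl).trans hlB
  have hint : Integrable (fun x => 1 + l * Z x) P :=
    (integrable_const 1).add (integrable_of_measurable_of_abs_le (hZ.const_mul l) hlZ)
  have hint_sq : Integrable (fun x => (l * Z x) ^ 2) P :=
    integrable_of_measurable_of_abs_le ((hZ.const_mul l).pow_const 2) (B := 1) fun x => by
      rw [abs_pow]; exact pow_le_one₀ (abs_nonneg _) (hlZ x)
  have hint_exp : Integrable (fun x => Real.exp (l * Z x)) P :=
    integrable_of_measurable_of_abs_le (hZ.const_mul l).exp (B := Real.exp 1) fun x => by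
      rw [Real.abs_exp]; exact Real.exp_le_exp.2 (abs_le.1 (hlZ x)).2
  calc ∫ x, Real.exp (l * Z x) ∂P ≤ ∫ x, (1 + l * Z x + (l * Z x) ^ 2) ∂P :=
        integral_mono hint_exp (hint.add hint_sq) fun x => by
          linarith [(abs_le.1 (Real.abs_exp_sub_one_sub_id_le (hlZ x))).2]
    _ = 1 + l * ∫ x, Z x ∂P + l ^ 2 * ∫ x, Z x ^ 2 ∂P := by
        rw [integral_add hint hint_sq, integral_add (integrable_const 1)
          (integrable_of_measurable_of_abs_le (hZ.const_mul l) hlZ), integral_const_mul]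
        simp only [mul_pow, integral_const_mul, integral_const, probReal_univ, smul_eq_mul, mul_one]

variable {ι : Type*} [Fintype ι]

theorem measureReal_sum_nonneg_le {Z : α → ℝ} (hZ : Measurable Z) {B l : ℝ}
    (hB : ∀ x, |Z x| ≤ B) (hl : 0 ≤ l) (hlB : l * B ≤ 1) :
    (Measure.pi fun _ : ι => P).real {X | 0 ≤ ∑ j, Z (X j)} ≤
      Real.exp (Fintype.card ι * (l * ∫ x, Z x ∂P + l ^ 2 * ∫ x, Z x ^ 2 ∂P)) := by
  have hmeas : Measurable fun X : ι → α => ∑ j, Z (X j) :=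
    Finset.measurable_sum _ fun j _ => hZ.comp (measurable_pi_apply j)
  have hint : Integrable (fun X : ι → α => Real.exp (l * ∑ j, Z (X j)))
      (Measure.pi fun _ : ι => P) := by
    refine integrable_of_measurable_of_abs_le (hmeas.const_mul l).exp
      (B := Real.exp (l * (Fintype.card ι * B))) fun X => ?_
    rw [Real.abs_exp, Real.exp_le_exp]
    refine mul_le_mul_of_nonneg_left ?_ hl
    refine (Finset.sum_le_sum fun j _ => (abs_le.1 (hB (X j))).2).trans ?_
    simp
  refine (ProbabilityTheory.measure_ge_le_exp_mul_mgf 0 hl hint).trans ?_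
  rw [mul_zero, Real.exp_zero, one_mul]
  simp only [ProbabilityTheory.mgf, Finset.mul_sum, Real.exp_sum]
  rw [integral_fintype_prod_eq_prod (μ := fun _ : ι => P) (fun _ x => Real.exp (l * Z x)),
    Finset.prod_const, Finset.card_univ, Real.exp_nat_mul]
  refine pow_le_pow_left₀ (integral_nonneg fun x => (Real.exp_pos _).le) ?_ _
  refine (integral_exp_mul_le hZ hB hl hlB).trans ?_
  linarith [Real.add_one_le_exp (l * ∫ x, Z x ∂P + l ^ 2 * ∫ x, Z x ^ 2 ∂P)]

theorem measureReal_sum_nonneg_le_exp_neg {Z : α → ℝ} (hZ : Measurable Z) {B V δ : ℝ}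
    (hB₀ : 0 < B) (hδ : 0 < δ) (hB : ∀ x, |Z x| ≤ B) (hV : ∫ x, Z x ^ 2 ∂P ≤ V)
    (hmean : ∫ x, Z x ∂P ≤ -δ) :
    (Measure.pi fun _ : ι => P).real {X | 0 ≤ ∑ j, Z (X j)} ≤
      Real.exp (-(δ ^ 2 / (2 * (2 * V + δ * B)) * Fintype.card ι)) := by
  have hV₀ : 0 ≤ V := (integral_nonneg fun x => sq_nonneg (Z x)).trans hV
  -- The tilt `l` minimises, up to constants, `-l δ + l² V` under the constraint `l B ≤ 1`.
  set l := δ / (2 * V + δ * B) with hl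
  have hden : 0 < 2 * V + δ * B := by positivity
  have hlB : l * B ≤ 1 := by
    rw [hl, div_mul_eq_mul_div, div_le_one hden]
    linarith
  have hlV : l * V ≤ δ / 2 := by
    rw [hl, div_mul_eq_mul_div, div_le_iff₀ hden]
    nlinarith [mul_pos hδ (mul_pos hδ hB₀)]
  have hl₀ : 0 < l := by positivity
  refine (measureReal_sum_nonneg_le hZ hB hl₀.le hlB).trans (Real.exp_le_exp.2 ?_)
  have hexponent : l * ∫ x, Z x ∂P + l ^ 2 * ∫ x, Z x ^ 2 ∂P ≤ -(l * δ / 2) := by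
    calc l * ∫ x, Z x ∂P + l ^ 2 * ∫ x, Z x ^ 2 ∂P ≤ l * -δ + l ^ 2 * V := by gcongr
      _ = l * (-δ + l * V) := by ring
      _ ≤ l * (-δ + δ / 2) := by gcongr
      _ = -(l * δ / 2) := by ring
  have hrate : δ ^ 2 / (2 * (2 * V + δ * B)) = l * δ / 2 := by rw [hl]; field_simp
  rw [hrate, ← neg_mul, mul_comm]
  exact mul_le_mul_of_nonneg_right hexponent (Nat.cast_nonneg _)

theorem measureReal_le_average_le {Y : α → ℝ} (hY : Measurable Y) {B V δ t : ℝ}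
    (hB₀ : 0 < B) (hδ : 0 < δ) (hB : ∀ x, |Y x - t| ≤ B) (hV : ∫ x, (Y x - t) ^ 2 ∂P ≤ V)
    (hmean : ∫ x, Y x ∂P ≤ t - δ) :
    (Measure.pi fun _ : ι => P).real {X | t ≤ (∑ j, Y (X j)) / Fintype.card ι} ≤
      Real.exp (-(δ ^ 2 / (2 * (2 * V + δ * B)) * Fintype.card ι)) := by
  have hYint : Integrable Y P :=
    integrable_of_measurable_of_abs_le hY (B := B + |t|) fun x => by
      linarith [abs_sub_abs_le_abs_sub (Y x) t, hB x]
  refine (measureReal_mono fun X hX => ?_).trans (measureReal_sum_nonneg_le_exp_neg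
    (hY.sub_const t) hB₀ hδ hB hV ?_)
  · rw [Set.mem_ofPred_eq] at hX
    rw [Set.mem_ofPred_eq, Finset.sum_sub_distrib, Finset.sum_const, nsmul_eq_mul,
      Finset.card_univ]
    rcases (Fintype.card ι).eq_zero_or_pos with hcard | hcard
    · have := Fintype.card_eq_zero_iff.1 hcard
      simp
    · rw [le_div_iff₀ (by exact_mod_cast hcard)] at hX
      linarith
  · rw [integral_sub hYint (integrable_const t), integral_const, probReal_univ, one_smul]
    linarith

theorem measureReal_average_le_le {Y : α → ℝ} (hY : Measurable Y) {B V δ t : ℝ}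
    (hB₀ : 0 < B) (hδ : 0 < δ) (hB : ∀ x, |Y x - t| ≤ B) (hV : ∫ x, (Y x - t) ^ 2 ∂P ≤ V)
    (hmean : t + δ ≤ ∫ x, Y x ∂P) :
    (Measure.pi fun _ : ι => P).real {X | (∑ j, Y (X j)) / Fintype.card ι ≤ t} ≤
      Real.exp (-(δ ^ 2 / (2 * (2 * V + δ * B)) * Fintype.card ι)) := by
  have hB' : ∀ x, |-Y x - -t| ≤ B := fun x => by
    rw [← neg_sub', abs_neg]; exact hB x
  have hV' : ∫ x, (-Y x - -t) ^ 2 ∂P ≤ V := by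
    simpa only [← neg_sub', neg_sq] using hV
  have hmean' : ∫ x, -Y x ∂P ≤ -t - δ := by
    rw [integral_neg]; linarith
  simpa only [Finset.sum_neg_distrib, neg_div, neg_le_neg_iff] using
    measureReal_le_average_le (ι := ι) (Y := fun x => -Y x) hY.neg hB₀ hδ hB' hV' hmean'

end Bernstein

/-! ### Exactness of the screening step from correlation bounds -/

section SymmDiff

variable {ι : Type*} [DecidableEq ι] {S T : Finset ι}

theorem card_le_two_mul_of_card_symmDiff_le {ε : ℝ} (hε : ε ≤ 1)
    (h : ((T ∆ S).card : ℝ) ≤ ε * S.card) : (T.card : ℝ) ≤ 2 * S.card := by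
  have hcard : T.card ≤ (T ∆ S).card + S.card :=
    (Finset.card_le_card (by grind [Finset.mem_symmDiff])).trans (Finset.card_union_le _ _)
  have hcast : (T.card : ℝ) ≤ (T ∆ S).card + S.card := by exact_mod_cast hcard
  linarith [mul_le_mul_of_nonneg_right hε (Nat.cast_nonneg (α := ℝ) S.card)]

theorem card_sub_one_sub_card_symmDiff_le (i : ι) :
    (S.card : ℝ) - 1 - (T ∆ S).card ≤ ((T ∩ S).erase i).card := by
  have hcard : S.card ≤ (T ∆ S).card + (((T ∩ S).erase i).card + 1) := by
    refine (Finset.card_le_card ?_).trans ((Finset.card_union_le _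
      (insert i ((T ∩ S).erase i))).trans (Nat.add_le_add_left (Finset.card_insert_le _ _) _))
    grind [Finset.mem_symmDiff]
  have hcast : (S.card : ℝ) ≤ (T ∆ S).card + (((T ∩ S).erase i).card + 1) := by
    exact_mod_cast hcard
  linarith

end SymmDiff

section CoordScore

variable {n : ℕ} {ν : Measure ℝ} [IsProbabilityMeasure ν] {θ : ℝ} {S T : Finset (Fin n)}

theorem abs_coordScore_le {a : ℝ} (ha : 0 < a) (x : Fin n → Bool) (i : Fin n) :
    |coordScore a T x i| ≤ T.card / a := by
  rw [coordScore, abs_div, abs_of_pos ha, abs_mul, abs_spin, one_mul]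
  gcongr
  exact (abs_sum_spin_le _ x).trans (Nat.cast_le.2 Finset.card_erase_le)

variable [ν.IsNegInvariant]

theorem integral_sq_sum_spin_le {ρ : ℝ} (hρ₀ : 0 ≤ ρ)
    (hρ : ∀ i ∈ S, ∀ j ∈ S, i ≠ j → pairCorr ν θ S i j ≤ ρ) :
    ∫ x, (∑ i ∈ T, spin (x i)) ^ 2 ∂(plantedLaw ν θ S) ≤ T.card + (T.card : ℝ) ^ 2 * ρ := by
  have hpair : ∀ j l, pairCorr ν θ S j l ≤ (if j = l then 1 else 0) + ρ := by
    intro j l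
    rcases eq_or_ne j l with rfl | hjl
    · rw [if_pos rfl, pairCorr_self]; linarith
    rw [if_neg hjl, zero_add]
    by_cases hj : j ∈ S
    · by_cases hl : l ∈ S
      · exact hρ j hj l hl hjl
      · rwa [pairCorr_comm, pairCorr_of_notMem hjl.symm hl]
    · rwa [pairCorr_of_notMem hjl hj]
  calc ∫ x, (∑ i ∈ T, spin (x i)) ^ 2 ∂(plantedLaw ν θ S)
      = ∑ j ∈ T, ∑ l ∈ T, pairCorr ν θ S j l := integral_sq_sum_spin T
    _ ≤ ∑ j ∈ T, ∑ l ∈ T, ((if j = l then 1 else 0) + ρ) :=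
        Finset.sum_le_sum fun j _ => Finset.sum_le_sum fun l _ => hpair j l
    _ = ∑ j ∈ T, (1 + T.card * ρ) := Finset.sum_congr rfl fun j hj => by
        rw [Finset.sum_add_distrib, Finset.sum_ite_eq, if_pos hj, Finset.sum_const, nsmul_eq_mul]
    _ = T.card + (T.card : ℝ) ^ 2 * ρ := by rw [Finset.sum_const, nsmul_eq_mul]; ring

theorem integral_sq_coordScore_le (a : ℝ) {ρ : ℝ} (hρ₀ : 0 ≤ ρ)
    (hρ : ∀ i ∈ S, ∀ j ∈ S, i ≠ j → pairCorr ν θ S i j ≤ ρ) (i : Fin n) :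
    ∫ x, coordScore a T x i ^ 2 ∂(plantedLaw ν θ S) ≤
      (T.card + (T.card : ℝ) ^ 2 * ρ) / a ^ 2 := by
  have hsq : ∀ x, coordScore a T x i ^ 2 = (∑ l ∈ T.erase i, spin (x l)) ^ 2 / a ^ 2 := fun x => by
    rw [coordScore, div_pow, mul_pow, sq (spin _), spin_mul_self, one_mul]
  have hcard : ((T.erase i).card : ℝ) ≤ T.card := Nat.cast_le.2 Finset.card_erase_le
  simp only [hsq, integral_div]
  gcongr
  refine (integral_sq_sum_spin_le hρ₀ hρ).trans ?_
  gcongr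

theorem integral_coordScore_of_notMem (a : ℝ) {i : Fin n} (hi : i ∉ S) :
    ∫ x, coordScore a T x i ∂(plantedLaw ν θ S) = 0 := by
  rw [integral_coordScore, Finset.sum_eq_zero, zero_div]
  intro l hl
  exact pairCorr_of_notMem (Finset.ne_of_mem_erase hl).symm hi

theorem integral_coordScore_of_mem (a : ℝ) {i j l : Fin n} (hi : i ∈ S) (hj : j ∈ S)
    (hij : i ≠ j) (hl : l ∈ S) :
    ∫ x, coordScore a T x l ∂(plantedLaw ν θ S) =
      (((T ∩ S).erase l).card : ℝ) * pairCorr ν θ S i j / a := by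
  have hsub : (T ∩ S).erase l ⊆ T.erase l :=
    Finset.erase_subset_erase _ Finset.inter_subset_left
  have houtside : ∀ l' ∈ T.erase l, l' ∉ (T ∩ S).erase l → pairCorr ν θ S l l' = 0 :=
    fun l' hl' hl'' => by
      rw [pairCorr_comm, pairCorr_of_notMem (Finset.ne_of_mem_erase hl') (by grind)]
  rw [integral_coordScore, ← Finset.sum_subset hsub houtside,
    Finset.sum_congr rfl fun l' hl' => pairCorr_eq_of_mem hl
      (Finset.mem_inter.1 (Finset.mem_of_mem_erase hl')).2 hi hj
      (Finset.ne_of_mem_erase hl').symm hij, Finset.sum_const, nsmul_eq_mul]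

theorem le_integral_coordScore_of_mem {a μ ε : ℝ} (hS : 2 ≤ S.card) (hμ : 0 < μ)
    (hμS : ∀ i ∈ S, μ ≤ ∫ x, coordScore a S x i ∂(plantedLaw ν θ S)) (hε₀ : 0 ≤ ε)
    (hε : 2 * ε ≤ 1) (hT : ((T ∆ S).card : ℝ) ≤ ε * S.card) {i : Fin n} (hi : i ∈ S) :
    (1 - 2 * ε) * μ ≤ ∫ x, coordScore a T x i ∂(plantedLaw ν θ S) := by
  obtain ⟨i₀, hi₀, j₀, hj₀, hij₀⟩ := Finset.one_lt_card.1 hS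
  have hcard : (2 : ℝ) ≤ S.card := by exact_mod_cast hS
  have hsignal := hμS i hi
  rw [integral_coordScore_clique a hi₀ hj₀ hij₀ hi, mul_div_assoc] at hsignal
  rw [integral_coordScore_of_mem a hi₀ hj₀ hij₀ hi, mul_div_assoc]
  have hcorr : 0 < pairCorr ν θ S i₀ j₀ / a :=
    pos_of_mul_pos_right (hμ.trans_le hsignal) (by linarith)
  have hoverlap : (1 - 2 * ε) * ((S.card : ℝ) - 1) ≤ ((T ∩ S).erase i).card := by
    nlinarith [card_sub_one_sub_card_symmDiff_le (S := S) (T := T) i]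
  calc (1 - 2 * ε) * μ
      ≤ (1 - 2 * ε) * (((S.card : ℝ) - 1) * (pairCorr ν θ S i₀ j₀ / a)) := by
        gcongr
    _ = (1 - 2 * ε) * ((S.card : ℝ) - 1) * (pairCorr ν θ S i₀ j₀ / a) := by ring
    _ ≤ ((T ∩ S).erase i).card * (pairCorr ν θ S i₀ j₀ / a) := by gcongr

end CoordScore

/-- The exponential rate, per `r` observations, at which a single coordinate is misclassified by
screening at threshold `t`, when the expected score of clique members is at least `μ` and the
correlations inside a clique of `k` vertices are at most `K * a k / k`. It is the rate of the
Bernstein inequality for scores of range of order `r` and second moment of order `r`. -/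
def screeningRate (K μ t : ℝ) : ℝ :=
  min t ((μ - t) / 2) ^ 2 /
    (2 * (2 * (2 * t ^ 2 + 2 * (2 + 4 * K)) + min t ((μ - t) / 2) * (t + 2)))

section ScreeningError

variable {K μ t : ℝ}

theorem screeningRate_pos (hK : 0 ≤ K) (ht : 0 < t) (htμ : t < μ) : 0 < screeningRate K μ t := by
  have hmargin : 0 < min t ((μ - t) / 2) := lt_min ht (by linarith)
  exact div_pos (pow_pos hmargin 2) (by positivity)

variable {n : ℕ} {ν : Measure ℝ} [IsProbabilityMeasure ν] [ν.IsNegInvariant] {θ : ℝ}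
  {S T : Finset (Fin n)} {a r : ℝ}

theorem abs_coordScore_sub_le (ha : 1 ≤ a) (hr : 1 ≤ r) (har : a * r = S.card) (ht : 0 ≤ t)
    (hT : (T.card : ℝ) ≤ 2 * S.card) (x : Fin n → Bool) (i : Fin n) :
    |coordScore a T x i - t| ≤ (t + 2) * r := by
  have hscore : |coordScore a T x i| ≤ 2 * r := by
    refine (abs_coordScore_le (by linarith) x i).trans ?_
    rw [div_le_iff₀ (by linarith)]
    linarith
  refine (abs_sub _ _).trans ?_
  rw [abs_of_nonneg ht]
  nlinarith

theorem integral_sq_coordScore_sub_le (ha : 1 ≤ a) (hr : 1 ≤ r) (har : a * r = S.card)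
    (hK : 0 ≤ K) (hρ : ∀ i ∈ S, ∀ j ∈ S, i ≠ j → pairCorr ν θ S i j ≤ K * a / S.card)
    (hT : (T.card : ℝ) ≤ 2 * S.card) (t : ℝ) (i : Fin n) :
    ∫ x, (coordScore a T x i - t) ^ 2 ∂(plantedLaw ν θ S) ≤
      (2 * t ^ 2 + 2 * (2 + 4 * K)) * r := by
  have hcard : 0 < (S.card : ℝ) := by rw [← har]; positivity
  have hsecond : ∫ x, coordScore a T x i ^ 2 ∂(plantedLaw ν θ S) ≤ (2 + 4 * K) * r := by
    refine (integral_sq_coordScore_le a (by positivity) hρ i).trans ?_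
    rw [div_le_iff₀ (by positivity)]
    calc T.card + (T.card : ℝ) ^ 2 * (K * a / S.card)
        ≤ 2 * S.card + (2 * S.card) ^ 2 * (K * a / S.card) := by gcongr
      _ = (2 + 4 * K * a) * S.card := by field_simp; ring
      _ ≤ (2 * a + 4 * K * a) * S.card := by gcongr; linarith
      _ = (2 + 4 * K) * r * a ^ 2 := by rw [← har]; ring
  calc ∫ x, (coordScore a T x i - t) ^ 2 ∂(plantedLaw ν θ S)
      ≤ ∫ x, (2 * t ^ 2 + 2 * coordScore a T x i ^ 2) ∂(plantedLaw ν θ S) :=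
        integral_mono Integrable.of_finite Integrable.of_finite fun x => by
          nlinarith [sq_nonneg (coordScore a T x i + t)]
    _ = 2 * t ^ 2 + 2 * ∫ x, coordScore a T x i ^ 2 ∂(plantedLaw ν θ S) := by
        rw [integral_add Integrable.of_finite Integrable.of_finite]
        simp [integral_const_mul]
    _ ≤ (2 * t ^ 2 + 2 * (2 + 4 * K)) * r := by nlinarith [sq_nonneg t]

theorem mem_screen_iff {m : ℕ} {X : Fin m → Fin n → Bool} {i : Fin n} :
    i ∈ screen a t T X ↔ t ≤ (∑ j, coordScore a T (X j) i) / m := by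
  unfold screen score
  exact Finset.mem_filter_univ _

theorem measureReal_misclassified_le (ha : 1 ≤ a) (hr : 1 ≤ r) (har : a * r = S.card)
    (hS : 2 ≤ S.card) (hK : 0 ≤ K)
    (hρ : ∀ i ∈ S, ∀ j ∈ S, i ≠ j → pairCorr ν θ S i j ≤ K * a / S.card)
    (hμ : ∀ i ∈ S, μ ≤ ∫ x, coordScore a S x i ∂(plantedLaw ν θ S)) (ht : 0 < t) (htμ : t < μ)
    (hT : ((T ∆ S).card : ℝ) ≤ (μ - t) / (4 * μ) * S.card) (m : ℕ) (i : Fin n) :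
    (Measure.pi fun _ : Fin m => plantedLaw ν θ S).real {X | ¬(i ∈ screen a t T X ↔ i ∈ S)} ≤
      Real.exp (-(screeningRate K μ t * (m / r))) := by
  have hμ₀ : 0 < μ := ht.trans htμ
  have hε₀ : 0 ≤ (μ - t) / (4 * μ) := div_nonneg (by linarith) (by linarith)
  have hε : 2 * ((μ - t) / (4 * μ)) ≤ 1 := by
    rw [mul_div_assoc', div_le_one (by positivity)]; linarith
  have hcard := card_le_two_mul_of_card_symmDiff_le (by linarith) hT
  have hY : Measurable fun x : Fin n → Bool => coordScore a T x i := Measurable.of_discrete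
  have hB := fun x => abs_coordScore_sub_le ha hr har ht.le hcard x i
  have hV := integral_sq_coordScore_sub_le ha hr har hK hρ hcard t i
  have hmargin : 0 < min t ((μ - t) / 2) := lt_min ht (by linarith)
  have hrate : screeningRate K μ t * (m / r) = min t ((μ - t) / 2) ^ 2 / (2 *
      (2 * ((2 * t ^ 2 + 2 * (2 + 4 * K)) * r) + min t ((μ - t) / 2) * ((t + 2) * r))) * m := by
    unfold screeningRate
    field_simp
  simp only [mem_screen_iff, hrate]
  by_cases hi : i ∈ S
  · have hmean := le_integral_coordScore_of_mem hS hμ₀ hμ hε₀ hε hT hi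
    have hmid : (1 - 2 * ((μ - t) / (4 * μ))) * μ = t + (μ - t) / 2 := by field_simp; ring
    rw [hmid] at hmean
    simp only [hi, iff_true, not_le]
    have hgap : t + min t ((μ - t) / 2) ≤ ∫ x, coordScore a T x i ∂(plantedLaw ν θ S) := by
      linarith [min_le_right t ((μ - t) / 2)]
    have htail := measureReal_average_le_le (ι := Fin m) hY (by positivity) hmargin hB hV hgap
    rw [Fintype.card_fin] at htail
    exact (measureReal_mono fun X (hX : _ < t) => hX.le).trans htail
  · simp only [hi, iff_false, not_not]
    have hgap : ∫ x, coordScore a T x i ∂(plantedLaw ν θ S) ≤ t - min t ((μ - t) / 2) := by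
      linarith [integral_coordScore_of_notMem (ν := ν) (θ := θ) (T := T) a hi,
        min_le_left t ((μ - t) / 2)]
    have htail := measureReal_le_average_le (ι := Fin m) hY (by positivity) hmargin hB hV hgap
    rwa [Fintype.card_fin] at htail

theorem measureReal_screen_ne_le (ha : 1 ≤ a) (hr : 1 ≤ r) (har : a * r = S.card)
    (hS : 2 ≤ S.card) (hK : 0 ≤ K)
    (hρ : ∀ i ∈ S, ∀ j ∈ S, i ≠ j → pairCorr ν θ S i j ≤ K * a / S.card)
    (hμ : ∀ i ∈ S, μ ≤ ∫ x, coordScore a S x i ∂(plantedLaw ν θ S)) (ht : 0 < t) (htμ : t < μ)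
    (hT : ((T ∆ S).card : ℝ) ≤ (μ - t) / (4 * μ) * S.card) (m : ℕ) :
    (Measure.pi fun _ : Fin m => plantedLaw ν θ S).real {X | screen a t T X ≠ S} ≤
      n * Real.exp (-(screeningRate K μ t * (m / r))) := by
  have hunion : {X : Fin m → Fin n → Bool | screen a t T X ≠ S} ⊆
      ⋃ i : Fin n, {X | ¬(i ∈ screen a t T X ↔ i ∈ S)} := fun X hX => by
    simpa [Finset.ext_iff] using hX
  calc (Measure.pi fun _ : Fin m => plantedLaw ν θ S).real {X | screen a t T X ≠ S}
      ≤ ∑ i : Fin n, (Measure.pi fun _ : Fin m => plantedLaw ν θ S).real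
          {X | ¬(i ∈ screen a t T X ↔ i ∈ S)} :=
        (measureReal_mono hunion).trans (measureReal_iUnion_fintype_le _)
    _ ≤ ∑ _i : Fin n, Real.exp (-(screeningRate K μ t * (m / r))) :=
        Finset.sum_le_sum fun i _ =>
          measureReal_misclassified_le ha hr har hS hK hρ hμ ht htμ hT m i
    _ = n * Real.exp (-(screeningRate K μ t * (m / r))) := by simp

end ScreeningError

theorem measureReal_mul_le_measureReal_prod {Ω β ι : Type*} [Countable ι] [MeasurableSpace Ω]
    [MeasurableSpace β] (Q : Measure Ω) [IsFiniteMeasure Q] (P : Measure β) [IsFiniteMeasure P]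
    {S' : Ω → ι} (hS' : ∀ T, MeasurableSet {ω | S' ω = T}) {E : ι → Set β}
    (hE : ∀ T, MeasurableSet (E T)) {good : ι → Prop} {c : ℝ} (hc₀ : 0 ≤ c)
    (hc : ∀ T, good T → c ≤ P.real (E T)) :
    Q.real {ω | good (S' ω)} * c ≤ (Q.prod P).real {p | p.2 ∈ E (S' p.1)} := by
  have hgood : MeasurableSet {ω | good (S' ω)} := by
    have hfibres : {ω | good (S' ω)} = ⋃ T ∈ {T | good T}, {ω | S' ω = T} := by ext ω; simp
    rw [hfibres]
    exact MeasurableSet.biUnion (Set.to_countable _) fun T _ => hS' T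
  have hmeas : MeasurableSet {p : Ω × β | p.2 ∈ E (S' p.1)} := by
    have hfibres : {p : Ω × β | p.2 ∈ E (S' p.1)} = ⋃ T, {ω | S' ω = T} ×ˢ E T := by ext p; simp
    rw [hfibres]
    exact MeasurableSet.iUnion fun T => (hS' T).prod (hE T)
  have hle : Q {ω | good (S' ω)} * ENNReal.ofReal c ≤ (Q.prod P) {p | p.2 ∈ E (S' p.1)} := by
    calc Q {ω | good (S' ω)} * ENNReal.ofReal c
        = ∫⁻ _ω in {ω | good (S' ω)}, ENNReal.ofReal c ∂Q := by
          rw [setLIntegral_const, mul_comm]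
      _ ≤ ∫⁻ ω in {ω | good (S' ω)}, P (E (S' ω)) ∂Q :=
          setLIntegral_mono' hgood fun ω hω => ENNReal.ofReal_le_of_le_toReal (hc _ hω)
      _ ≤ ∫⁻ ω, P (E (S' ω)) ∂Q := setLIntegral_le_lintegral _ _
      _ = (Q.prod P) {p | p.2 ∈ E (S' p.1)} := (Measure.prod_apply hmeas).symm
  simpa [measureReal_def, hc₀] using ENNReal.toReal_mono (measure_ne_top _ _) hle

theorem mul_exp_neg_le_inv {x y : ℝ} (hx : 0 < x) (hxy : 2 * Real.log x ≤ y) :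
    x * Real.exp (-y) ≤ x⁻¹ := by
  calc x * Real.exp (-y) ≤ x * Real.exp (-(Real.log x + Real.log x)) := by gcongr; linarith
    _ = x⁻¹ := by rw [Real.exp_neg, Real.exp_add, Real.exp_log hx]; field_simp

/-- Correlations between distinct members of a large clique of size `k` are at most `ρ k`. -/
def CorrelationAtMost (ν : Measure ℝ) (θ : ℝ) (ρ : ℕ → ℝ) : Prop :=
  ∀ᶠ k : ℕ in atTop, ∀ (n : ℕ) (S : Finset (Fin n)), S.card = k →
    ∀ i ∈ S, ∀ j ∈ S, i ≠ j → pairCorr ν θ S i j ≤ ρ k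

theorem exists_screeningExact {ν : Measure ℝ} [IsProbabilityMeasure ν] [ν.IsNegInvariant] {θ : ℝ}
    {a r : ℕ → ℝ} (ha : ∀ k, 1 ≤ k → 1 ≤ a k) (hr : ∀ k, 1 ≤ k → 1 ≤ r k)
    (har : ∀ k, 1 ≤ k → a k * r k = k) {K : ℝ} (hK : 0 ≤ K)
    (hρ : CorrelationAtMost ν θ fun k => K * a k / k)
    {μ t : ℝ} (hμ : SignalAtLeast ν θ a μ) (ht : 0 < t) (htμ : t < μ) :
    ∃ C : ℝ, 0 < C ∧ ScreeningExact ν θ a r t C := by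
  have hκ := screeningRate_pos hK ht htμ
  refine ⟨2 / screeningRate K μ t, by positivity, ?_⟩
  intro n m S Ω _ Q S' hQ hS' hS hm hQS
  have hlim := (hQS _ (div_pos (sub_pos.2 htμ) (by linarith : 0 < 4 * μ))).mul
    ((tendsto_const_nhds (x := (1 : ℝ))).sub
      (tendsto_inv_atTop_zero.comp (tendsto_natCast_atTop_atTop.comp hS)))
  simp only [sub_zero, mul_one] at hlim
  refine tendsto_of_tendsto_of_tendsto_of_le_of_le' hlim tendsto_const_nhds ?_
    (Eventually.of_forall fun N => measureReal_le_one)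
  filter_upwards [hS.eventually hρ, hS.eventually hμ, hS.eventually_ge_atTop 2, hm]
    with N hcorr hsignal hcard hmN
  have hk : 1 ≤ (S N).card := by omega
  have hkn : (S N).card ≤ n N := by simpa using Finset.card_le_univ (S N)
  have hr₀ : 0 < r (S N).card := by linarith [hr _ hk]
  have hsamples : 2 * Real.log (n N) ≤ screeningRate K μ t * (m N / r (S N).card) := by
    rw [← mul_div_assoc, le_div_iff₀ hr₀]
    calc 2 * Real.log (n N) * r (S N).card = screeningRate K μ t *
          (2 / screeningRate K μ t * r (S N).card * Real.log (n N)) := by field_simp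
      _ ≤ screeningRate K μ t * m N := by gcongr
  refine measureReal_mul_le_measureReal_prod (Q N) _ (hS' N)
    (E := fun T => {X | screen (a (S N).card) t T X = S N}) (fun T => .of_discrete)
    (good := fun T => ((T ∆ S N).card : ℝ) ≤ (μ - t) / (4 * μ) * (S N).card)
    (sub_nonneg.2 <| inv_le_one_of_one_le₀ <| Nat.one_le_cast.2 hk) fun T hT => ?_
  have hfail := (measureReal_screen_ne_le (ha _ hk) (hr _ hk) (har _ hk) hcard hK
    (hcorr _ _ rfl) (hsignal _ _ rfl) ht htμ hT (m N)).trans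
    (mul_exp_neg_le_inv (by exact_mod_cast hk.trans hkn) hsamples)
  have hinv : ((n N : ℝ))⁻¹ ≤ ((S N).card : ℝ)⁻¹ :=
    inv_anti₀ (by exact_mod_cast hk) (by exact_mod_cast hkn)
  have hcompl := probReal_compl_eq_one_sub (μ := Measure.pi fun _ : Fin (m N) =>
    plantedLaw ν θ (S N)) (s := {X | screen (a (S N).card) t T X = S N}) .of_discrete
  rw [Set.compl_ofPred] at hcompl
  simp only [Function.comp_apply]
  linarith

/-! ### The external field -/

section Field

variable {ι : Type*} {ν : Measure ℝ} [IsProbabilityMeasure ν]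

theorem abs_integral_le_of_abs_le {g : ℝ → ℝ} {B : ℝ} (hB : ∀ s, |g s| ≤ B) :
    |∫ s, g s ∂ν| ≤ B := by
  simpa using norm_integral_le_of_norm_le_const (μ := ν) (f := g) (ae_of_all _ hB)

theorem memLp_two_of_continuous_of_abs_le {g : ℝ → ℝ} (hg : Continuous g) {B : ℝ}
    (hB : ∀ s, |g s| ≤ B) : MemLp g 2 ν :=
  MemLp.of_bound hg.aestronglyMeasurable B (ae_of_all _ hB)

variable [Fintype ι]

theorem integral_field_apply (i : ι) {f : ℝ → ℝ} (hf : Continuous f) :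
    ∫ h, f (h i) ∂(iidField ι ν) = ∫ s, f s ∂ν :=
  integral_comp_eval hf.aestronglyMeasurable

theorem integral_prod_field (S : Finset ι) (f : ℝ → ℝ) :
    ∫ h, ∏ i ∈ S, f (h i) ∂(iidField ι ν) = (∫ s, f s ∂ν) ^ S.card := by
  classical
  have hext : ∀ h : ι → ℝ, ∏ i ∈ S, f (h i) = ∏ i, (if i ∈ S then f else 1) (h i) := fun h => by
    simp [ite_apply, Finset.prod_ite_mem]
  have hfactor : ∀ i, ∫ s, (if i ∈ S then f else 1) s ∂ν = if i ∈ S then ∫ s, f s ∂ν else 1 :=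
    fun i => by by_cases hi : i ∈ S <;> simp [hi]
  simp only [hext]
  rw [integral_fintype_prod_eq_prod (μ := fun _ : ι => ν) fun i => if i ∈ S then f else 1]
  simp only [hfactor, Finset.prod_ite_mem, Finset.univ_inter, Finset.prod_const]

theorem variance_sum_field (S : Finset ι) {g : ℝ → ℝ} (hg : MemLp g 2 ν) :
    ProbabilityTheory.variance (fun h => ∑ i ∈ S, g (h i)) (iidField ι ν) =
      S.card * ProbabilityTheory.variance g ν := by
  classical
  have hX : ∀ i, MemLp (if i ∈ S then g else 0) 2 ν := fun i => by
    by_cases hi : i ∈ S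
    · simpa only [hi, if_true] using hg
    · simp only [hi, if_false, MemLp.zero]
  have hsum : (fun h : ι → ℝ => ∑ i ∈ S, g (h i)) =
      ∑ i, fun h : ι → ℝ => (if i ∈ S then g else 0) (h i) := by
    ext h
    simp [ite_apply, Finset.sum_ite_mem]
  have hvar : ∀ i, ProbabilityTheory.variance (if i ∈ S then g else 0) ν =
      if i ∈ S then ProbabilityTheory.variance g ν else 0 := fun i => by
    by_cases hi : i ∈ S <;> simp [hi]
  rw [hsum, ProbabilityTheory.variance_sum_pi hX]
  simp [hvar, Finset.sum_ite_mem]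

variable {g : ℝ → ℝ} {B : ℝ}

theorem integral_sq_centered_sum_field (S : Finset ι) (hg : Continuous g) (hB : ∀ s, |g s| ≤ B) :
    ∫ h, (∑ i ∈ S, (g (h i) - ∫ s, g s ∂ν)) ^ 2 ∂(iidField ι ν) =
      S.card * ProbabilityTheory.variance g ν := by
  have hmean : ∫ h, ∑ i ∈ S, g (h i) ∂(iidField ι ν) = S.card * ∫ s, g s ∂ν := by
    rw [integral_finsetSum (f := fun i (h : ι → ℝ) => g (h i)) S fun i _ =>
      integrable_of_continuous_of_abs_le (hg.comp (continuous_apply i)) fun h => hB (h i)]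
    simp [integral_field_apply _ hg]
  rw [← variance_sum_field S (memLp_two_of_continuous_of_abs_le hg hB),
    ProbabilityTheory.variance_eq_integral
      (Continuous.aemeasurable (by fun_prop)), hmean]
  simp

theorem integral_sq_centered_sum_field_le (S : Finset ι) (hg : Continuous g)
    (hB : ∀ s, |g s| ≤ B) :
    ∫ h, (∑ i ∈ S, (g (h i) - ∫ s, g s ∂ν)) ^ 2 ∂(iidField ι ν) ≤ S.card * B ^ 2 := by
  rw [integral_sq_centered_sum_field S hg hB]
  gcongr
  refine (ProbabilityTheory.variance_le_expectation_sq hg.aestronglyMeasurable).trans ?_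
  refine (le_abs_self _).trans (abs_integral_le_of_abs_le fun s => ?_)
  rw [Pi.pow_apply, abs_pow]
  exact pow_le_pow_left₀ (abs_nonneg _) (hB s) 2

theorem integral_sq_sum_field (S : Finset ι) (hg : Continuous g) (hB : ∀ s, |g s| ≤ B)
    (hg₀ : ∫ s, g s ∂ν = 0) :
    ∫ h, (∑ i ∈ S, g (h i)) ^ 2 ∂(iidField ι ν) = S.card * ∫ s, g s ^ 2 ∂ν := by
  have hcentered := integral_sq_centered_sum_field S hg hB (ν := ν)
  rw [ProbabilityTheory.variance_of_integral_eq_zero hg.aemeasurable hg₀] at hcentered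
  simpa only [hg₀, sub_zero] using hcentered

variable [DecidableEq ι]

theorem measurePreserving_update (ν : Measure ℝ) [IsProbabilityMeasure ν] (i : ι) :
    MeasurePreserving (fun p : (ι → ℝ) × ℝ => Function.update p.1 i p.2)
      ((iidField ι ν).prod ν) (iidField ι ν) := by
  have hmeas : Measurable fun p : (ι → ℝ) × ℝ => Function.update p.1 i p.2 :=
    (continuous_fst.update i continuous_snd).measurable
  refine ⟨hmeas, (Measure.pi_eq fun s hs => ?_).symm⟩
  have hbox : (fun p : (ι → ℝ) × ℝ => Function.update p.1 i p.2) ⁻¹' Set.univ.pi s =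
      Set.univ.pi (Function.update s i Set.univ) ×ˢ s i := by
    ext p
    simp only [Set.mem_preimage, Set.mem_univ_pi, Set.mem_prod]
    constructor
    · refine fun hp => ⟨fun j => ?_, by simpa using hp i⟩
      by_cases hj : j = i
      · subst hj; simp
      · simpa [hj] using hp j
    · rintro ⟨hp, hpi⟩ j
      by_cases hj : j = i
      · subst hj; simpa using hpi
      · simpa [hj] using hp j
  rw [Measure.map_apply hmeas (.univ_pi hs), hbox, Measure.prod_prod, Measure.pi_pi,
    ← Finset.prod_erase_mul _ _ (Finset.mem_univ i),
    ← Finset.prod_erase_mul _ _ (Finset.mem_univ i), Function.update_self, measure_univ, mul_one,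
    Finset.prod_congr rfl fun j hj => by rw [Function.update_of_ne (Finset.ne_of_mem_erase hj)]]

theorem integral_mul_of_update_eq (i : ι) {f : ℝ → ℝ} (hf : Continuous f)
    {G : (ι → ℝ) → ℝ} (hG : Continuous G) (hGi : ∀ h s, G (Function.update h i s) = G h) :
    ∫ h, f (h i) * G h ∂(iidField ι ν) = (∫ s, f s ∂ν) * ∫ h, G h ∂(iidField ι ν) := by
  have hmp := measurePreserving_update ν i
  rw [mul_comm, ← integral_prod_mul, ← hmp.map_eq, integral_map hmp.measurable.aemeasurable
    (by rw [hmp.map_eq]; exact Continuous.aestronglyMeasurable (by fun_prop)), hmp.map_eq]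
  simp only [Function.update_self, hGi, mul_comm]

end Field

/-! ### The cavity decomposition at a clique vertex -/

/-- The sum of the spins of the clique other than the one at `i`. -/
def cavitySum {n : ℕ} (S : Finset (Fin n)) (i : Fin n) (x : Fin n → Bool) : ℝ :=
  ∑ l ∈ S.erase i, spin (x l)

/-- The part of the Gibbs weight which does not involve the spin and the field at `i`. -/
def cavityWeight {n : ℕ} (θ : ℝ) (S : Finset (Fin n)) (i : Fin n) (h : Fin n → ℝ)
    (x : Fin n → Bool) : ℝ :=
  Real.exp (θ / (2 * (S.card : ℝ)) * (cavitySum S i x ^ 2 + 1) +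
    ∑ j ∈ Finset.univ.erase i, h j * spin (x j))

/-- The interaction part of the local field acting on the spin at `i`. -/
def cavityField {n : ℕ} (θ : ℝ) (S : Finset (Fin n)) (i : Fin n)
    (x : Fin n → Bool) : ℝ := θ / S.card * cavitySum S i x

section Cavity

variable {n : ℕ} {θ : ℝ} {S : Finset (Fin n)} {i : Fin n}

theorem cavityWeight_pos (h : Fin n → ℝ) (x : Fin n → Bool) : 0 < cavityWeight θ S i h x :=
  Real.exp_pos _

theorem cavitySum_add_spin (hi : i ∈ S) (x : Fin n → Bool) :
    ∑ l ∈ S, spin (x l) = cavitySum S i x + spin (x i) :=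
  (Finset.sum_erase_add _ _ hi).symm

theorem cavitySum_flipAt (x : Fin n → Bool) : cavitySum S i (flipAt i x) = cavitySum S i x :=
  sum_spin_flipAt (Finset.notMem_erase i S) x

theorem cavityField_flipAt (x : Fin n → Bool) :
    cavityField θ S i (flipAt i x) = cavityField θ S i x := by
  rw [cavityField, cavitySum_flipAt, cavityField]

theorem cavityWeight_flipAt (h : Fin n → ℝ) (x : Fin n → Bool) :
    cavityWeight θ S i h (flipAt i x) = cavityWeight θ S i h x := by
  unfold cavityWeight
  rw [cavitySum_flipAt, Finset.sum_congr rfl fun j hj => by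
    rw [flipAt_of_ne (Finset.ne_of_mem_erase hj)]]

theorem cavityWeight_update (h : Fin n → ℝ) (s : ℝ) (x : Fin n → Bool) :
    cavityWeight θ S i (Function.update h i s) x = cavityWeight θ S i h x := by
  unfold cavityWeight
  rw [Finset.sum_congr rfl fun j hj => by rw [Function.update_of_ne (Finset.ne_of_mem_erase hj)]]

theorem gibbsWeight_eq_cavity (hi : i ∈ S) (h : Fin n → ℝ) (x : Fin n → Bool) :
    gibbsWeight θ S h x =
      cavityWeight θ S i h x * Real.exp (spin (x i) * (cavityField θ S i x + h i)) := by
  have hcard : (S.card : ℝ) ≠ 0 := by exact_mod_cast (Finset.card_pos.2 ⟨i, hi⟩).ne'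
  unfold gibbsWeight cavityWeight cavityField
  rw [← Real.exp_add, cavitySum_add_spin hi, ← Finset.sum_erase_add _ _ (Finset.mem_univ i)]
  congr 1
  field_simp
  linear_combination θ * spin_mul_self (x i)

theorem exp_spin_average (b : Bool) (u : ℝ) :
    (Real.exp (spin b * u) + Real.exp (spin (!b) * u)) / 2 = Real.cosh u := by
  rw [Real.cosh_eq]
  cases b <;> simp [spin, add_comm]

theorem spin_mul_exp_spin_average (b : Bool) (u : ℝ) :
    (spin b * Real.exp (spin b * u) + spin (!b) * Real.exp (spin (!b) * u)) / 2 =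
      Real.sinh u := by
  rw [Real.sinh_eq]
  cases b <;> simp [spin] <;> ring

theorem sum_gibbsWeight_mul_of_flip (hi : i ∈ S) (h : Fin n → ℝ) {f : (Fin n → Bool) → ℝ}
    (hf : ∀ x, f (flipAt i x) = f x) :
    ∑ x, gibbsWeight θ S h x * f x =
      ∑ x, cavityWeight θ S i h x * f x * Real.cosh (cavityField θ S i x + h i) := by
  rw [sum_eq_sum_flip_average i]
  refine Finset.sum_congr rfl fun x _ => ?_
  rw [gibbsWeight_eq_cavity hi, gibbsWeight_eq_cavity hi, cavityWeight_flipAt,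
    cavityField_flipAt, hf, flipAt_self, ← exp_spin_average (x i)]
  ring

theorem sum_gibbsWeight_mul_spin_of_flip (hi : i ∈ S) (h : Fin n → ℝ)
    {f : (Fin n → Bool) → ℝ} (hf : ∀ x, f (flipAt i x) = f x) :
    ∑ x, gibbsWeight θ S h x * (f x * spin (x i)) =
      ∑ x, cavityWeight θ S i h x * f x * Real.sinh (cavityField θ S i x + h i) := by
  rw [sum_eq_sum_flip_average i]
  refine Finset.sum_congr rfl fun x _ => ?_
  rw [gibbsWeight_eq_cavity hi, gibbsWeight_eq_cavity hi, cavityWeight_flipAt,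
    cavityField_flipAt, hf, flipAt_self, ← spin_mul_exp_spin_average (x i)]
  ring

/-- The DLR equation at `i`: `hf` says that `f` depends only on the other spins, given which the
spin at `i` has the mean `tanh (cavityField θ S i x + h i)`. -/
theorem gibbsMean_mul_spin_sub_tanh (hi : i ∈ S) (h : Fin n → ℝ) {f : (Fin n → Bool) → ℝ}
    (hf : ∀ x, f (flipAt i x) = f x) :
    gibbsMean θ S h (fun x => f x * (spin (x i) - Real.tanh (cavityField θ S i x + h i))) = 0 := by
  simp only [mul_sub]
  rw [gibbsMean_sub, gibbsMean_eq_div, gibbsMean_eq_div, sum_gibbsWeight_mul_spin_of_flip hi h hf,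
    sum_gibbsWeight_mul_of_flip hi h fun x => by rw [hf, cavityField_flipAt], sub_eq_zero]
  congr 1
  refine Finset.sum_congr rfl fun x _ => ?_
  have hcosh := (Real.cosh_pos (cavityField θ S i x + h i)).ne'
  rw [Real.tanh_eq_sinh_div_cosh]
  field_simp

theorem abs_cavitySum_le (x : Fin n → Bool) : |cavitySum S i x| ≤ S.card :=
  (abs_sum_spin_le _ x).trans (Nat.cast_le.2 Finset.card_erase_le)

theorem abs_cavityField_le (hθ : 0 ≤ θ) (hi : i ∈ S) (x : Fin n → Bool) :
    |cavityField θ S i x| ≤ θ := by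
  have hcard : (0 : ℝ) < S.card := by exact_mod_cast Finset.card_pos.2 ⟨i, hi⟩
  rw [cavityField, abs_mul, abs_of_nonneg (by positivity), div_mul_eq_mul_div, div_le_iff₀ hcard]
  exact mul_le_mul_of_nonneg_left (abs_cavitySum_le x) hθ

end Cavity

section Hyperbolic

theorem cosh_add_le (y s : ℝ) : Real.cosh (y + s) ≤ Real.exp |y| * Real.cosh s := by
  rw [Real.cosh_eq, Real.cosh_eq, neg_add, Real.exp_add, Real.exp_add]
  have hpos : Real.exp y ≤ Real.exp |y| := Real.exp_le_exp.2 (le_abs_self y)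
  have hneg : Real.exp (-y) ≤ Real.exp |y| := Real.exp_le_exp.2 (neg_le_abs y)
  nlinarith [Real.exp_pos s, Real.exp_pos (-s)]

theorem le_cosh_add (y s : ℝ) : Real.exp (-|y|) * Real.cosh s ≤ Real.cosh (y + s) := by
  have hshift := cosh_add_le (-y) (y + s)
  rw [neg_add_cancel_left, abs_neg] at hshift
  rwa [Real.exp_neg, inv_mul_le_iff₀ (Real.exp_pos _)]

theorem mul_sq_le_mul_sinh {c : ℝ} (hc : 0 ≤ c) (x : ℝ) : c * x ^ 2 ≤ x * Real.sinh (c * x) := by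
  rcases le_total 0 x with hx | hx
  · nlinarith [Real.self_le_sinh_iff.2 (mul_nonneg hc hx)]
  · nlinarith [Real.sinh_le_self_iff.2 (mul_nonpos_of_nonneg_of_nonpos hc hx)]

theorem symmetrized_sinh_mul_cosh_eq (c M M' s : ℝ) :
    M * (Real.sinh (c * M + s) * Real.cosh (c * M' - s) +
        Real.sinh (c * M - s) * Real.cosh (c * M' + s)) +
      M' * (Real.sinh (c * M' + s) * Real.cosh (c * M - s) +
        Real.sinh (c * M' - s) * Real.cosh (c * M + s)) =
      (M + M') * Real.sinh (c * (M + M')) +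
        (M - M') * Real.sinh (c * (M - M')) * Real.cosh (2 * s) := by
  rw [mul_add c, mul_sub c, two_mul]
  simp only [Real.sinh_add, Real.cosh_add, Real.sinh_sub, Real.cosh_sub]
  linear_combination (M + M') * (Real.sinh (c * M) * Real.cosh (c * M') +
    Real.cosh (c * M) * Real.sinh (c * M')) * Real.cosh_sq s

theorem le_symmetrized_sinh_mul_cosh {c : ℝ} (hc : 0 ≤ c) (M M' s : ℝ) :
    2 * c * (M ^ 2 + M' ^ 2) ≤
      M * (Real.sinh (c * M + s) * Real.cosh (c * M' - s) +
        Real.sinh (c * M - s) * Real.cosh (c * M' + s)) +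
      M' * (Real.sinh (c * M' + s) * Real.cosh (c * M - s) +
        Real.sinh (c * M' - s) * Real.cosh (c * M + s)) := by
  rw [symmetrized_sinh_mul_cosh_eq]
  have hsum := mul_sq_le_mul_sinh hc (M + M')
  have hdiff := mul_sq_le_mul_sinh hc (M - M')
  have hcosh := le_mul_of_one_le_right (le_trans (by positivity) hdiff)
    (Real.one_le_cosh (2 * s))
  linarith

theorem two_mul_sum_sq_mul_sum_le {α : Type*} [Fintype α] {W : α → ℝ} (hW : ∀ x, 0 ≤ W x)
    (M : α → ℝ) {c : ℝ} (hc : 0 ≤ c) (s : ℝ) :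
    2 * c * ((∑ x, W x * M x ^ 2) * ∑ x, W x) ≤
      (∑ x, W x * M x * Real.sinh (c * M x + s)) * (∑ x, W x * Real.cosh (c * M x - s)) +
        (∑ x, W x * Real.cosh (c * M x + s)) * ∑ x, W x * M x * Real.sinh (c * M x - s) := by
  have hsymm : ∀ F : α → α → ℝ, 2 * ∑ x, ∑ y, F x y = ∑ x, ∑ y, (F x y + F y x) := fun F => by
    simp only [Finset.sum_add_distrib]
    rw [Finset.sum_comm (f := fun x y => F y x), two_mul]
  rw [mul_comm (∑ x, W x * Real.cosh _), Finset.sum_mul_sum, Finset.sum_mul_sum,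
    Finset.sum_mul_sum, ← Finset.sum_add_distrib]
  simp only [← Finset.sum_add_distrib]
  refine le_of_mul_le_mul_left ?_ (two_pos (α := ℝ))
  rw [mul_left_comm, hsymm, hsymm, Finset.mul_sum]
  simp only [Finset.mul_sum]
  refine Finset.sum_le_sum fun x _ => Finset.sum_le_sum fun y _ => ?_
  linarith [mul_le_mul_of_nonneg_left (le_symmetrized_sinh_mul_cosh hc (M x) (M y) s)
    (mul_nonneg (hW x) (hW y))]

end Hyperbolic

/-! ### A lower bound on the correlations at every temperature -/

/-- The second moment of the cavity sum under the normalised cavity weight. -/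
def cavitySecondMoment {n : ℕ} (θ : ℝ) (S : Finset (Fin n)) (i : Fin n)
    (h : Fin n → ℝ) : ℝ :=
  (∑ x, cavityWeight θ S i h x * cavitySum S i x ^ 2) / ∑ x, cavityWeight θ S i h x

section LowerBound

variable {n : ℕ} {θ : ℝ} {S : Finset (Fin n)} {i : Fin n}

theorem sum_cavityWeight_pos (h : Fin n → ℝ) : 0 < ∑ x, cavityWeight θ S i h x :=
  Finset.sum_pos (fun y _ => cavityWeight_pos h y) Finset.univ_nonempty

theorem cavitySecondMoment_nonneg (h : Fin n → ℝ) : 0 ≤ cavitySecondMoment θ S i h :=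
  div_nonneg (Finset.sum_nonneg fun x _ => mul_nonneg (cavityWeight_pos h x).le (sq_nonneg _))
    (sum_cavityWeight_pos h).le

theorem abs_cavitySecondMoment_le (h : Fin n → ℝ) :
    |cavitySecondMoment θ S i h| ≤ (S.card : ℝ) ^ 2 := by
  rw [abs_of_nonneg (cavitySecondMoment_nonneg h), cavitySecondMoment,
    div_le_iff₀ (sum_cavityWeight_pos h), mul_comm, Finset.sum_mul]
  refine Finset.sum_le_sum fun x _ => mul_le_mul_of_nonneg_left ?_ (cavityWeight_pos h x).le
  rw [← sq_abs]
  exact pow_le_pow_left₀ (abs_nonneg _) (abs_cavitySum_le x) 2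

theorem continuous_cavitySecondMoment : Continuous (cavitySecondMoment θ S i) := by
  have hweight : ∀ x, Continuous fun h : Fin n → ℝ => cavityWeight θ S i h x := fun x => by
    unfold cavityWeight
    fun_prop
  exact (continuous_finsetSum _ fun x _ => (hweight x).mul continuous_const).div
    (continuous_finsetSum _ fun x _ => hweight x) fun h => (sum_cavityWeight_pos h).ne'

theorem cavitySecondMoment_update (h : Fin n → ℝ) (s : ℝ) :
    cavitySecondMoment θ S i (Function.update h i s) = cavitySecondMoment θ S i h := by
  simp only [cavitySecondMoment, cavityWeight_update]

theorem sum_gibbsWeight_eq_cavity (hi : i ∈ S) (h : Fin n → ℝ) :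
    ∑ x, gibbsWeight θ S h x =
      ∑ x, cavityWeight θ S i h x * Real.cosh (cavityField θ S i x + h i) := by
  simpa using sum_gibbsWeight_mul_of_flip (θ := θ) hi h (f := fun _ => 1) fun _ => rfl

theorem cosh_cavityField_add_le (hθ : 0 ≤ θ) (hi : i ∈ S) (s : ℝ) (x : Fin n → Bool) :
    Real.cosh (cavityField θ S i x + s) ≤ Real.exp θ * Real.cosh s :=
  (cosh_add_le _ _).trans <| mul_le_mul_of_nonneg_right
    (Real.exp_le_exp.2 (abs_cavityField_le hθ hi x)) (Real.cosh_pos _).le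

theorem le_cosh_cavityField_add (hθ : 0 ≤ θ) (hi : i ∈ S) (s : ℝ) (x : Fin n → Bool) :
    Real.exp (-θ) * Real.cosh s ≤ Real.cosh (cavityField θ S i x + s) :=
  le_trans (mul_le_mul_of_nonneg_right (Real.exp_le_exp.2
    (neg_le_neg (abs_cavityField_le hθ hi x))) (Real.cosh_pos _).le) (le_cosh_add _ _)

theorem sum_gibbsWeight_le_cavity (hθ : 0 ≤ θ) (hi : i ∈ S) (h : Fin n → ℝ) :
    ∑ x, gibbsWeight θ S h x ≤
      (∑ x, cavityWeight θ S i h x) * (Real.exp θ * Real.cosh (h i)) := by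
  rw [sum_gibbsWeight_eq_cavity hi, Finset.sum_mul]
  exact Finset.sum_le_sum fun x _ => mul_le_mul_of_nonneg_left
    (cosh_cavityField_add_le hθ hi (h i) x) (cavityWeight_pos h x).le

theorem le_sum_gibbsWeight (hθ : 0 ≤ θ) (hi : i ∈ S) (h : Fin n → ℝ) :
    (∑ x, cavityWeight θ S i h x) * (Real.exp (-θ) * Real.cosh (h i)) ≤
      ∑ x, gibbsWeight θ S h x := by
  rw [sum_gibbsWeight_eq_cavity hi, Finset.sum_mul]
  exact Finset.sum_le_sum fun x _ => mul_le_mul_of_nonneg_left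
    (le_cosh_cavityField_add hθ hi (h i) x) (cavityWeight_pos h x).le

theorem gibbsMean_sq_cavitySum_le (hθ : 0 ≤ θ) (hi : i ∈ S) (h : Fin n → ℝ) :
    gibbsMean θ S h (fun x => cavitySum S i x ^ 2) ≤
      Real.exp (2 * θ) * cavitySecondMoment θ S i h := by
  have hweight := sum_cavityWeight_pos (θ := θ) (S := S) (i := i) h
  have hmoment : 0 ≤ ∑ x, cavityWeight θ S i h x * cavitySum S i x ^ 2 :=
    Finset.sum_nonneg fun x _ => mul_nonneg (cavityWeight_pos h x).le (sq_nonneg _)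
  have hexp : Real.exp θ = Real.exp (2 * θ) * Real.exp (-θ) := by
    rw [← Real.exp_add]; congr 1; ring
  rw [gibbsMean_eq_div, sum_gibbsWeight_mul_of_flip hi h fun x => by rw [cavitySum_flipAt]]
  calc (∑ x, cavityWeight θ S i h x * cavitySum S i x ^ 2 *
        Real.cosh (cavityField θ S i x + h i)) / ∑ x, gibbsWeight θ S h x
      ≤ (∑ x, cavityWeight θ S i h x * cavitySum S i x ^ 2) * (Real.exp θ * Real.cosh (h i)) /
          ((∑ x, cavityWeight θ S i h x) * (Real.exp (-θ) * Real.cosh (h i))) := by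
        refine div_le_div₀ (by positivity) ?_ (by positivity) (le_sum_gibbsWeight hθ hi h)
        rw [Finset.sum_mul]
        exact Finset.sum_le_sum fun x _ => mul_le_mul_of_nonneg_left
          (cosh_cavityField_add_le hθ hi (h i) x)
          (mul_nonneg (cavityWeight_pos h x).le (sq_nonneg _))
    _ = Real.exp (2 * θ) * cavitySecondMoment θ S i h := by
        rw [hexp, cavitySecondMoment]
        field_simp

/-- Averaging over the sign of the field at `i` removes the part of the correlation between the
spin at `i` and the rest of the clique which is of unknown sign. -/
theorem le_gibbsMean_add_gibbsMean_negAt (hθ : 0 ≤ θ) (hi : i ∈ S) (h : Fin n → ℝ) :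
    2 * (θ / S.card * Real.exp (-(2 * θ)) *
      (1 / Real.cosh (h i) ^ 2 * cavitySecondMoment θ S i h)) ≤
    gibbsMean θ S h (fun x => cavitySum S i x * spin (x i)) +
      gibbsMean θ S (negAt i h) (fun x => cavitySum S i x * spin (x i)) := by
  set W := cavityWeight θ S i h with hWdef
  have hW : ∀ x, cavityWeight θ S i (negAt i h) x = W x := cavityWeight_update h _
  have hneg : negAt i h i = -h i := Function.update_self ..
  have hZ : 0 < ∑ x, gibbsWeight θ S h x := sum_gibbsWeight_pos
  have hZneg : 0 < ∑ x, gibbsWeight θ S (negAt i h) x := sum_gibbsWeight_pos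
  have hZle := sum_gibbsWeight_le_cavity hθ hi h
  have hZnegle := sum_gibbsWeight_le_cavity hθ hi (negAt i h)
  simp only [hW, hneg, Real.cosh_neg] at hZnegle
  have hweight : 0 < ∑ x, W x := sum_cavityWeight_pos h
  have hcosh := Real.cosh_pos (h i)
  have hmoment : 0 ≤ ∑ x, W x * cavitySum S i x ^ 2 :=
    Finset.sum_nonneg fun x _ => mul_nonneg (cavityWeight_pos h x).le (sq_nonneg _)
  have hsymm := two_mul_sum_sq_mul_sum_le (W := W)
    (fun x => (cavityWeight_pos h x).le) (cavitySum S i) (show 0 ≤ θ / S.card by positivity) (h i)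
  calc _ = 2 * (θ / S.card) * ((∑ x, W x * cavitySum S i x ^ 2) * ∑ x, W x) /
        ((∑ x, W x) * (Real.exp θ * Real.cosh (h i)) *
          ((∑ x, W x) * (Real.exp θ * Real.cosh (h i)))) := by
        rw [cavitySecondMoment, ← hWdef, Real.exp_neg, two_mul θ, Real.exp_add]
        field_simp
    _ ≤ 2 * (θ / S.card) * ((∑ x, W x * cavitySum S i x ^ 2) * ∑ x, W x) /
        ((∑ x, gibbsWeight θ S h x) * ∑ x, gibbsWeight θ S (negAt i h) x) := by gcongr
    _ ≤ _ := by
        rw [gibbsMean_eq_div, gibbsMean_eq_div, div_add_div _ _ hZ.ne' hZneg.ne',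
          sum_gibbsWeight_mul_spin_of_flip hi h cavitySum_flipAt,
          sum_gibbsWeight_mul_spin_of_flip hi (negAt i h) cavitySum_flipAt]
        gcongr
        rw [sum_gibbsWeight_eq_cavity hi, sum_gibbsWeight_eq_cavity hi]
        simpa only [hW, hneg, cavityField, ← sub_eq_add_neg] using hsymm

variable {ν : Measure ℝ} [IsProbabilityMeasure ν]

theorem continuous_sech_sq : Continuous fun s : ℝ => 1 / Real.cosh s ^ 2 :=
  continuous_const.div (by fun_prop) fun s => (pow_pos (Real.cosh_pos s) 2).ne'

theorem abs_sech_sq_le_one (s : ℝ) : |1 / Real.cosh s ^ 2| ≤ 1 := by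
  have hcosh := Real.one_le_cosh s
  rw [abs_of_nonneg (by positivity), div_le_one (by positivity)]
  exact one_le_pow₀ hcosh

theorem integrable_cavitySecondMoment :
    Integrable (cavitySecondMoment θ S i) (iidField (Fin n) ν) :=
  integrable_of_continuous_of_abs_le continuous_cavitySecondMoment abs_cavitySecondMoment_le

theorem integral_cavitySum_mul_spin {j : Fin n} (hi : i ∈ S) (hj : j ∈ S) (hij : i ≠ j) :
    ∫ x, cavitySum S i x * spin (x i) ∂(plantedLaw ν θ S) =
      ((S.card : ℝ) - 1) * pairCorr ν θ S i j := by
  simpa only [coordScore, cavitySum, div_one, mul_comm] using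
    integral_coordScore_clique (ν := ν) (θ := θ) 1 hi hj hij hi

theorem mul_integral_cavitySecondMoment_le [ν.IsNegInvariant] (hθ : 0 ≤ θ) (hi : i ∈ S) :
    θ / S.card * Real.exp (-(2 * θ)) *
        (meanSechSq ν * ∫ h, cavitySecondMoment θ S i h ∂(iidField (Fin n) ν)) ≤
      ∫ x, cavitySum S i x * spin (x i) ∂(plantedLaw ν θ S) := by
  set f : (Fin n → Bool) → ℝ := fun x => cavitySum S i x * spin (x i)
  have hbound : ∀ h : Fin n → ℝ,
      |1 / Real.cosh (h i) ^ 2 * cavitySecondMoment θ S i h| ≤ 1 * (S.card : ℝ) ^ 2 := fun h => by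
    rw [abs_mul]
    gcongr
    · exact abs_sech_sq_le_one _
    · exact abs_cavitySecondMoment_le h
  have hint : Integrable (fun h : Fin n → ℝ =>
      1 / Real.cosh (h i) ^ 2 * cavitySecondMoment θ S i h) (iidField (Fin n) ν) :=
    integrable_of_continuous_of_abs_le ((continuous_sech_sq.comp (continuous_apply i)).mul
      continuous_cavitySecondMoment) hbound
  have hmean := integrable_gibbsMean ν θ S f
  have hmean_neg : Integrable (fun h => gibbsMean θ S (negAt i h) f) (iidField (Fin n) ν) :=
    (measurePreserving_negAt i).integrable_comp_of_integrable hmean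
  have hmono := integral_mono (hint.const_mul _ |>.const_mul 2) (hmean.add hmean_neg)
    (le_gibbsMean_add_gibbsMean_negAt hθ hi)
  simp only [Pi.add_apply] at hmono
  rw [integral_add hmean hmean_neg, integral_comp_negAt i
    (continuous_gibbsMean θ S (f := fun _ => f) fun x => continuous_const), integral_const_mul,
    integral_const_mul, integral_mul_of_update_eq i continuous_sech_sq
      continuous_cavitySecondMoment cavitySecondMoment_update] at hmono
  rw [integral_plantedLaw, meanSechSq]
  linarith

theorem le_integral_cavitySecondMoment (hθ : 0 ≤ θ) {j : Fin n} (hi : i ∈ S) (hj : j ∈ S)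
    (hij : i ≠ j) (hcorr : 0 ≤ pairCorr ν θ S i j) :
    (S.card : ℝ) - 1 ≤
      Real.exp (2 * θ) * ∫ h, cavitySecondMoment θ S i h ∂(iidField (Fin n) ν) := by
  have hcard : (2 : ℝ) ≤ S.card := by
    exact_mod_cast Finset.one_lt_card.2 ⟨i, hi, j, hj, hij⟩
  have hsq := integral_sq_sum_spin_of_subset (ν := ν) (θ := θ) (Finset.erase_subset i S) hi hj hij
  rw [Finset.cast_card_erase_of_mem hi] at hsq
  calc (S.card : ℝ) - 1 ≤ ∫ x, cavitySum S i x ^ 2 ∂(plantedLaw ν θ S) := by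
        unfold cavitySum
        rw [hsq, le_add_iff_nonneg_right]
        exact mul_nonneg (mul_nonneg (by linarith) (by linarith)) hcorr
    _ ≤ ∫ h, Real.exp (2 * θ) * cavitySecondMoment θ S i h ∂(iidField (Fin n) ν) := by
        rw [integral_plantedLaw]
        exact integral_mono (integrable_gibbsMean ν θ S _)
          (integrable_cavitySecondMoment.const_mul _) (gibbsMean_sq_cavitySum_le hθ hi)
    _ = _ := integral_const_mul ..

theorem meanSechSq_nonneg (ν : Measure ℝ) : 0 ≤ meanSechSq ν :=
  integral_nonneg fun s => by positivity

theorem le_pairCorr [ν.IsNegInvariant] (hθ : 0 ≤ θ) {j : Fin n} (hi : i ∈ S) (hj : j ∈ S)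
    (hij : i ≠ j) :
    θ / S.card * Real.exp (-(4 * θ)) * meanSechSq ν ≤ pairCorr ν θ S i j := by
  have hcard : (0 : ℝ) < S.card - 1 := by
    have : (2 : ℝ) ≤ S.card := by exact_mod_cast Finset.one_lt_card.2 ⟨i, hi, j, hj, hij⟩
    linarith
  have hsech := meanSechSq_nonneg ν
  have hmoment : 0 ≤ ∫ h, cavitySecondMoment θ S i h ∂(iidField (Fin n) ν) :=
    integral_nonneg cavitySecondMoment_nonneg
  have hcavity := mul_integral_cavitySecondMoment_le (ν := ν) hθ hi
  rw [integral_cavitySum_mul_spin hi hj hij] at hcavity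
  have hcorr : 0 ≤ pairCorr ν θ S i j :=
    nonneg_of_mul_nonneg_right (le_trans (by positivity) hcavity) hcard
  have hexp : Real.exp (-(4 * θ)) * Real.exp (2 * θ) = Real.exp (-(2 * θ)) := by
    rw [← Real.exp_add]; congr 1; ring
  refine le_of_mul_le_mul_left (le_trans ?_ hcavity) hcard
  calc ((S.card : ℝ) - 1) * (θ / S.card * Real.exp (-(4 * θ)) * meanSechSq ν)
      ≤ (Real.exp (2 * θ) * ∫ h, cavitySecondMoment θ S i h ∂(iidField (Fin n) ν)) *
          (θ / S.card * Real.exp (-(4 * θ)) * meanSechSq ν) := by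
        gcongr
        exact le_integral_cavitySecondMoment hθ hi hj hij hcorr
    _ = _ := by rw [← hexp]; ring

end LowerBound

/-! ### Smoothness of the potential -/

theorem one_sub_tanh_sq (x : ℝ) : 1 - Real.tanh x ^ 2 = 1 / Real.cosh x ^ 2 := by
  have hcosh := (Real.cosh_pos x).ne'
  rw [Real.tanh_eq_sinh_div_cosh, div_pow, Real.sinh_sq]
  field_simp
  ring

theorem hasDerivAt_tanh (x : ℝ) : HasDerivAt Real.tanh (1 - Real.tanh x ^ 2) x := by
  rw [show Real.tanh = fun y => Real.sinh y / Real.cosh y from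
    funext Real.tanh_eq_sinh_div_cosh]
  refine ((Real.hasDerivAt_sinh x).fun_div (Real.hasDerivAt_cosh x)
    (Real.cosh_pos x).ne').congr_deriv ?_
  have hcosh := (Real.cosh_pos x).ne'
  field_simp

theorem continuous_tanh : Continuous Real.tanh :=
  continuous_iff_continuousAt.2 fun x => (hasDerivAt_tanh x).continuousAt

theorem abs_tanh_le_one (x : ℝ) : |Real.tanh x| ≤ 1 := (Real.abs_tanh_lt_one x).le

theorem abs_one_sub_tanh_sq_le (x : ℝ) : |1 - Real.tanh x ^ 2| ≤ 1 := by
  rw [one_sub_tanh_sq]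
  exact abs_sech_sq_le_one x

theorem abs_tanh_sub_tanh_le (a b : ℝ) : |Real.tanh a - Real.tanh b| ≤ |a - b| := by
  have hlip := convex_univ.norm_image_sub_le_of_norm_hasDerivWithin_le (f := Real.tanh) (C := 1)
    (fun x _ => (hasDerivAt_tanh x).hasDerivWithinAt) (fun x _ => abs_one_sub_tanh_sq_le x)
    (Set.mem_univ b) (Set.mem_univ a)
  simpa using hlip

theorem log_cosh_add_le (y s : ℝ) :
    Real.log (Real.cosh (y + s)) ≤ |y| + Real.log (Real.cosh s) := by
  have hlog := Real.log_le_log (Real.cosh_pos _) (cosh_add_le y s)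
  rwa [Real.log_mul (Real.exp_pos _).ne' (Real.cosh_pos s).ne', Real.log_exp] at hlog

theorem abs_log_cosh_add_sub_le (y s : ℝ) :
    |Real.log (Real.cosh (y + s)) - Real.log (Real.cosh s)| ≤ |y| := by
  have hneg := log_cosh_add_le (-y) (y + s)
  rw [neg_add_cancel_left, abs_neg] at hneg
  exact abs_sub_le_iff.2 ⟨by linarith [log_cosh_add_le y s], by linarith⟩

theorem continuous_log_cosh : Continuous fun s => Real.log (Real.cosh s) :=
  Real.continuous_cosh.log fun s => (Real.cosh_pos s).ne'

theorem hasDerivAt_log_cosh (x : ℝ) :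
    HasDerivAt (fun s => Real.log (Real.cosh s)) (Real.tanh x) x := by
  rw [Real.tanh_eq_sinh_div_cosh]
  exact (Real.hasDerivAt_cosh x).log (Real.cosh_pos x).ne'

theorem integral_eq_zero_of_odd {ν : Measure ℝ} [ν.IsNegInvariant] {f : ℝ → ℝ}
    (hf : ∀ s, f (-s) = -f s) : ∫ s, f s ∂ν = 0 := by
  have hneg := integral_neg_eq_self f ν
  simp only [hf, integral_neg] at hneg
  linarith

theorem integral_tanh_eq_zero (ν : Measure ℝ) [ν.IsNegInvariant] : ∫ s, Real.tanh s ∂ν = 0 :=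
  integral_eq_zero_of_odd Real.tanh_neg

section Potential

variable {ν : Measure ℝ} [IsProbabilityMeasure ν]

theorem hasDerivAt_integral_shift {f f' : ℝ → ℝ} (hf : ∀ y, HasDerivAt f (f' y) y)
    (hf' : Continuous f') {B : ℝ} (hB : ∀ y, |f' y| ≤ B)
    (hint : ∀ x, Integrable (fun h => f (x + h)) ν) (x : ℝ) :
    HasDerivAt (fun x => ∫ h, f (x + h) ∂ν) (∫ h, f' (x + h) ∂ν) x := by
  have hfc : Continuous f := continuous_iff_continuousAt.2 fun y => (hf y).continuousAt
  refine (hasDerivAt_integral_of_dominated_loc_of_deriv_le (bound := fun _ => B)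
    (F := fun x h => f (x + h)) (F' := fun x h => f' (x + h)) (s := Set.univ) univ_mem ?_
    (hint x) ?_ ?_ (integrable_const B) ?_).2
  · exact Eventually.of_forall fun y => Continuous.aestronglyMeasurable (by fun_prop)
  · exact Continuous.aestronglyMeasurable (by fun_prop)
  · exact ae_of_all _ fun h y _ => hB _
  · exact ae_of_all _ fun h y _ => (hf (y + h)).comp_add_const y h

theorem exists_abs_eval_tanh_le (p : Polynomial ℝ) :
    ∃ B, ∀ y, |p.eval (Real.tanh y)| ≤ B := by
  obtain ⟨B, hB⟩ := (isCompact_Icc (a := (-1 : ℝ)) (b := 1)).exists_bound_of_continuousOn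
    (f := fun t => p.eval t) p.continuous.continuousOn
  exact ⟨B, fun y => hB _ (abs_le.1 (abs_tanh_le_one y))⟩

theorem hasDerivAt_eval_tanh (p : Polynomial ℝ) (y : ℝ) :
    HasDerivAt (fun y => p.eval (Real.tanh y))
      ((Polynomial.derivative p * (1 - Polynomial.X ^ 2)).eval (Real.tanh y)) y := by
  exact ((p.hasDerivAt (Real.tanh y)).comp y (hasDerivAt_tanh y)).congr_deriv (by simp)

theorem continuous_eval_tanh (p : Polynomial ℝ) :
    Continuous fun y => p.eval (Real.tanh y) := p.continuous.comp continuous_tanh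

theorem integrable_eval_tanh (p : Polynomial ℝ) (x : ℝ) :
    Integrable (fun h => p.eval (Real.tanh (x + h))) ν := by
  obtain ⟨B, hB⟩ := exists_abs_eval_tanh_le p
  exact integrable_of_continuous_of_abs_le ((continuous_eval_tanh p).comp (by fun_prop))
    fun h => hB _

theorem hasDerivAt_integral_eval_tanh (p : Polynomial ℝ) (x : ℝ) :
    HasDerivAt (fun x => ∫ h, p.eval (Real.tanh (x + h)) ∂ν)
      (∫ h, (Polynomial.derivative p * (1 - Polynomial.X ^ 2)).eval (Real.tanh (x + h)) ∂ν) x := by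
  obtain ⟨B, hB⟩ := exists_abs_eval_tanh_le (Polynomial.derivative p * (1 - Polynomial.X ^ 2))
  exact hasDerivAt_integral_shift (hasDerivAt_eval_tanh p) (continuous_eval_tanh _) hB
    (integrable_eval_tanh p) x

theorem contDiff_integral_eval_tanh (m : ℕ) (p : Polynomial ℝ) :
    ContDiff ℝ m (fun x => ∫ h, p.eval (Real.tanh (x + h)) ∂ν) := by
  induction m generalizing p with
  | zero =>
    exact contDiff_zero.2 (continuous_iff_continuousAt.2 fun x =>
      (hasDerivAt_integral_eval_tanh p x).continuousAt)
  | succ m ih =>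
    rw [Nat.cast_succ, contDiff_succ_iff_deriv]
    refine ⟨fun x => (hasDerivAt_integral_eval_tanh p x).differentiableAt, by simp, ?_⟩
    rw [funext fun x => (hasDerivAt_integral_eval_tanh (ν := ν) p x).deriv]
    exact ih _

theorem integrable_log_cosh (hint : Integrable (fun h : ℝ => h) ν) (x : ℝ) :
    Integrable (fun h => Real.log (Real.cosh (x + h))) ν := by
  refine (((integrable_const |x|).add hint.abs)).mono'
    (continuous_log_cosh.comp (by fun_prop)).aestronglyMeasurable (ae_of_all _ fun h => ?_)
  have hlip := abs_log_cosh_add_sub_le (x + h) 0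
  simp only [add_zero, Real.cosh_zero, Real.log_one, sub_zero] at hlip
  exact hlip.trans (abs_add_le x h)

theorem hasDerivAt_potential (hint : Integrable (fun h : ℝ => h) ν) (θ x : ℝ) :
    HasDerivAt (potential ν θ)
      (x - Real.sqrt θ * ∫ h, Real.tanh (Real.sqrt θ * x + h) ∂ν) x := by
  have hfree := hasDerivAt_integral_shift hasDerivAt_log_cosh continuous_tanh abs_tanh_le_one
    (integrable_log_cosh hint) (Real.sqrt θ * x)
  have hcomp := hfree.comp x ((hasDerivAt_id x).const_mul (Real.sqrt θ))
  exact (((hasDerivAt_pow 2 x).div_const 2).sub hcomp).congr_deriv (by simp; ring)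

theorem deriv_potential (hint : Integrable (fun h : ℝ => h) ν) (θ : ℝ) :
    deriv (potential ν θ) =
      fun x => x - Real.sqrt θ * ∫ h, Real.tanh (Real.sqrt θ * x + h) ∂ν :=
  funext fun x => (hasDerivAt_potential hint θ x).deriv

theorem contDiff_deriv_potential (hint : Integrable (fun h : ℝ => h) ν) (θ : ℝ) (m : ℕ) :
    ContDiff ℝ m (deriv (potential ν θ)) := by
  rw [deriv_potential hint]
  have htanh := contDiff_integral_eval_tanh (ν := ν) m Polynomial.X
  simp only [Polynomial.eval_X] at htanh
  exact contDiff_id.sub (contDiff_const.mul (htanh.comp (contDiff_const.mul contDiff_id)))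

theorem contDiff_potential (hint : Integrable (fun h : ℝ => h) ν) (θ : ℝ) (m : ℕ) :
    ContDiff ℝ m (potential ν θ) := by
  have hsucc : ContDiff ℝ (m + 1) (potential ν θ) :=
    contDiff_succ_iff_deriv.2 ⟨fun x => (hasDerivAt_potential hint θ x).differentiableAt,
      by simp, contDiff_deriv_potential hint θ m⟩
  exact hsucc.of_le (by norm_cast; omega)

theorem hasDerivAt_deriv_potential_zero (hint : Integrable (fun h : ℝ => h) ν) {θ : ℝ}
    (hθ : 0 ≤ θ) : HasDerivAt (deriv (potential ν θ)) (1 - θ * meanSechSq ν) 0 := by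
  rw [deriv_potential hint]
  have htanh := (hasDerivAt_integral_eval_tanh (ν := ν) Polynomial.X (Real.sqrt θ * 0)).comp
    (0 : ℝ) ((hasDerivAt_id (0 : ℝ)).const_mul (Real.sqrt θ))
  have hderiv := (hasDerivAt_id (0 : ℝ)).sub (htanh.const_mul (Real.sqrt θ))
  simp only [Polynomial.eval_X] at hderiv
  refine hderiv.congr_deriv ?_
  simp only [Polynomial.derivative_X, one_mul, Polynomial.eval_sub, Polynomial.eval_one,
    Polynomial.eval_pow, Polynomial.eval_X, mul_zero, zero_add, one_sub_tanh_sq, mul_one,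
    meanSechSq]
  linear_combination (-∫ h, 1 / Real.cosh h ^ 2 ∂ν) * Real.mul_self_sqrt hθ

theorem deriv_potential_zero [ν.IsNegInvariant] (hint : Integrable (fun h : ℝ => h) ν) (θ : ℝ) :
    deriv (potential ν θ) 0 = 0 := by
  simp [deriv_potential hint, integral_tanh_eq_zero]

end Potential

/-! ### Taylor expansions -/

theorem taylor_leading_term {f : ℝ → ℝ} {p : ℕ} (hp : 1 ≤ p) (hf : ContDiff ℝ p f)
    (hlower : ∀ q, 1 ≤ q → q < p → iteratedDeriv q f 0 = 0) :
    (fun x => f x - f 0 - iteratedDeriv p f 0 / (p.factorial : ℝ) * x ^ p) =o[𝓝 0]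
      fun x => x ^ p := by
  have htaylor := taylor_isLittleO_univ (x₀ := (0 : ℝ)) hf
  simp only [sub_zero] at htaylor
  refine htaylor.congr_left fun x => ?_
  rw [taylor_within_apply, Finset.sum_range_succ]
  obtain ⟨p, rfl⟩ : ∃ p', p = p' + 1 := ⟨p - 1, by omega⟩
  rw [Finset.sum_range_succ', Finset.sum_eq_zero]
  · simp [iteratedDerivWithin_univ]; ring
  · intro q hq
    rw [iteratedDerivWithin_univ, hlower (q + 1) (by omega) (by simpa using hq), smul_zero]

theorem coeff_eq_zero_of_isLittleO {c : ℝ} {p : ℕ}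
    (h : (fun x : ℝ => c * x ^ p) =o[𝓝 0] fun x => x ^ p) : c = 0 := by
  by_contra hc
  refine Asymptotics.isLittleO_irrefl ?_ ((Asymptotics.isLittleO_const_mul_left_iff hc).1 h)
  exact ((eventually_mem_nhdsWithin (a := (0 : ℝ)) (s := {0}ᶜ)).frequently.filter_mono
    nhdsWithin_le_nhds).mono fun x hx => pow_ne_zero p hx

theorem iteratedDeriv_eq_zero_of_expansion {f : ℝ → ℝ} {N : ℕ} (hf : ContDiff ℝ N f) {A : ℝ}
    (hO : (fun x => f x - f 0 - A * x ^ N) =O[𝓝 0] fun x => x ^ (N + 1)) {p : ℕ} (hp : 1 ≤ p)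
    (hpN : p < N) : iteratedDeriv p f 0 = 0 := by
  induction p using Nat.strong_induction_on with
  | _ p ih =>
    have htaylor := taylor_leading_term hp (hf.of_le (by exact_mod_cast hpN.le))
      fun q hq hqp => ih q hqp hq (hqp.trans hpN)
    have hsmall : (fun x => f x - f 0) =o[𝓝 0] fun x => x ^ p := by
      have hremainder := hO.trans_isLittleO (Asymptotics.isLittleO_pow_pow (by omega : p < N + 1))
      have hleading := (Asymptotics.isLittleO_pow_pow hpN (𝕜 := ℝ)).const_mul_left A
      exact (hremainder.add hleading).congr_left fun x => by ring
    have hcoeff := coeff_eq_zero_of_isLittleO ((hsmall.sub htaylor).congr_left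
      (f₂ := fun x => iteratedDeriv p f 0 / (p.factorial : ℝ) * x ^ p) fun x => by ring)
    exact (div_eq_zero_iff.1 hcoeff).resolve_right (by exact_mod_cast p.factorial_ne_zero)

theorem deriv_expansion {f : ℝ → ℝ} {N : ℕ} (hN : 2 ≤ N) (hf : ContDiff ℝ N f)
    (hf' : ContDiff ℝ ((N - 1 : ℕ) : WithTop ℕ∞) (deriv f)) {A : ℝ}
    (hO : (fun x => f x - f 0 - A * x ^ N) =O[𝓝 0] fun x => x ^ (N + 1)) :
    (fun x => deriv f x - iteratedDeriv N f 0 / ((N - 1).factorial : ℝ) * x ^ (N - 1)) =o[𝓝 0]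
      fun x => x ^ (N - 1) := by
  have hlower : ∀ p, 1 ≤ p → p < N → iteratedDeriv p f 0 = 0 := fun p hp hpN =>
    iteratedDeriv_eq_zero_of_expansion hf hO hp hpN
  have htaylor := taylor_leading_term (p := N - 1) (by omega) hf' fun q _ hqN => by
    rw [← iteratedDeriv_succ']
    exact hlower (q + 1) (by omega) (by omega)
  have hderiv : deriv f 0 = 0 := by
    rw [← iteratedDeriv_one]
    exact hlower 1 le_rfl (by omega)
  rw [← iteratedDeriv_succ', Nat.sub_add_cancel (by omega), hderiv] at htaylor
  simpa using htaylor

/-! ### The restoring force -/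

/-- The defect of the limiting mean-field equation `m = E[tanh (θ m + h)]`. It is, up to the factor
`√θ`, the derivative of the potential at the point `√θ * m`. -/
def restoringForce (ν : Measure ℝ) (θ m : ℝ) : ℝ :=
  m - ∫ h, Real.tanh (θ * m + h) ∂ν

/-- Near zero the restoring force is a positive multiple of `m ^ (2 τ - 1)`. -/
def HasFlatness (ν : Measure ℝ) (θ : ℝ) (τ : ℕ) : Prop :=
  ∃ D : ℝ, 0 < D ∧ (fun m => restoringForce ν θ m - D * m ^ (2 * τ - 1)) =o[𝓝 0]
    fun m => m ^ (2 * τ - 1)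

section RestoringForce

variable {ν : Measure ℝ}

theorem exists_le_abs_restoringForce {θ : ℝ} {τ : ℕ} (hτ : HasFlatness ν θ τ) :
    ∃ c > 0, ∃ δ > 0, ∀ m, |m| ≤ δ → c * |m| ^ (2 * τ - 1) ≤ |restoringForce ν θ m| := by
  obtain ⟨D, hD, ho⟩ := hτ
  obtain ⟨δ, hδ, hball⟩ := Metric.eventually_nhds_iff.1 (ho.def (c := D / 2) (by positivity))
  refine ⟨D / 2, by positivity, δ / 2, by positivity, fun m hm => ?_⟩
  have hnear := hball (y := m) (by rw [Real.dist_eq, sub_zero]; linarith)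
  have htriangle := norm_sub_norm_le (D * m ^ (2 * τ - 1)) (restoringForce ν θ m)
  rw [norm_sub_rev, norm_mul, norm_pow] at htriangle
  simp only [Real.norm_eq_abs, abs_pow, abs_of_pos hD] at htriangle hnear
  linarith

variable [IsProbabilityMeasure ν]

theorem deriv_potential_sqrt_mul (hint : Integrable (fun h : ℝ => h) ν) {θ : ℝ} (hθ : 0 ≤ θ)
    (m : ℝ) : deriv (potential ν θ) (Real.sqrt θ * m) = Real.sqrt θ * restoringForce ν θ m := by
  simp only [deriv_potential hint, restoringForce]
  rw [← mul_assoc, Real.mul_self_sqrt hθ]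
  ring

theorem hasFlatness_of_deriv (hint : Integrable (fun h : ℝ => h) ν) {θ : ℝ} (hθ : 0 < θ)
    {τ : ℕ} {D : ℝ} (hD : 0 < D)
    (hderiv : (fun x => deriv (potential ν θ) x - D * x ^ (2 * τ - 1)) =o[𝓝 0]
      fun x => x ^ (2 * τ - 1)) : HasFlatness ν θ τ := by
  have := Real.sqrt_pos.2 hθ
  refine ⟨D * Real.sqrt θ ^ (2 * τ - 1) / Real.sqrt θ, by positivity, ?_⟩
  have hscale : Tendsto (fun m : ℝ => Real.sqrt θ * m) (𝓝 0) (𝓝 0) :=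
    Continuous.tendsto' (by fun_prop) _ _ (mul_zero _)
  have hforce := ((hderiv.comp_tendsto hscale).const_mul_left (Real.sqrt θ)⁻¹).congr_left
    (f₂ := fun m => restoringForce ν θ m -
      D * Real.sqrt θ ^ (2 * τ - 1) / Real.sqrt θ * m ^ (2 * τ - 1)) fun m => by
    simp only [Function.comp_apply]
    rw [deriv_potential_sqrt_mul hint hθ.le, mul_pow]
    field_simp
  refine hforce.trans_isBigO ?_
  simp only [Function.comp_def, mul_pow]
  exact (Asymptotics.isBigO_refl _ _).const_mul_left _

theorem hasFlatness_one [ν.IsNegInvariant] (hint : Integrable (fun h : ℝ => h) ν) {θ : ℝ}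
    (hθ : 0 < θ) (hlt : θ * meanSechSq ν < 1) : HasFlatness ν θ 1 := by
  refine hasFlatness_of_deriv hint hθ (sub_pos.2 hlt) ?_
  have hderiv := (hasDerivAt_deriv_potential_zero (ν := ν) hint hθ.le).isLittleO
  simp only [deriv_potential_zero hint, sub_zero, smul_eq_mul] at hderiv
  simp only [mul_one, Nat.reduceSub, pow_one]
  exact hderiv.congr_left fun x => by ring

theorem potential_zero_nonpos (ν : Measure ℝ) (θ : ℝ) : potential ν θ 0 ≤ 0 := by
  have hlog : 0 ≤ ∫ h, Real.log (Real.cosh (Real.sqrt θ * 0 + h)) ∂ν :=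
    integral_nonneg fun h => Real.log_nonneg (Real.one_le_cosh _)
  unfold potential
  linarith

theorem two_le_of_criticalTemperature (hint : Integrable (fun h : ℝ => h) ν) {θ : ℝ}
    (hθ : 0 < θ) {τ : ℕ} (hcrit : CriticalTemperature ν θ τ) : 2 ≤ τ := by
  obtain ⟨hsech, -, hderiv, -⟩ := hcrit
  by_contra hlt
  obtain rfl | rfl : τ = 0 ∨ τ = 1 := by omega
  · rw [mul_zero, iteratedDeriv_zero] at hderiv
    exact hderiv.not_ge (potential_zero_nonpos ν θ)
  · rw [mul_one, iteratedDeriv_succ', iteratedDeriv_one,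
      (hasDerivAt_deriv_potential_zero hint hθ.le).deriv] at hderiv
    linarith

theorem hasFlatness_of_criticalTemperature (hint : Integrable (fun h : ℝ => h) ν) {θ : ℝ}
    (hθ : 0 < θ) {τ : ℕ} (hcrit : CriticalTemperature ν θ τ) : HasFlatness ν θ τ := by
  have hτ := two_le_of_criticalTemperature hint hθ hcrit
  obtain ⟨-, -, hderiv, hexpansion⟩ := hcrit
  exact hasFlatness_of_deriv hint hθ (div_pos hderiv (by positivity))
    (deriv_expansion (by omega) (contDiff_potential hint θ _)
      (contDiff_deriv_potential hint θ _) hexpansion)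

theorem abs_restoringForce_le (ν : Measure ℝ) [IsProbabilityMeasure ν] (θ m : ℝ) :
    |restoringForce ν θ m| ≤ |m| + 1 :=
  (abs_sub _ _).trans <| by
    gcongr
    exact abs_integral_le_of_abs_le fun s => abs_tanh_le_one _

theorem exists_abs_restoringForce_le {θ : ℝ} {τ : ℕ} (hτ : HasFlatness ν θ τ) :
    ∃ C > 0, ∀ m, |m| ≤ 1 → |restoringForce ν θ m| ≤ C * |m| ^ (2 * τ - 1) := by
  obtain ⟨D, -, ho⟩ := hτ
  have hO := (ho.isBigO.add (Asymptotics.isBigO_const_mul_self D _ (𝓝 0))).congr_left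
    (f₂ := restoringForce ν θ) fun m => by ring
  obtain ⟨A, hA, hO⟩ := hO.exists_pos
  obtain ⟨δ, hδ, hball⟩ := Metric.eventually_nhds_iff.1 hO.bound
  refine ⟨max A (2 / δ ^ (2 * τ - 1)), lt_max_of_lt_left hA, fun m hm => ?_⟩
  rcases lt_or_ge |m| δ with hsmall | hlarge
  · have hnear := hball (y := m) (by rwa [Real.dist_eq, sub_zero])
    simp only [Real.norm_eq_abs, abs_pow] at hnear
    exact hnear.trans (mul_le_mul_of_nonneg_right (le_max_left _ _) (by positivity))
  · calc |restoringForce ν θ m| ≤ 2 := by linarith [abs_restoringForce_le ν θ m]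
      _ = 2 / δ ^ (2 * τ - 1) * δ ^ (2 * τ - 1) := by field_simp
      _ ≤ max A (2 / δ ^ (2 * τ - 1)) * |m| ^ (2 * τ - 1) := by
          gcongr
          exact le_max_right _ _

end RestoringForce

/-! ### Comparison with independent spins -/

/-- The gain in the logarithmic partition function of a single spin in the field `s` when the
field is shifted by `q`. -/
def logCoshGain (q s : ℝ) : ℝ := Real.log (Real.cosh (q + s)) - Real.log (Real.cosh s)

theorem continuous_logCoshGain (q : ℝ) : Continuous (logCoshGain q) :=
  (continuous_log_cosh.comp (continuous_const_add q)).sub continuous_log_cosh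

theorem abs_logCoshGain_le (q s : ℝ) : |logCoshGain q s| ≤ |q| := abs_log_cosh_add_sub_le q s

theorem exp_logCoshGain (q s : ℝ) :
    Real.exp (logCoshGain q s) = Real.cosh (q + s) / Real.cosh s := by
  rw [logCoshGain, Real.exp_sub, Real.exp_log (Real.cosh_pos _), Real.exp_log (Real.cosh_pos _)]

section FreeSpins

variable {ι : Type*} [Fintype ι] [DecidableEq ι]

theorem sum_exp_sum_mul_spin (u : ι → ℝ) :
    ∑ x : ι → Bool, Real.exp (∑ i, u i * spin (x i)) = ∏ i, (2 * Real.cosh (u i)) := by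
  simp only [Real.exp_sum]
  rw [← Fintype.prod_sum fun i (b : Bool) => Real.exp (u i * spin b)]
  refine Finset.prod_congr rfl fun i _ => ?_
  rw [Fintype.sum_bool, Real.cosh_eq]
  simp only [spin, if_true, Bool.false_eq_true, if_false, mul_one, mul_neg]
  ring

theorem sum_exp_shift_add_sum_mul_spin (S : Finset ι) (h : ι → ℝ) (q : ℝ) :
    ∑ x : ι → Bool, Real.exp (q * ∑ i ∈ S, spin (x i) + ∑ i, h i * spin (x i)) =
      Real.exp (∑ i ∈ S, logCoshGain q (h i)) * ∏ i, (2 * Real.cosh (h i)) := by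
  have hexponent : ∀ x : ι → Bool, q * ∑ i ∈ S, spin (x i) + ∑ i, h i * spin (x i) =
      ∑ i, ((if i ∈ S then q else 0) + h i) * spin (x i) := fun x => by
    simp only [add_mul, Finset.sum_add_distrib, ite_mul, zero_mul, Finset.sum_ite_mem,
      Finset.univ_inter, Finset.mul_sum]
  have hclique : ∏ i ∈ S, Real.cosh (q + h i) / Real.cosh (h i) =
      ∏ i, (if i ∈ S then Real.cosh (q + h i) / Real.cosh (h i) else 1) := by
    rw [Finset.prod_ite_mem, Finset.univ_inter]
  simp only [hexponent, sum_exp_sum_mul_spin]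
  simp only [Real.exp_sum, exp_logCoshGain]
  rw [hclique, ← Finset.prod_mul_distrib]
  refine Finset.prod_congr rfl fun i _ => ?_
  split_ifs
  · have := (Real.cosh_pos (h i)).ne'
    field_simp
  · simp

end FreeSpins

section QuenchedComparison

variable {n : ℕ} {θ : ℝ} {S : Finset (Fin n)}

theorem exp_mul_prod_cosh_le_sum_gibbsWeight (hθ : 0 ≤ θ) (hS : 0 < S.card) (h : Fin n → ℝ)
    (x : ℝ) :
    Real.exp (∑ i ∈ S, logCoshGain (√θ * x) (h i) - S.card * (x ^ 2 / 2)) *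
      ∏ i, (2 * Real.cosh (h i)) ≤ ∑ y, gibbsWeight θ S h y := by
  have : (0 : ℝ) < S.card := by exact_mod_cast hS
  rw [sub_eq_add_neg, Real.exp_add, mul_right_comm, ← sum_exp_shift_add_sum_mul_spin,
    Finset.sum_mul]
  refine Finset.sum_le_sum fun y _ => ?_
  rw [← Real.exp_add, gibbsWeight, Real.exp_le_exp]
  generalize ∑ i ∈ S, spin (y i) = M
  have hsquare : θ / (2 * S.card) * M ^ 2 + S.card * (x ^ 2 / 2) - √θ * x * M =
      (√θ * M - S.card * x) ^ 2 / (2 * S.card) := by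
    field_simp
    linear_combination (-M ^ 2) * Real.sq_sqrt hθ
  have hsquare_nonneg : 0 ≤ (√θ * M - S.card * x) ^ 2 / (2 * S.card) := by positivity
  linarith

theorem exp_neg_gibbsMean_le (h : Fin n → ℝ) (f : (Fin n → Bool) → ℝ) :
    Real.exp (-gibbsMean θ S h f) ≤ gibbsMean θ S h fun y => Real.exp (-f y) := by
  have hjensen := convexOn_exp.map_sum_le (p := fun y => -f y)
    (fun y _ => gibbsProb_nonneg θ S h y) (sum_gibbsProb θ S h) fun y _ => Set.mem_univ _
  simpa [gibbsMean] using hjensen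

theorem gibbsMean_exp_neg_interaction (h : Fin n → ℝ) :
    gibbsMean θ S h (fun y => Real.exp (-(θ / (2 * S.card) * (∑ i ∈ S, spin (y i)) ^ 2))) =
      (∏ i, (2 * Real.cosh (h i))) / ∑ y, gibbsWeight θ S h y := by
  rw [gibbsMean_eq_div, ← sum_exp_sum_mul_spin]
  congr 1
  refine Finset.sum_congr rfl fun y _ => ?_
  rw [gibbsWeight, ← Real.exp_add, add_neg_cancel_comm]

theorem le_gibbsMean_sq_sum_spin (hθ : 0 ≤ θ) (hS : 0 < S.card) (h : Fin n → ℝ) (x : ℝ) :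
    ∑ i ∈ S, logCoshGain (√θ * x) (h i) - S.card * (x ^ 2 / 2) ≤
      θ / (2 * S.card) * gibbsMean θ S h (fun y => (∑ i ∈ S, spin (y i)) ^ 2) := by
  have hfree : 0 < ∏ i, (2 * Real.cosh (h i)) :=
    Finset.prod_pos fun i _ => mul_pos two_pos (Real.cosh_pos _)
  have hjensen := exp_neg_gibbsMean_le (θ := θ) (S := S) h
    fun y => θ / (2 * S.card) * (∑ i ∈ S, spin (y i)) ^ 2
  rw [gibbsMean_exp_neg_interaction, le_div_iff₀ sum_gibbsWeight_pos, gibbsMean_const_mul]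
    at hjensen
  have hprod := (mul_le_mul_of_nonneg_left (exp_mul_prod_cosh_le_sum_gibbsWeight hθ hS h x)
    (Real.exp_pos _).le).trans hjensen
  rw [← mul_assoc, ← Real.exp_add] at hprod
  linarith [Real.exp_le_one_iff.1 (le_of_mul_le_mul_right (hprod.trans_eq (one_mul _).symm) hfree)]

end QuenchedComparison

section AnnealedSecondMoment

variable {n : ℕ} {S : Finset (Fin n)} {ν : Measure ℝ} [IsProbabilityMeasure ν]

theorem integral_logCoshGain (hint : Integrable (fun h : ℝ => h) ν) (θ x : ℝ) :
    ∫ s, logCoshGain (√θ * x) s ∂ν = x ^ 2 / 2 - (potential ν θ x - potential ν θ 0) := by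
  have hint_zero := integrable_log_cosh hint 0
  simp only [zero_add] at hint_zero
  simp only [logCoshGain]
  rw [integral_sub (integrable_log_cosh hint _) hint_zero]
  simp only [potential, mul_zero, zero_add]
  ring

theorem le_integral_sq_sum_spin (hint : Integrable (fun h : ℝ => h) ν) {θ : ℝ} (hθ : 0 ≤ θ)
    (hS : 0 < S.card) (x : ℝ) :
    S.card * (potential ν θ 0 - potential ν θ x) ≤
      θ / (2 * S.card) * ∫ y, (∑ i ∈ S, spin (y i)) ^ 2 ∂(plantedLaw ν θ S) := by
  have hgain : ∀ i ∈ S, Integrable (fun h : Fin n → ℝ => logCoshGain (√θ * x) (h i))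
      (iidField (Fin n) ν) := fun i _ =>
    integrable_of_continuous_of_abs_le ((continuous_logCoshGain _).comp (continuous_apply i))
      fun h => abs_logCoshGain_le _ _
  rw [integral_plantedLaw, ← integral_const_mul]
  refine le_trans (le_of_eq ?_) (integral_mono
    ((integrable_finsetSum S hgain).sub (integrable_const _))
    ((integrable_gibbsMean ν θ S _).const_mul _) fun h => le_gibbsMean_sq_sum_spin hθ hS h x)
  simp only [Pi.sub_apply]
  rw [integral_sub (integrable_finsetSum S hgain) (integrable_const _), integral_finsetSum _ hgain]
  simp only [integral_field_apply _ (continuous_logCoshGain _), integral_logCoshGain hint]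
  simp only [Finset.sum_sub_distrib, Finset.sum_const, nsmul_eq_mul, integral_const,
    probReal_univ, smul_eq_mul]
  ring

end AnnealedSecondMoment

/-! ### Large deviations of the magnetization -/

/-- The average spin of the vertices in `S`; the junk value for `S = ∅` is `0`. -/
def magnetization {ι : Type*} (S : Finset ι) (x : ι → Bool) : ℝ :=
  (∑ i ∈ S, spin (x i)) / S.card

theorem abs_magnetization_le_one {ι : Type*} (S : Finset ι) (x : ι → Bool) :
    |magnetization S x| ≤ 1 := by
  rw [magnetization, abs_div, Nat.abs_cast]
  exact div_le_one_of_le₀ (abs_sum_spin_le S x) (Nat.cast_nonneg _)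

theorem card_mul_magnetization {ι : Type*} {S : Finset ι} (hS : 0 < S.card) (x : ι → Bool) :
    S.card * magnetization S x = ∑ i ∈ S, spin (x i) :=
  mul_div_cancel₀ _ (Nat.cast_ne_zero.2 hS.ne')

/-- The exponential rate, contributed by one clique spin in the field `s`, of the event that the
magnetization of the clique equals `m`. -/
def siteRate (θ m s : ℝ) : ℝ := logCoshGain (θ * m) s - θ * m ^ 2 / 2

section SiteRate

variable {ν : Measure ℝ} [IsProbabilityMeasure ν] {θ m : ℝ}

theorem continuous_siteRate : Continuous (siteRate θ m) :=
  (continuous_logCoshGain _).sub continuous_const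

theorem abs_siteRate_le (hθ : 0 ≤ θ) (hm : |m| ≤ 1) (s : ℝ) : |siteRate θ m s| ≤ 2 * θ := by
  have hshift : |θ * m| ≤ θ := by
    rw [abs_mul, abs_of_nonneg hθ]
    exact mul_le_of_le_one_right hθ hm
  have hsq : m ^ 2 ≤ 1 := (sq_le_one_iff_abs_le_one m).2 hm
  have hquad : |θ * m ^ 2 / 2| ≤ θ := by
    rw [abs_of_nonneg (by positivity)]
    nlinarith
  have htri : |siteRate θ m s| ≤ |logCoshGain (θ * m) s| + |θ * m ^ 2 / 2| := abs_sub _ _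
  linarith [abs_logCoshGain_le (θ * m) s]

theorem integral_siteRate (hint : Integrable (fun h : ℝ => h) ν) (hθ : 0 ≤ θ) (m : ℝ) :
    ∫ s, siteRate θ m s ∂ν = -(potential ν θ (√θ * m) - potential ν θ 0) := by
  have hgain := integral_logCoshGain hint θ (√θ * m)
  rw [← mul_assoc, Real.mul_self_sqrt hθ, mul_pow, Real.sq_sqrt hθ] at hgain
  simp only [siteRate]
  rw [integral_sub (integrable_of_continuous_of_abs_le (continuous_logCoshGain _)
    (abs_logCoshGain_le _)) (integrable_const _), hgain]
  simp

theorem integral_exp_mul_siteRate_le (hint : Integrable (fun h : ℝ => h) ν) (hθ : 0 ≤ θ)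
    (hm : |m| ≤ 1) {l : ℝ} (hl : 0 ≤ l) (hlθ : l * (2 * θ) ≤ 1) :
    ∫ s, Real.exp (l * siteRate θ m s) ∂ν ≤
      1 - l * (potential ν θ (√θ * m) - potential ν θ 0) + l ^ 2 * (2 * θ) ^ 2 := by
  have hbound := abs_siteRate_le hθ hm
  have hsq : ∫ s, siteRate θ m s ^ 2 ∂ν ≤ (2 * θ) ^ 2 :=
    (le_abs_self _).trans (abs_integral_le_of_abs_le fun s => by
      rw [abs_pow]
      exact pow_le_pow_left₀ (abs_nonneg _) (hbound s) 2)
  refine (integral_exp_mul_le continuous_siteRate.measurable hbound hl hlθ).trans ?_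
  rw [integral_siteRate hint hθ]
  linarith [mul_le_mul_of_nonneg_left hsq (sq_nonneg l)]

theorem exists_le_potential_sub (hint : Integrable (fun h : ℝ => h) ν) (hθ : 0 < θ)
    (hmin : ZeroIsUniqueMinimum ν θ) {δ : ℝ} (hδ : 0 < δ) :
    ∃ c > 0, ∀ m, δ ≤ |m| → |m| ≤ 1 → c ≤ potential ν θ (√θ * m) - potential ν θ 0 := by
  have hcompact : IsCompact ({m : ℝ | δ ≤ |m|} ∩ Set.Icc (-1) 1) :=
    isCompact_Icc.inter_left (isClosed_le continuous_const continuous_abs)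
  have hcont : Continuous fun m => potential ν θ (√θ * m) - potential ν θ 0 :=
    ((contDiff_potential hint θ 0).continuous.comp (by fun_prop)).sub continuous_const
  obtain ⟨c, hc₀, hc⟩ := hcompact.exists_forall_le' hcont.continuousOn (a := 0) fun m hm =>
    sub_pos.2 (hmin _ (mul_ne_zero (Real.sqrt_pos.2 hθ).ne' (abs_pos.1 (hδ.trans_le hm.1))))
  exact ⟨c, hc₀, fun m hδm hm => hc m ⟨hδm, abs_le.1 hm⟩⟩

theorem exists_integral_exp_mul_siteRate_le (hint : Integrable (fun h : ℝ => h) ν) (hθ : 0 < θ)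
    (hmin : ZeroIsUniqueMinimum ν θ) {δ : ℝ} (hδ : 0 < δ) :
    ∃ l, 0 ≤ l ∧ l ≤ 1 ∧ ∃ q, 0 ≤ q ∧ q < 1 ∧
      ∀ m, δ ≤ |m| → |m| ≤ 1 → ∫ s, Real.exp (l * siteRate θ m s) ∂ν ≤ q := by
  obtain ⟨c, hc₀, hc⟩ := exists_le_potential_sub hint hθ hmin hδ
  set l := min 1 (min (1 / (2 * θ)) (c / (2 * (2 * θ) ^ 2)))
  have hl₀ : 0 < l := by positivity
  have hlθ : l * (2 * θ) ≤ 1 :=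
    (le_div_iff₀ (by positivity)).1 ((min_le_right _ _).trans (min_le_left _ _))
  have hlc : l * (2 * (2 * θ) ^ 2) ≤ c :=
    (le_div_iff₀ (by positivity)).1 ((min_le_right _ _).trans (min_le_right _ _))
  have hlc₀ : 0 < l * c := mul_pos hl₀ hc₀
  refine ⟨l, hl₀.le, min_le_left _ _, max 0 (1 - l * c / 2), le_max_left _ _,
    max_lt one_pos (by linarith), fun m hδm hm => le_max_of_le_right ?_⟩
  refine (integral_exp_mul_siteRate_le hint hθ.le hm hl₀.le hlθ).trans ?_
  nlinarith [mul_le_mul_of_nonneg_left (hc m hδm hm) hl₀.le,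
    mul_le_mul_of_nonneg_left hlc hl₀.le]

end SiteRate

section LargeDeviations

variable {n : ℕ} {S : Finset (Fin n)} {ν : Measure ℝ} [IsProbabilityMeasure ν] {θ m l : ℝ}

theorem gibbsMean_magnetization_eq_le (hθ : 0 ≤ θ) (hS : 0 < S.card) (h : Fin n → ℝ) (m : ℝ) :
    gibbsMean θ S h (fun y => if magnetization S y = m then 1 else 0) ≤
      Real.exp (∑ i ∈ S, siteRate θ m (h i)) := by
  have : (S.card : ℝ) ≠ 0 := Nat.cast_ne_zero.2 hS.ne'
  have hpartition : ∏ i, (2 * Real.cosh (h i)) ≤ ∑ y, gibbsWeight θ S h y := by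
    simpa [logCoshGain] using exp_mul_prod_cosh_le_sum_gibbsWeight hθ hS h 0
  rw [gibbsMean_eq_div, div_le_iff₀ sum_gibbsWeight_pos]
  refine le_trans ?_ (mul_le_mul_of_nonneg_left hpartition (Real.exp_pos _).le)
  simp only [siteRate, Finset.sum_sub_distrib, Finset.sum_const, nsmul_eq_mul]
  rw [sub_eq_add_neg, Real.exp_add, mul_right_comm, ← sum_exp_shift_add_sum_mul_spin,
    Finset.sum_mul]
  refine Finset.sum_le_sum fun y _ => ?_
  split_ifs with hy
  · rw [mul_one, gibbsWeight, ← card_mul_magnetization hS, hy, ← Real.exp_add]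
    refine (congrArg Real.exp ?_).le
    field_simp
    ring
  · rw [mul_zero]
    positivity

theorem gibbsMean_magnetization_eq_le_exp_mul (hθ : 0 ≤ θ) (hS : 0 < S.card) (hl : 0 ≤ l)
    (hl₁ : l ≤ 1) (h : Fin n → ℝ) :
    gibbsMean θ S h (fun y => if magnetization S y = m then 1 else 0) ≤
      Real.exp (l * ∑ i ∈ S, siteRate θ m (h i)) := by
  have hexp := gibbsMean_magnetization_eq_le hθ hS h m
  have hprob : gibbsMean θ S h (fun y => if magnetization S y = m then 1 else 0) ≤ 1 :=
    (gibbsMean_mono (g := fun _ => 1) fun y => by split_ifs <;> norm_num).trans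
      (gibbsMean_const 1).le
  rcases le_total 0 (∑ i ∈ S, siteRate θ m (h i)) with hsign | hsign
  · exact hprob.trans (Real.one_le_exp (mul_nonneg hl hsign))
  · exact hexp.trans (Real.exp_le_exp.2 (by nlinarith))

theorem integral_magnetization_eq_le (hθ : 0 ≤ θ) (hS : 0 < S.card) (hm : |m| ≤ 1) (hl : 0 ≤ l)
    (hl₁ : l ≤ 1) :
    ∫ y, (if magnetization S y = m then (1 : ℝ) else 0) ∂(plantedLaw ν θ S) ≤
      (∫ s, Real.exp (l * siteRate θ m s) ∂ν) ^ S.card := by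
  rw [← integral_prod_field, integral_plantedLaw]
  simp only [← Real.exp_sum, ← Finset.mul_sum]
  refine integral_mono (integrable_gibbsMean ν θ S _) ?_
    (gibbsMean_magnetization_eq_le_exp_mul hθ hS hl hl₁)
  have hcont : Continuous fun h : Fin n → ℝ => ∑ i ∈ S, siteRate θ m (h i) :=
    continuous_finsetSum S fun i _ => continuous_siteRate.comp (continuous_apply i)
  refine integrable_of_continuous_of_abs_le (B := Real.exp (l * (S.card * (2 * θ))))
    (Real.continuous_exp.comp (hcont.const_mul l)) fun h => ?_
  rw [Real.abs_exp, Real.exp_le_exp, ← nsmul_eq_mul]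
  exact mul_le_mul_of_nonneg_left (Finset.sum_le_card_nsmul S _ _ fun i _ =>
    (abs_le.1 (abs_siteRate_le hθ hm _)).2) hl

theorem exists_magnetization_eq {ι : Type*} (S : Finset ι) (x : ι → Bool) :
    ∃ j ∈ Finset.range (S.card + 1), magnetization S x = (2 * (j : ℝ) - S.card) / S.card := by
  refine ⟨(S.filter fun i => x i = true).card,
    Finset.mem_range.2 (Nat.lt_succ_of_le (Finset.card_filter_le _ _)), ?_⟩
  have hspin : ∀ i, spin (x i) = 2 * (if x i = true then 1 else 0) - 1 := fun i => by
    cases x i <;> norm_num [spin]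
  simp only [magnetization, hspin, Finset.sum_sub_distrib, ← Finset.mul_sum, Finset.sum_boole]
  simp

theorem integral_large_magnetization_le {ι : Type*} {S : Finset ι} [Finite ι]
    {P : Measure (ι → Bool)} [IsFiniteMeasure P] (hS : 0 < S.card) {δ p : ℝ} (hp : 0 ≤ p)
    (hlevel : ∀ m, δ ≤ |m| → |m| ≤ 1 →
      ∫ y, (if magnetization S y = m then (1 : ℝ) else 0) ∂P ≤ p) :
    ∫ y, (if δ < |magnetization S y| then (1 : ℝ) else 0) ∂P ≤
      (S.card + 1) * p := by
  have hk : (0 : ℝ) < S.card := by exact_mod_cast hS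
  set value : ℕ → ℝ := fun j => (2 * (j : ℝ) - S.card) / S.card with hvalue
  set large := (Finset.range (S.card + 1)).filter fun j => δ < |value j|
  have hvalue_le : ∀ j ∈ large, |value j| ≤ 1 := fun j hj => by
    have hjk : (j : ℝ) ≤ S.card := by
      exact_mod_cast Nat.lt_succ_iff.1 (Finset.mem_range.1 (Finset.mem_filter.1 hj).1)
    rw [hvalue, abs_div, abs_of_pos hk, div_le_one hk, abs_le]
    constructor <;> linarith [(Nat.cast_nonneg j : (0 : ℝ) ≤ j)]
  calc ∫ y, (if δ < |magnetization S y| then (1 : ℝ) else 0) ∂P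
      ≤ ∫ y, ∑ j ∈ large, (if magnetization S y = value j then (1 : ℝ) else 0) ∂P := by
        refine integral_mono .of_finite .of_finite fun y => ?_
        simp only
        obtain ⟨j, hj, hjy⟩ := exists_magnetization_eq S y
        split_ifs with hy
        · rw [hjy] at hy
          refine le_of_eq_of_le (if_pos hjy).symm
            (Finset.single_le_sum
              (f := fun j => if magnetization S y = value j then (1 : ℝ) else 0)
              (fun _ _ => ?_) (Finset.mem_filter.2 ⟨hj, hy⟩))
          split_ifs <;> norm_num
        · exact Finset.sum_nonneg fun _ _ => by split_ifs <;> norm_num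
    _ ≤ ∑ _j ∈ large, p := by
        rw [integral_finsetSum _ fun j _ => .of_finite]
        exact Finset.sum_le_sum fun j hj =>
          hlevel _ (Finset.mem_filter.1 hj).2.le (hvalue_le j hj)
    _ = large.card * p := by rw [Finset.sum_const, nsmul_eq_mul]
    _ ≤ (S.card + 1) * p := by
        refine mul_le_mul_of_nonneg_right ?_ hp
        exact_mod_cast (Finset.card_filter_le _ _).trans_eq (Finset.card_range _)

theorem eventually_integral_large_magnetization_le (hint : Integrable (fun h : ℝ => h) ν)
    (hθ : 0 < θ) (hmin : ZeroIsUniqueMinimum ν θ) {δ : ℝ} (hδ : 0 < δ) :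
    ∀ᶠ k : ℕ in atTop, ∀ (n : ℕ) (S : Finset (Fin n)), S.card = k →
      ∫ y, (if δ < |magnetization S y| then (1 : ℝ) else 0) ∂(plantedLaw ν θ S) ≤
        1 / k := by
  obtain ⟨l, hl₀, hl₁, q, hq₀, hq₁, hq⟩ := exists_integral_exp_mul_siteRate_le hint hθ hmin hδ
  have hlim : Tendsto (fun k : ℕ => (k : ℝ) ^ 2 * q ^ k + (k : ℝ) ^ 1 * q ^ k) atTop (𝓝 0) := by
    simpa using (tendsto_pow_const_mul_const_pow_of_lt_one 2 hq₀ hq₁).add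
      (tendsto_pow_const_mul_const_pow_of_lt_one 1 hq₀ hq₁)
  filter_upwards [hlim.eventually (gt_mem_nhds one_pos), eventually_ge_atTop 1] with k hk hk₁
  rintro n S rfl
  have hcard : (0 : ℝ) < S.card := by exact_mod_cast hk₁
  refine (integral_large_magnetization_le hk₁ (pow_nonneg hq₀ S.card) fun m hδm hm =>
    (integral_magnetization_eq_le hθ.le hk₁ hm hl₀ hl₁).trans (pow_le_pow_left₀
      (integral_nonneg fun s => (Real.exp_pos _).le) (hq m hδm hm) _)).trans ?_
  rw [le_div_iff₀ hcard]
  nlinarith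

end LargeDeviations

/-! ### The mean-field equation -/

/-- The deviation of the spin at `i` from its mean given the field and the other spins. -/
def spinDefect {n : ℕ} (θ : ℝ) (S : Finset (Fin n)) (h : Fin n → ℝ) (i : Fin n)
    (x : Fin n → Bool) : ℝ := spin (x i) - Real.tanh (cavityField θ S i x + h i)

/-- The amount by which the magnetization fails to solve the quenched mean-field equation
`m = k⁻¹ ∑_{i ∈ S} tanh (θ m + h i)`. -/
def meanFieldDefect {n : ℕ} (θ : ℝ) (S : Finset (Fin n)) (h : Fin n → ℝ) (x : Fin n → Bool) : ℝ :=
  magnetization S x - (∑ i ∈ S, Real.tanh (θ * magnetization S x + h i)) / S.card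

section MeanField

variable {n : ℕ} {θ : ℝ} {S : Finset (Fin n)} {h : Fin n → ℝ}

theorem abs_spinDefect_le (i : Fin n) (x : Fin n → Bool) : |spinDefect θ S h i x| ≤ 2 := by
  refine (abs_sub _ _).trans ?_
  rw [abs_spin]
  linarith [abs_tanh_le_one (cavityField θ S i x + h i)]

theorem gibbsMean_mul_spinDefect {i : Fin n} (hi : i ∈ S) {f : (Fin n → Bool) → ℝ}
    (hf : ∀ x, f (flipAt i x) = f x) :
    gibbsMean θ S h (fun x => f x * spinDefect θ S h i x) = 0 :=
  gibbsMean_mul_spin_sub_tanh hi h hf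

theorem abs_gibbsMean_mul_spinDefect_le {i : Fin n} (hi : i ∈ S) {f g : (Fin n → Bool) → ℝ}
    (hg : ∀ x, g (flipAt i x) = g x) {ε : ℝ} (hε : ∀ x, |f x - g x| ≤ ε) :
    |gibbsMean θ S h (fun x => f x * spinDefect θ S h i x)| ≤ ε * 2 := by
  have hsub : gibbsMean θ S h (fun x => f x * spinDefect θ S h i x) =
      gibbsMean θ S h (fun x => (f x - g x) * spinDefect θ S h i x) := by
    simp only [sub_mul]
    rw [gibbsMean_sub, gibbsMean_mul_spinDefect hi hg, sub_zero]
  rw [hsub]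
  refine abs_gibbsMean_le fun x => ?_
  rw [abs_mul]
  exact mul_le_mul (hε x) (abs_spinDefect_le i x) (abs_nonneg _) ((abs_nonneg _).trans (hε x))

theorem abs_gibbsMean_spinDefect_mul_le (hθ : 0 ≤ θ) {i j : Fin n} (hi : i ∈ S) (hij : i ≠ j) :
    |gibbsMean θ S h (fun x => spinDefect θ S h j x * spinDefect θ S h i x)| ≤
      θ / S.card * 2 := by
  refine abs_gibbsMean_mul_spinDefect_le hi
    (g := fun x => spin (x j) -
      Real.tanh (θ / S.card * ∑ l ∈ (S.erase j).erase i, spin (x l) + h j))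
    (fun x => by rw [sum_spin_flipAt (Finset.notMem_erase i _), flipAt_of_ne hij.symm])
    fun x => ?_
  have hfield : cavityField θ S j x + h j -
      (θ / S.card * ∑ l ∈ (S.erase j).erase i, spin (x l) + h j) = θ / S.card * spin (x i) := by
    rw [cavityField, cavitySum, ← Finset.add_sum_erase _ _ (Finset.mem_erase.2 ⟨hij, hi⟩)]
    ring
  rw [spinDefect, sub_sub_sub_cancel_left, abs_sub_comm]
  refine (abs_tanh_sub_tanh_le _ _).trans ?_
  rw [hfield, abs_mul, abs_spin, mul_one, abs_of_nonneg (by positivity)]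

theorem gibbsMean_sq_sum_spinDefect_le (hθ : 0 ≤ θ) (hS : 0 < S.card) :
    gibbsMean θ S h (fun x => (∑ i ∈ S, spinDefect θ S h i x) ^ 2) ≤ (4 + 2 * θ) * S.card := by
  have : (0 : ℝ) < S.card := by exact_mod_cast hS
  have hterm : ∀ i ∈ S, ∀ j ∈ S,
      gibbsMean θ S h (fun x => spinDefect θ S h i x * spinDefect θ S h j x) ≤
        (if i = j then 4 else 0) + θ / S.card * 2 := by
    intro i _ j hj
    split_ifs with hij
    · subst hij
      refine (le_abs_self _).trans ((abs_gibbsMean_le (B := 2 * 2) fun x => ?_).trans ?_)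
      · rw [abs_mul]
        exact mul_le_mul (abs_spinDefect_le i x) (abs_spinDefect_le i x) (abs_nonneg _) two_pos.le
      · linarith [show 0 ≤ θ / S.card * 2 by positivity]
    · rw [zero_add]
      exact (le_abs_self _).trans (abs_gibbsMean_spinDefect_mul_le hθ hj (Ne.symm hij))
  simp only [sq, Finset.sum_mul_sum, gibbsMean_sum]
  calc ∑ i ∈ S, ∑ j ∈ S, gibbsMean θ S h (fun x => spinDefect θ S h i x * spinDefect θ S h j x)
      ≤ ∑ i ∈ S, ∑ j ∈ S, ((if i = j then (4 : ℝ) else 0) + θ / S.card * 2) :=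
        Finset.sum_le_sum fun i hi => Finset.sum_le_sum fun j hj => hterm i hi j hj
    _ = ∑ _i ∈ S, (4 + 2 * θ) := by
        refine Finset.sum_congr rfl fun i hi => ?_
        rw [Finset.sum_add_distrib, Finset.sum_ite_eq, if_pos hi, Finset.sum_const, nsmul_eq_mul]
        field_simp
    _ = (4 + 2 * θ) * S.card := by rw [Finset.sum_const, nsmul_eq_mul, mul_comm]

theorem abs_card_mul_meanFieldDefect_sub_le (hθ : 0 ≤ θ) (hS : 0 < S.card) (x : Fin n → Bool) :
    |S.card * meanFieldDefect θ S h x - ∑ i ∈ S, spinDefect θ S h i x| ≤ θ := by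
  have hk : (0 : ℝ) < S.card := by exact_mod_cast hS
  have hsum : S.card * meanFieldDefect θ S h x - ∑ i ∈ S, spinDefect θ S h i x =
      ∑ i ∈ S, (Real.tanh (cavityField θ S i x + h i) -
        Real.tanh (θ * magnetization S x + h i)) := by
    unfold meanFieldDefect spinDefect
    rw [mul_sub, mul_div_cancel₀ _ hk.ne', card_mul_magnetization hS, Finset.sum_sub_distrib,
      Finset.sum_sub_distrib]
    ring
  have hsite : ∀ i ∈ S, |Real.tanh (cavityField θ S i x + h i) -
      Real.tanh (θ * magnetization S x + h i)| ≤ θ / S.card := by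
    intro i hi
    have hfield : cavityField θ S i x + h i - (θ * magnetization S x + h i) =
        -(θ / S.card * spin (x i)) := by
      rw [cavityField, magnetization, cavitySum_add_spin hi]
      ring
    refine (abs_tanh_sub_tanh_le _ _).trans ?_
    rw [hfield, abs_neg, abs_mul, abs_spin, mul_one, abs_of_nonneg (by positivity)]
  rw [hsum]
  refine (Finset.abs_sum_le_sum_abs _ _).trans ((Finset.sum_le_sum hsite).trans_eq ?_)
  rw [Finset.sum_const, nsmul_eq_mul, mul_div_cancel₀ _ hk.ne']

theorem gibbsMean_sq_meanFieldDefect_le (hθ : 0 ≤ θ) (hS : 0 < S.card) :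
    gibbsMean θ S h (fun x => meanFieldDefect θ S h x ^ 2) ≤
      (8 + 4 * θ + 2 * θ ^ 2) / S.card := by
  have hk : (1 : ℝ) ≤ S.card := by exact_mod_cast hS
  have hspin := gibbsMean_sq_sum_spinDefect_le (h := h) hθ hS
  have hclose := abs_card_mul_meanFieldDefect_sub_le (h := h) hθ hS
  generalize (S.card : ℝ) = k at hk hspin hclose ⊢
  have hpointwise : ∀ x, meanFieldDefect θ S h x ^ 2 ≤
      2 / k ^ 2 * (∑ i ∈ S, spinDefect θ S h i x) ^ 2 + 2 * θ ^ 2 / k ^ 2 := by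
    intro x
    have hclose_sq := sq_le_sq' (abs_le.1 (hclose x)).1 (abs_le.1 (hclose x)).2
    rw [div_mul_eq_mul_div, ← add_div, le_div_iff₀ (by positivity)]
    nlinarith [sq_nonneg (k * meanFieldDefect θ S h x - 2 * ∑ i ∈ S, spinDefect θ S h i x)]
  refine (gibbsMean_mono hpointwise).trans ?_
  rw [gibbsMean_add, gibbsMean_const_mul, gibbsMean_const]
  calc 2 / k ^ 2 * gibbsMean θ S h (fun x => (∑ i ∈ S, spinDefect θ S h i x) ^ 2) +
        2 * θ ^ 2 / k ^ 2
      ≤ 2 / k ^ 2 * ((4 + 2 * θ) * k) + 2 * θ ^ 2 / k := by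
        gcongr
        exact le_self_pow₀ hk two_ne_zero
    _ = (8 + 4 * θ + 2 * θ ^ 2) / k := by
        field_simp
        ring

theorem abs_gibbsMean_meanFieldDefect_le (hθ : 0 ≤ θ) (hS : 0 < S.card) :
    |gibbsMean θ S h (meanFieldDefect θ S h)| ≤ θ / S.card := by
  have hk : (0 : ℝ) < S.card := by exact_mod_cast hS
  have hspin : gibbsMean θ S h (fun x => ∑ i ∈ S, spinDefect θ S h i x) = 0 := by
    rw [gibbsMean_sum]
    exact Finset.sum_eq_zero fun i hi => by
      simpa only [one_mul] using gibbsMean_mul_spinDefect hi (f := fun _ => 1) fun _ => rfl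
  have hclose := abs_gibbsMean_le (θ := θ) (S := S) (h := h)
    (abs_card_mul_meanFieldDefect_sub_le (h := h) hθ hS)
  rw [gibbsMean_sub, gibbsMean_const_mul, hspin, sub_zero, abs_mul, abs_of_pos hk] at hclose
  rwa [le_div_iff₀ hk, mul_comm]

end MeanField

/-! ### Expansion of `tanh` -/

/-- The coefficient of `tanh u ^ (p + 1)` in the expansion of `tanh (u + s)`. -/
def tanhCoeff (p : ℕ) (s : ℝ) : ℝ := (1 - Real.tanh s ^ 2) * (-Real.tanh s) ^ p

theorem continuous_tanhCoeff (p : ℕ) : Continuous (tanhCoeff p) :=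
  (continuous_const.sub (continuous_tanh.pow 2)).mul (continuous_tanh.neg.pow p)

theorem abs_tanhCoeff_le (p : ℕ) (s : ℝ) : |tanhCoeff p s| ≤ 1 := by
  rw [tanhCoeff, abs_mul, abs_pow, abs_neg]
  exact mul_le_one₀ (abs_one_sub_tanh_sq_le s) (by positivity)
    (pow_le_one₀ (abs_nonneg _) (abs_tanh_le_one s))

theorem tanh_add_mul_one_add (u s : ℝ) :
    Real.tanh (u + s) * (1 + Real.tanh u * Real.tanh s) = Real.tanh u + Real.tanh s := by
  have hu := (Real.cosh_pos u).ne'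
  have hs := (Real.cosh_pos s).ne'
  have hus := (Real.cosh_pos (u + s)).ne'
  simp only [Real.tanh_eq_sinh_div_cosh]
  field_simp
  rw [Real.sinh_add, Real.cosh_add]
  ring

theorem tanh_add_sub_expansion_mul_one_add (P : ℕ) (u s : ℝ) :
    (Real.tanh (u + s) - Real.tanh s -
        ∑ p ∈ Finset.range P, Real.tanh u ^ (p + 1) * tanhCoeff p s) *
      (1 + Real.tanh u * Real.tanh s) =
    Real.tanh u * (1 - Real.tanh s ^ 2) * (-(Real.tanh u * Real.tanh s)) ^ P := by
  have hadd := tanh_add_mul_one_add u s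
  unfold tanhCoeff
  generalize Real.tanh (u + s) = w at hadd ⊢
  generalize Real.tanh u = b at hadd ⊢
  generalize Real.tanh s = t at hadd ⊢
  have hgeom := geom_sum_mul_neg (-(b * t)) P
  have hsum : ∑ p ∈ Finset.range P, b ^ (p + 1) * ((1 - t ^ 2) * (-t) ^ p) =
      b * (1 - t ^ 2) * ∑ p ∈ Finset.range P, (-(b * t)) ^ p := by
    rw [Finset.mul_sum]
    refine Finset.sum_congr rfl fun p _ => ?_
    rw [neg_mul_eq_mul_neg, mul_pow]
    ring
  rw [hsum]
  linear_combination hadd - b * (1 - t ^ 2) * hgeom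

theorem abs_tanh_add_sub_expansion_le (P : ℕ) (u s : ℝ) :
    |Real.tanh (u + s) - Real.tanh s -
      ∑ p ∈ Finset.range P, Real.tanh u ^ (p + 1) * tanhCoeff p s| ≤
        2 * |Real.tanh u| ^ (P + 1) := by
  have hremainder := congrArg abs (tanh_add_sub_expansion_mul_one_add P u s)
  have hu := abs_tanh_le_one u
  have hs := Real.abs_tanh_lt_one s
  generalize ∑ p ∈ Finset.range P, Real.tanh u ^ (p + 1) * tanhCoeff p s = expansion
    at hremainder ⊢
  generalize Real.tanh u = b at hu hremainder ⊢
  generalize Real.tanh s = t at hs hremainder ⊢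
  have hbt : |b * t| ≤ |t| := by
    rw [abs_mul]
    exact mul_le_of_le_one_left (abs_nonneg _) hu
  have hden : 1 - |t| ≤ 1 + b * t := by linarith [neg_abs_le (b * t)]
  have hden_pos : 0 < 1 + b * t := by linarith
  have hsq : |1 - t ^ 2| = (1 + |t|) * (1 - |t|) := by
    rw [abs_of_nonneg (by nlinarith [sq_abs t, abs_nonneg t]), ← sq_abs]
    ring
  have hratio : (1 + |t|) * |t| ^ P ≤ 2 * 1 := by
    gcongr
    · linarith
    · exact pow_le_one₀ (abs_nonneg _) hs.le
  refine le_of_mul_le_mul_right ?_ hden_pos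
  rw [abs_mul, abs_of_pos hden_pos] at hremainder
  rw [hremainder, abs_mul, abs_mul, hsq, abs_pow, abs_neg, abs_mul, mul_pow]
  calc |b| * ((1 + |t|) * (1 - |t|)) * (|b| ^ P * |t| ^ P)
      = |b| ^ (P + 1) * (1 - |t|) * ((1 + |t|) * |t| ^ P) := by ring
    _ ≤ |b| ^ (P + 1) * (1 + b * t) * (2 * 1) := by gcongr
    _ = 2 * |b| ^ (P + 1) * (1 + b * t) := by ring

/-! ### Fluctuations of the empirical field -/

/-- The centred empirical average of `g` over the fields of the clique. -/
def empiricalDev {ι : Type*} (ν : Measure ℝ) (S : Finset ι) (g : ℝ → ℝ) (h : ι → ℝ) : ℝ :=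
  (∑ i ∈ S, (g (h i) - ∫ s, g s ∂ν)) / S.card

/-- The total fluctuation of the first `P` coefficients of the expansion of `tanh (u + h)`. -/
def coeffDev {ι : Type*} (ν : Measure ℝ) (S : Finset ι) (P : ℕ) (h : ι → ℝ) : ℝ :=
  ∑ p ∈ Finset.range P, |empiricalDev ν S (tanhCoeff p) h|

section Fluctuations

variable {ι : Type*} {ν : Measure ℝ} {S : Finset ι}

theorem continuous_empiricalDev {g : ℝ → ℝ} (hg : Continuous g) :
    Continuous (empiricalDev ν S g) := by
  unfold empiricalDev
  fun_prop

theorem continuous_coeffDev (P : ℕ) : Continuous (coeffDev ν S P) :=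
  continuous_finsetSum _ fun p _ => (continuous_empiricalDev (continuous_tanhCoeff p)).abs

theorem coeffDev_nonneg (P : ℕ) (h : ι → ℝ) : 0 ≤ coeffDev ν S P h :=
  Finset.sum_nonneg fun _ _ => abs_nonneg _

theorem empiricalDev_sub {f g : ℝ → ℝ} (hf : Integrable f ν) (hg : Integrable g ν) (h : ι → ℝ) :
    empiricalDev ν S (fun s => f s - g s) h = empiricalDev ν S f h - empiricalDev ν S g h := by
  unfold empiricalDev
  rw [integral_sub hf hg, ← sub_div, ← Finset.sum_sub_distrib]
  simp only [sub_sub_sub_comm]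

theorem empiricalDev_sum_const_mul {κ : Type*} (T : Finset κ) (c : κ → ℝ) {f : κ → ℝ → ℝ}
    (hf : ∀ p, Integrable (f p) ν) (h : ι → ℝ) :
    empiricalDev ν S (fun s => ∑ p ∈ T, c p * f p s) h =
      ∑ p ∈ T, c p * empiricalDev ν S (f p) h := by
  unfold empiricalDev
  rw [integral_finsetSum _ fun p _ => (hf p).const_mul _]
  simp only [integral_const_mul, mul_div_assoc', Finset.mul_sum, ← Finset.sum_div,
    ← Finset.sum_sub_distrib, mul_sub]
  rw [Finset.sum_comm]

theorem restoringForce_magnetization {n : ℕ} {S : Finset (Fin n)} (hS : 0 < S.card) (θ : ℝ)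
    (h : Fin n → ℝ) (x : Fin n → Bool) :
    restoringForce ν θ (magnetization S x) = meanFieldDefect θ S h x +
      empiricalDev ν S (fun s => Real.tanh (θ * magnetization S x + s)) h := by
  have hk : (S.card : ℝ) ≠ 0 := by exact_mod_cast hS.ne'
  unfold restoringForce meanFieldDefect empiricalDev
  rw [Finset.sum_sub_distrib, Finset.sum_const, nsmul_eq_mul, sub_div, mul_div_cancel_left₀ _ hk]
  ring

variable [IsProbabilityMeasure ν]

theorem abs_empiricalDev_le {g : ℝ → ℝ} {B : ℝ} (hB : ∀ s, |g s| ≤ B) (h : ι → ℝ) :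
    |empiricalDev ν S g h| ≤ 2 * B := by
  have hB₀ : 0 ≤ B := (abs_nonneg _).trans (hB 0)
  rw [empiricalDev, abs_div, Nat.abs_cast]
  refine div_le_of_le_mul₀ (Nat.cast_nonneg _) (by linarith)
    ((Finset.abs_sum_le_sum_abs _ _).trans ((Finset.sum_le_sum fun i _ => (abs_sub _ _).trans
      (add_le_add (hB (h i)) (abs_integral_le_of_abs_le hB))).trans_eq ?_))
  rw [Finset.sum_const, nsmul_eq_mul]
  ring

theorem abs_empiricalDev_tanh_sub_le (P : ℕ) (h : ι → ℝ) (u : ℝ) :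
    |empiricalDev ν S (fun s => Real.tanh (u + s)) h - empiricalDev ν S Real.tanh h| ≤
      |u| * coeffDev ν S P h + 4 * |u| ^ (P + 1) := by
  have hshift : Integrable (fun s => Real.tanh (u + s)) ν :=
    integrable_of_continuous_of_abs_le (continuous_tanh.comp (by fun_prop))
      fun s => abs_tanh_le_one _
  have htanh : Integrable Real.tanh ν :=
    integrable_of_continuous_of_abs_le continuous_tanh abs_tanh_le_one
  have hcoeff : ∀ p, Integrable (tanhCoeff p) ν := fun p =>
    integrable_of_continuous_of_abs_le (continuous_tanhCoeff p) (abs_tanhCoeff_le p)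
  have hremainder := abs_empiricalDev_le (ν := ν) (S := S) (abs_tanh_add_sub_expansion_le P u) h
  rw [empiricalDev_sub (f := fun s => Real.tanh (u + s) - Real.tanh s) (hshift.sub htanh)
    (integrable_finsetSum _ fun p _ => (hcoeff p).const_mul _), empiricalDev_sub hshift htanh,
    empiricalDev_sum_const_mul _ _ hcoeff] at hremainder
  have hu : |Real.tanh u| ≤ |u| := by simpa using abs_tanh_sub_tanh_le u 0
  have hexpansion : |∑ p ∈ Finset.range P,
      Real.tanh u ^ (p + 1) * empiricalDev ν S (tanhCoeff p) h| ≤ |u| * coeffDev ν S P h := by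
    rw [coeffDev, Finset.mul_sum]
    refine (Finset.abs_sum_le_sum_abs _ _).trans (Finset.sum_le_sum fun p _ => ?_)
    rw [abs_mul, abs_pow]
    exact mul_le_mul_of_nonneg_right ((pow_le_of_le_one (abs_nonneg _) (abs_tanh_le_one u)
      p.succ_ne_zero).trans hu) (abs_nonneg _)
  have hpow : |Real.tanh u| ^ (P + 1) ≤ |u| ^ (P + 1) := pow_le_pow_left₀ (abs_nonneg _) hu _
  linarith [abs_sub_abs_le_abs_sub
    (empiricalDev ν S (fun s => Real.tanh (u + s)) h - empiricalDev ν S Real.tanh h)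
    (∑ p ∈ Finset.range P, Real.tanh u ^ (p + 1) * empiricalDev ν S (tanhCoeff p) h)]

theorem coeffDev_le (P : ℕ) (h : ι → ℝ) : coeffDev ν S P h ≤ 2 * P := by
  refine (Finset.sum_le_sum fun p _ => abs_empiricalDev_le (abs_tanhCoeff_le p) h).trans_eq ?_
  simp [mul_comm]

variable [Fintype ι]

theorem integrable_sq_empiricalDev {g : ℝ → ℝ} (hg : Continuous g) {B : ℝ}
    (hB : ∀ s, |g s| ≤ B) : Integrable (fun h => empiricalDev ν S g h ^ 2) (iidField ι ν) :=
  integrable_of_continuous_of_abs_le ((continuous_empiricalDev hg).pow 2) fun h => by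
    rw [abs_pow]
    exact pow_le_pow_left₀ (abs_nonneg _) (abs_empiricalDev_le hB h) 2

theorem integral_sq_empiricalDev_le {g : ℝ → ℝ} (hg : Continuous g) {B : ℝ}
    (hB : ∀ s, |g s| ≤ B) (hS : 0 < S.card) :
    ∫ h, empiricalDev ν S g h ^ 2 ∂(iidField ι ν) ≤ B ^ 2 / S.card := by
  have hk : (0 : ℝ) < S.card := by exact_mod_cast hS
  simp only [empiricalDev, div_pow]
  rw [integral_div, div_le_div_iff₀ (by positivity) hk]
  nlinarith [integral_sq_centered_sum_field_le (ν := ν) S hg hB]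

theorem integrable_sq_coeffDev (P : ℕ) :
    Integrable (fun h => coeffDev ν S P h ^ 2) (iidField ι ν) :=
  integrable_of_continuous_of_abs_le ((continuous_coeffDev P).pow 2) fun h => by
    rw [abs_pow, abs_of_nonneg (coeffDev_nonneg P h)]
    exact pow_le_pow_left₀ (coeffDev_nonneg P h) (coeffDev_le P h) 2

theorem integral_sq_coeffDev_le (P : ℕ) (hS : 0 < S.card) :
    ∫ h, coeffDev ν S P h ^ 2 ∂(iidField ι ν) ≤ (P : ℝ) ^ 2 / S.card := by
  have hcauchySchwarz : ∀ h : ι → ℝ, coeffDev ν S P h ^ 2 ≤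
      P * ∑ p ∈ Finset.range P, empiricalDev ν S (tanhCoeff p) h ^ 2 := fun h => by
    simpa [coeffDev] using sq_sum_le_card_mul_sum_sq (s := Finset.range P)
      (f := fun p => |empiricalDev ν S (tanhCoeff p) h|)
  have hint : ∀ p, Integrable (fun h => empiricalDev ν S (tanhCoeff p) h ^ 2) (iidField ι ν) :=
    fun p => integrable_sq_empiricalDev (continuous_tanhCoeff p) (abs_tanhCoeff_le p)
  refine (integral_mono (integrable_sq_coeffDev P)
    ((integrable_finsetSum _ fun p _ => hint p).const_mul _) hcauchySchwarz).trans ?_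
  rw [integral_const_mul, integral_finsetSum _ fun p _ => hint p]
  refine (mul_le_mul_of_nonneg_left (Finset.sum_le_sum fun p _ => integral_sq_empiricalDev_le
    (continuous_tanhCoeff p) (abs_tanhCoeff_le p) hS) (Nat.cast_nonneg P)).trans_eq ?_
  rw [Finset.sum_const, Finset.card_range, nsmul_eq_mul]
  ring

end Fluctuations

/-! ### Upper bounds on the moments of the magnetization -/

section UpperBound

variable {n : ℕ} {ν : Measure ℝ} [IsProbabilityMeasure ν] {θ : ℝ} {S : Finset (Fin n)}

theorem abs_restoringForce_magnetization_sub_le (hθ : 0 ≤ θ) (hS : 0 < S.card) (N : ℕ)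
    (h : Fin n → ℝ) (x : Fin n → Bool) :
    |restoringForce ν θ (magnetization S x) -
        (meanFieldDefect θ S h x + empiricalDev ν S Real.tanh h)| ≤
      θ * (|magnetization S x| * coeffDev ν S N h) +
        4 * θ ^ (N + 1) * |magnetization S x| ^ (N + 1) := by
  rw [restoringForce_magnetization hS θ h x, add_sub_add_left_eq_sub]
  refine (abs_empiricalDev_tanh_sub_le N h (θ * magnetization S x)).trans_eq ?_
  rw [abs_mul, abs_of_nonneg hθ]
  ring

/-- Near zero the remainder `4 (θ m) ^ (N + 1)` of the expansion is absorbed by the restoring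
force, so that only the fluctuations remain. -/
theorem sq_magnetization_pow_le (hθ : 0 ≤ θ) (hS : 0 < S.card) {N : ℕ} {c : ℝ} (hc : 0 < c)
    {h : Fin n → ℝ} {x : Fin n → Bool}
    (hforce : c * |magnetization S x| ^ N ≤ |restoringForce ν θ (magnetization S x)|)
    (hsmall : 64 * θ ^ (2 * N + 2) * magnetization S x ^ 2 ≤ c ^ 2 / 2) :
    (magnetization S x ^ 2) ^ N ≤ 8 / c ^ 2 *
      (meanFieldDefect θ S h x ^ 2 + empiricalDev ν S Real.tanh h ^ 2 +
        θ ^ 2 * coeffDev ν S N h ^ 2) := by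
  have hexpand := abs_restoringForce_magnetization_sub_le (ν := ν) hθ hS N h x
  have hm_le := abs_magnetization_le_one S x
  have hW₀ := coeffDev_nonneg (ν := ν) (S := S) N h
  set m := magnetization S x
  set D := meanFieldDefect θ S h x
  set E := empiricalDev ν S Real.tanh h
  set W := coeffDev ν S N h
  have hforce_le : c * |m| ^ N ≤ (|D| + |E|) + (θ * W + 4 * θ ^ (N + 1) * |m| ^ (N + 1)) := by
    have htriangle := abs_sub_abs_le_abs_sub (restoringForce ν θ m) (D + E)
    have hdrop : θ * (|m| * W) ≤ θ * W :=
      mul_le_mul_of_nonneg_left (mul_le_of_le_one_left hW₀ hm_le) hθ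
    linarith [abs_add_le D E]
  have hsq := (pow_le_pow_left₀ (by positivity) hforce_le 2).trans add_sq_le
  have hsq_fst : (|D| + |E|) ^ 2 ≤ 2 * (D ^ 2 + E ^ 2) := by
    simpa only [sq_abs] using add_sq_le (a := |D|) (b := |E|)
  have hsq_snd := add_sq_le (a := θ * W) (b := 4 * θ ^ (N + 1) * |m| ^ (N + 1))
  have hpow : (|m| ^ N) ^ 2 = (m ^ 2) ^ N := by rw [pow_right_comm, sq_abs]
  have habsorb : 4 * (4 * θ ^ (N + 1) * |m| ^ (N + 1)) ^ 2 ≤ c ^ 2 / 2 * (m ^ 2) ^ N := by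
    calc 4 * (4 * θ ^ (N + 1) * |m| ^ (N + 1)) ^ 2
        = 64 * θ ^ (2 * N + 2) * m ^ 2 * (m ^ 2) ^ N := by rw [← hpow, ← sq_abs m]; ring
      _ ≤ c ^ 2 / 2 * (m ^ 2) ^ N := mul_le_mul_of_nonneg_right hsmall (by positivity)
  rw [div_mul_eq_mul_div, le_div_iff₀ (by positivity)]
  rw [mul_pow, hpow] at hsq
  rw [mul_pow θ W] at hsq_snd
  linarith

theorem gibbsMean_sq_magnetization_pow_le (hθ : 0 ≤ θ) (hS : 0 < S.card) {N : ℕ} {c δ : ℝ}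
    (hc : 0 < c) (hforce : ∀ m, |m| ≤ δ → c * |m| ^ N ≤ |restoringForce ν θ m|)
    (hsmall : 64 * θ ^ (2 * N + 2) * δ ^ 2 ≤ c ^ 2 / 2) (h : Fin n → ℝ) :
    gibbsMean θ S h (fun x => (magnetization S x ^ 2) ^ N) ≤
      8 / c ^ 2 * ((8 + 4 * θ + 2 * θ ^ 2) / S.card +
        (empiricalDev ν S Real.tanh h ^ 2 + θ ^ 2 * coeffDev ν S N h ^ 2)) +
      gibbsMean θ S h (fun x => if δ < |magnetization S x| then 1 else 0) := by
  have hpoint : ∀ x, (magnetization S x ^ 2) ^ N ≤ 8 / c ^ 2 * (meanFieldDefect θ S h x ^ 2 +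
      (empiricalDev ν S Real.tanh h ^ 2 + θ ^ 2 * coeffDev ν S N h ^ 2)) +
        (if δ < |magnetization S x| then 1 else 0) := by
    intro x
    split_ifs with hx
    · have hm_le : (magnetization S x ^ 2) ^ N ≤ 1 :=
        pow_le_one₀ (sq_nonneg _) ((sq_le_one_iff_abs_le_one _).2 (abs_magnetization_le_one S x))
      exact hm_le.trans (le_add_of_nonneg_left (by positivity))
    · have hm := not_lt.1 hx
      rw [add_zero, ← add_assoc]
      refine sq_magnetization_pow_le hθ hS hc (hforce _ hm) (le_trans ?_ hsmall)
      exact mul_le_mul_of_nonneg_left (sq_le_sq' (abs_le.1 hm).1 (abs_le.1 hm).2) (by positivity)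
  refine (gibbsMean_mono hpoint).trans ?_
  rw [gibbsMean_add, gibbsMean_const_mul, gibbsMean_add, gibbsMean_const]
  gcongr
  exact gibbsMean_sq_meanFieldDefect_le hθ hS

theorem integral_sq_magnetization_pow_le (hθ : 0 ≤ θ) (hS : 0 < S.card) {N : ℕ} {c δ : ℝ}
    (hc : 0 < c) (hforce : ∀ m, |m| ≤ δ → c * |m| ^ N ≤ |restoringForce ν θ m|)
    (hsmall : 64 * θ ^ (2 * N + 2) * δ ^ 2 ≤ c ^ 2 / 2) :
    ∫ x, (magnetization S x ^ 2) ^ N ∂(plantedLaw ν θ S) ≤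
      8 / c ^ 2 * ((8 + 4 * θ + 2 * θ ^ 2) / S.card +
        (1 / S.card + θ ^ 2 * ((N : ℝ) ^ 2 / S.card))) +
      ∫ x, (if δ < |magnetization S x| then (1 : ℝ) else 0) ∂(plantedLaw ν θ S) := by
  have hint_dev := integrable_sq_empiricalDev (ν := ν) (S := S) continuous_tanh abs_tanh_le_one
  have hint_coeff := (integrable_sq_coeffDev (ν := ν) (S := S) N).const_mul (θ ^ 2)
  have hint_const := integrable_const (μ := iidField (Fin n) ν) ((8 + 4 * θ + 2 * θ ^ 2) / S.card)
  have hint_noise := (hint_const.add (hint_dev.add hint_coeff)).const_mul (8 / c ^ 2)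
  have hint_large := integrable_gibbsMean ν θ S fun x => if δ < |magnetization S x| then 1 else 0
  rw [integral_plantedLaw, integral_plantedLaw]
  refine (integral_mono (integrable_gibbsMean ν θ S _) (hint_noise.add hint_large)
    (gibbsMean_sq_magnetization_pow_le hθ hS hc hforce hsmall)).trans ?_
  refine (integral_add hint_noise hint_large).trans_le (add_le_add_left ?_ _)
  rw [integral_const_mul]
  refine mul_le_mul_of_nonneg_left ?_ (by positivity)
  refine (integral_add hint_const (hint_dev.add hint_coeff)).trans_le ?_
  refine add_le_add (by simp) ((integral_add hint_dev hint_coeff).trans_le ?_)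
  rw [integral_const_mul]
  gcongr
  · simpa using integral_sq_empiricalDev_le continuous_tanh abs_tanh_le_one hS
  · exact integral_sq_coeffDev_le N hS

theorem exists_integral_sq_magnetization_pow_le (hint : Integrable (fun h : ℝ => h) ν)
    (hθ : 0 < θ) (hmin : ZeroIsUniqueMinimum ν θ) {τ : ℕ} (hτ : HasFlatness ν θ τ) :
    ∃ C > 0, ∀ᶠ k : ℕ in atTop, ∀ (n : ℕ) (S : Finset (Fin n)), S.card = k →
      ∫ x, (magnetization S x ^ 2) ^ (2 * τ - 1) ∂(plantedLaw ν θ S) ≤ C / k := by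
  obtain ⟨c, hc, δ₀, hδ₀, hforce⟩ := exists_le_abs_restoringForce hτ
  set N := 2 * τ - 1
  have hcontinuous : Continuous fun δ : ℝ => 64 * θ ^ (2 * N + 2) * δ ^ 2 := by fun_prop
  have hsmall : ∀ᶠ δ in 𝓝[>] 0, 64 * θ ^ (2 * N + 2) * δ ^ 2 < c ^ 2 / 2 :=
    ((hcontinuous.tendsto' 0 0 (by simp)).eventually
      (gt_mem_nhds (by positivity))).filter_mono nhdsWithin_le_nhds
  obtain ⟨δ, hδ_small, hδ, hδδ₀⟩ := (hsmall.and (Ioc_mem_nhdsGT hδ₀)).exists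
  refine ⟨8 / c ^ 2 * ((8 + 4 * θ + 2 * θ ^ 2) + (1 + θ ^ 2 * (N : ℝ) ^ 2)) + 1,
    by positivity, ?_⟩
  filter_upwards [eventually_integral_large_magnetization_le hint hθ hmin hδ,
    eventually_gt_atTop 0] with k htail hk n S hS
  have hmoment := integral_sq_magnetization_pow_le (S := S) hθ.le (hS ▸ hk) hc
    (fun m hm => hforce m (hm.trans hδδ₀)) hδ_small.le
  refine (hmoment.trans (add_le_add_right (htail n S hS) _)).trans_eq ?_
  rw [hS]
  ring

/-- The order of magnitude of the correlations inside a clique of size `k` when the restoring force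
vanishes to order `N` at zero. -/
def corrScale (N k : ℕ) : ℝ := (k : ℝ) ^ (-(1 / N : ℝ))

theorem corrScale_nonneg (N k : ℕ) : 0 ≤ corrScale N k := Real.rpow_nonneg (Nat.cast_nonneg k) _

theorem corrScale_pos (N : ℕ) {k : ℕ} (hk : 0 < k) : 0 < corrScale N k :=
  Real.rpow_pos_of_pos (Nat.cast_pos.2 hk) _

theorem corrScale_pow {N : ℕ} (hN : N ≠ 0) (k : ℕ) : corrScale N k ^ N = (k : ℝ)⁻¹ := by
  rw [corrScale, Real.rpow_neg (Nat.cast_nonneg k), inv_pow, one_div,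
    Real.rpow_inv_natCast_pow (Nat.cast_nonneg k) hN]

theorem tendsto_corrScale {N : ℕ} (hN : N ≠ 0) : Tendsto (corrScale N) atTop (𝓝 0) :=
  (tendsto_rpow_neg_atTop (by positivity)).comp tendsto_natCast_atTop_atTop

theorem integral_sq_magnetization_le {N : ℕ} (hN : N ≠ 0) {C : ℝ} (hC : 0 ≤ C)
    (hmoment : ∫ x, (magnetization S x ^ 2) ^ N ∂(plantedLaw ν θ S) ≤ C / S.card) :
    ∫ x, magnetization S x ^ 2 ∂(plantedLaw ν θ S) ≤ (1 + C) * corrScale N S.card := by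
  have hl := corrScale_nonneg N S.card
  refine le_of_pow_le_pow_left₀ hN (by positivity) ?_
  calc (∫ x, magnetization S x ^ 2 ∂(plantedLaw ν θ S)) ^ N
      ≤ ∫ x, (magnetization S x ^ 2) ^ N ∂(plantedLaw ν θ S) :=
        (convexOn_pow N).map_integral_le (continuousOn_pow N) isClosed_Ici
          (ae_of_all _ fun x => Set.mem_Ici.2 (sq_nonneg _))
          Integrable.of_finite Integrable.of_finite
    _ ≤ C * corrScale N S.card ^ N := by rwa [corrScale_pow hN, ← div_eq_mul_inv]
    _ ≤ ((1 + C) * corrScale N S.card) ^ N := by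
        rw [mul_pow]
        refine mul_le_mul_of_nonneg_right ?_ (by positivity)
        exact (le_add_of_nonneg_left zero_le_one).trans (le_self_pow₀ (by linarith) hN)

end UpperBound

/-! ### The fluctuation of the random field -/

theorem pow_four_le_exp_add_exp_neg (x : ℝ) : x ^ 4 ≤ 24 * (Real.exp x + Real.exp (-x)) := by
  have htaylor := Real.pow_div_factorial_le_exp |x| (abs_nonneg x) 4
  rw [Even.pow_abs (by decide), div_le_iff₀ (by positivity), mul_comm] at htaylor
  exact htaylor.trans (mul_le_mul_of_nonneg_left (Real.exp_abs_le x) (by positivity))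

/-- Integrates the pointwise inequality `K² y² - y⁴ ≤ K³ |y|`, which is an interpolation between
the first and the fourth moment. -/
theorem sub_integral_pow_four_le {α : Type*} [MeasurableSpace α] {P : Measure α} {X : α → ℝ}
    (hX : Integrable X P) (hX₂ : Integrable (fun a => X a ^ 2) P)
    (hX₄ : Integrable (fun a => X a ^ 4) P) {K : ℝ} (hK : 0 ≤ K) :
    K ^ 2 * ∫ a, X a ^ 2 ∂P - ∫ a, X a ^ 4 ∂P ≤ K ^ 3 * ∫ a, |X a| ∂P := by
  have hpoint : ∀ y : ℝ, K ^ 2 * y ^ 2 - y ^ 4 ≤ K ^ 3 * |y| := by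
    intro y
    have hfactor : K ^ 3 * |y| - (K ^ 2 * |y| ^ 2 - |y| ^ 4) =
        |y| * ((K - |y|) ^ 2 * (K + |y|) + K * |y| ^ 2) := by ring
    rw [← sq_abs y, ← Even.pow_abs (n := 4) (by decide) y, ← sub_nonneg, hfactor]
    positivity
  rw [← integral_const_mul, ← integral_const_mul, ← integral_sub (hX₂.const_mul _) hX₄]
  exact integral_mono ((hX₂.const_mul _).sub hX₄) (hX.abs.const_mul _) fun a => hpoint (X a)

section FieldFluctuation

variable {ι : Type*} [Fintype ι] {ν : Measure ℝ} [IsProbabilityMeasure ν] {g : ℝ → ℝ}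

theorem integral_exp_mul_sum_field_le (S : Finset ι) (hg : Continuous g) (hB : ∀ s, |g s| ≤ 1)
    (hg₀ : ∫ s, g s ∂ν = 0) {l : ℝ} (hl : 0 ≤ l) (hl_le : l ≤ 1) :
    ∫ h, Real.exp (l * ∑ i ∈ S, g (h i)) ∂(iidField ι ν) ≤ Real.exp (l ^ 2 * S.card) := by
  simp only [Finset.mul_sum, Real.exp_sum]
  rw [integral_prod_field S fun s => Real.exp (l * g s), mul_comm, Real.exp_nat_mul]
  refine pow_le_pow_left₀ (integral_nonneg fun s => (Real.exp_pos _).le) ?_ _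
  have hvar : ∫ s, g s ^ 2 ∂ν ≤ 1 := (le_abs_self _).trans
    (abs_integral_le_of_abs_le fun s => by
      rw [abs_pow]
      exact pow_le_one₀ (abs_nonneg _) (hB s))
  calc ∫ s, Real.exp (l * g s) ∂ν
      ≤ 1 + l * ∫ s, g s ∂ν + l ^ 2 * ∫ s, g s ^ 2 ∂ν :=
        integral_exp_mul_le hg.measurable hB hl (by rwa [mul_one])
    _ ≤ l ^ 2 + 1 := by
        rw [hg₀, mul_zero, add_zero, add_comm]
        exact add_le_add_left (mul_le_of_le_one_right (sq_nonneg l) hvar) 1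
    _ ≤ Real.exp (l ^ 2) := Real.add_one_le_exp _

theorem integrable_comp_sum_field (S : Finset ι) (hg : Continuous g) (hB : ∀ s, |g s| ≤ 1)
    {f : ℝ → ℝ} (hf : Continuous f) :
    Integrable (fun h => f (∑ i ∈ S, g (h i))) (iidField ι ν) := by
  obtain ⟨B, hfB⟩ := (isCompact_Icc (a := -(S.card : ℝ)) (b := S.card)).exists_bound_of_continuousOn
    hf.continuousOn
  refine integrable_of_continuous_of_abs_le (by fun_prop) fun h => hfB _ (abs_le.1 ?_)
  exact (Finset.abs_sum_le_sum_abs _ _).trans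
    ((Finset.sum_le_sum fun i _ => hB (h i)).trans_eq (by simp))

theorem pow_four_mul_integral_sum_field_le (S : Finset ι) (hg : Continuous g)
    (hB : ∀ s, |g s| ≤ 1) (hg₀ : ∫ s, g s ∂ν = 0) {l : ℝ} (hl : 0 ≤ l) (hl_le : l ≤ 1) :
    l ^ 4 * ∫ h, (∑ i ∈ S, g (h i)) ^ 4 ∂(iidField ι ν) ≤ 48 * Real.exp (l ^ 2 * S.card) := by
  have hexp := integral_exp_mul_sum_field_le S hg hB hg₀ hl hl_le
  have hexp_neg := integral_exp_mul_sum_field_le (ν := ν) S hg.neg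
    (fun s => (abs_neg _).trans_le (hB s)) ((integral_neg _).trans (by rw [hg₀, neg_zero]))
    hl hl_le
  simp only [Pi.neg_apply, Finset.sum_neg_distrib, mul_neg] at hexp_neg
  have hint_exp := integrable_comp_sum_field (ν := ν) S hg hB (f := fun x => Real.exp (l * x))
    (by fun_prop)
  have hint_exp_neg := integrable_comp_sum_field (ν := ν) S hg hB
    (f := fun x => Real.exp (-(l * x))) (by fun_prop)
  have hmoment := integral_mono
    (integrable_comp_sum_field (ν := ν) S hg hB (f := fun x => (l * x) ^ 4) (by fun_prop))
    ((hint_exp.add hint_exp_neg).const_mul 24) fun h => pow_four_le_exp_add_exp_neg _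
  simp only [Pi.add_apply, mul_pow] at hmoment
  rw [integral_const_mul, integral_const_mul, integral_add hint_exp hint_exp_neg] at hmoment
  linarith

theorem integral_pow_four_sum_field_le (S : Finset ι) (hg : Continuous g) (hB : ∀ s, |g s| ≤ 1)
    (hg₀ : ∫ s, g s ∂ν = 0) :
    ∫ h, (∑ i ∈ S, g (h i)) ^ 4 ∂(iidField ι ν) ≤ 48 * Real.exp 1 * (S.card : ℝ) ^ 2 := by
  rcases S.eq_empty_or_nonempty with rfl | hS
  · simp
  have hk : (1 : ℝ) ≤ S.card := by exact_mod_cast hS.card_pos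
  set l := 1 / √(S.card : ℝ) with hl
  have hl_sq : l ^ 2 * S.card = 1 := by
    rw [hl, div_pow, Real.sq_sqrt (by linarith)]
    field_simp
  have hl_le : l ≤ 1 := div_le_one_of_le₀ (Real.one_le_sqrt.2 hk) (Real.sqrt_nonneg _)
  have hfourth := pow_four_mul_integral_sum_field_le S hg hB hg₀ (by positivity) hl_le
  rw [hl_sq] at hfourth
  calc ∫ h, (∑ i ∈ S, g (h i)) ^ 4 ∂(iidField ι ν)
      = (l ^ 4 * ∫ h, (∑ i ∈ S, g (h i)) ^ 4 ∂(iidField ι ν)) * (S.card : ℝ) ^ 2 := by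
        linear_combination (-(l ^ 2 * S.card) - 1) *
          (∫ h, (∑ i ∈ S, g (h i)) ^ 4 ∂(iidField ι ν)) * hl_sq
    _ ≤ 48 * Real.exp 1 * (S.card : ℝ) ^ 2 := mul_le_mul_of_nonneg_right hfourth (by positivity)

theorem exists_le_integral_abs_sum_field (hg : Continuous g) (hB : ∀ s, |g s| ≤ 1)
    (hg₀ : ∫ s, g s ∂ν = 0) (hvar : 0 < ∫ s, g s ^ 2 ∂ν) :
    ∃ c > 0, ∀ (n : ℕ) (S : Finset (Fin n)),
      c * √S.card ≤ ∫ h, |∑ i ∈ S, g (h i)| ∂(iidField (Fin n) ν) := by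
  set v := ∫ s, g s ^ 2 ∂ν
  set K := √(96 * Real.exp 1 / v)
  have : 0 < K := by positivity
  have hK_sq : K ^ 2 * v = 96 * Real.exp 1 := by
    rw [Real.sq_sqrt (by positivity)]
    field_simp
  refine ⟨48 * Real.exp 1 / K ^ 3, by positivity, fun n S => ?_⟩
  rcases S.eq_empty_or_nonempty with rfl | hS
  · simp
  have hk : (0 : ℝ) < S.card := by exact_mod_cast hS.card_pos
  set w := √(S.card : ℝ)
  have hw : 0 < w := by positivity
  have hw_sq : w ^ 2 = S.card := Real.sq_sqrt hk.le
  have hmoments := sub_integral_pow_four_le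
    (integrable_comp_sum_field (ν := ν) S hg hB continuous_id)
    (integrable_comp_sum_field (ν := ν) S hg hB (f := fun x => x ^ 2) (by fun_prop))
    (integrable_comp_sum_field (ν := ν) S hg hB (f := fun x => x ^ 4) (by fun_prop))
    (K := K * w) (by positivity)
  have hfourth := integral_pow_four_sum_field_le (ν := ν) S hg hB hg₀
  simp only [id_eq] at hmoments
  rw [integral_sq_sum_field S hg hB hg₀, ← hw_sq] at hmoments
  rw [← hw_sq] at hfourth
  rw [div_mul_eq_mul_div, div_le_iff₀ (by positivity)]
  refine le_of_mul_le_mul_left ?_ (pow_pos hw 3)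
  calc w ^ 3 * (48 * Real.exp 1 * w)
      = (K * w) ^ 2 * (w ^ 2 * v) - 48 * Real.exp 1 * (w ^ 2) ^ 2 := by
        linear_combination -(w ^ 4) * hK_sq
    _ ≤ (K * w) ^ 3 * ∫ h, |∑ i ∈ S, g (h i)| ∂(iidField (Fin n) ν) := by linarith
    _ = w ^ 3 * ((∫ h, |∑ i ∈ S, g (h i)| ∂(iidField (Fin n) ν)) * K ^ 3) := by ring

theorem integral_tanh_sq_pos (hν : ν ≠ Measure.dirac 0) : 0 < ∫ s, Real.tanh s ^ 2 ∂ν := by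
  refine lt_of_le_of_ne (integral_nonneg fun s => sq_nonneg _) fun hzero => hν ?_
  have hint : Integrable (fun s => Real.tanh s ^ 2) ν :=
    integrable_of_continuous_of_abs_le (continuous_tanh.pow 2) fun s => by
      rw [abs_pow]
      exact pow_le_one₀ (abs_nonneg _) (abs_tanh_le_one s)
  have hsq_ae := (integral_eq_zero_iff_of_nonneg (fun s => sq_nonneg _) hint).1 hzero.symm
  have hfield_ae : (fun s : ℝ => s) =ᵐ[ν] fun _ => 0 := by
    filter_upwards [hsq_ae] with s hs
    have htanh : Real.tanh s = 0 := by simpa using hs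
    rw [Real.tanh_eq_sinh_div_cosh, div_eq_zero_iff] at htanh
    exact Real.sinh_eq_zero.1 (htanh.resolve_right (Real.cosh_pos s).ne')
  calc ν = ν.map fun s => s := Measure.map_id'.symm
    _ = ν.map fun _ => (0 : ℝ) := Measure.map_congr hfield_ae
    _ = Measure.dirac 0 := by rw [Measure.map_const, measure_univ, one_smul]

theorem exists_le_integral_abs_empiricalDev_tanh [ν.IsNegInvariant] (hν : ν ≠ Measure.dirac 0) :
    ∃ c > 0, ∀ (n : ℕ) (S : Finset (Fin n)),
      c / √S.card ≤ ∫ h, |empiricalDev ν S Real.tanh h| ∂(iidField (Fin n) ν) := by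
  have hmean := integral_tanh_eq_zero ν
  obtain ⟨c, hc, hdev⟩ := exists_le_integral_abs_sum_field continuous_tanh abs_tanh_le_one hmean
    (integral_tanh_sq_pos hν)
  refine ⟨c, hc, fun n S => ?_⟩
  simp only [empiricalDev, hmean, sub_zero, abs_div, Nat.abs_cast]
  rw [integral_div, div_eq_mul_one_div, ← Real.sqrt_div_self', ← mul_div_assoc]
  gcongr
  exact hdev n S

end FieldFluctuation

/-! ### The lower bound at critical temperature -/

section LowerBound

variable {n : ℕ} {ν : Measure ℝ} [IsProbabilityMeasure ν] {θ : ℝ} {S : Finset (Fin n)}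

/-- The mean-field equation forces the magnetization to follow the fluctuation of the field. -/
theorem abs_empiricalDev_tanh_le (hθ : 0 ≤ θ) (hS : 0 < S.card) (N : ℕ) (h : Fin n → ℝ) :
    |empiricalDev ν S Real.tanh h| ≤ gibbsMean θ S h (fun x =>
      |restoringForce ν θ (magnetization S x)| + (θ * (|magnetization S x| * coeffDev ν S N h) +
        4 * θ ^ (N + 1) * |magnetization S x| ^ (N + 1))) + θ / S.card := by
  set E := empiricalDev ν S Real.tanh h
  have hdefect := abs_gibbsMean_meanFieldDefect_le (h := h) hθ hS
  have htriangle : |E| ≤ |gibbsMean θ S h (fun x => meanFieldDefect θ S h x + E)| +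
      |gibbsMean θ S h (meanFieldDefect θ S h)| := by
    rw [gibbsMean_add, gibbsMean_const]
    simpa using abs_sub (gibbsMean θ S h (meanFieldDefect θ S h) + E)
      (gibbsMean θ S h (meanFieldDefect θ S h))
  refine htriangle.trans (add_le_add ?_ hdefect)
  refine (abs_gibbsMean_le_gibbsMean_abs _).trans (gibbsMean_mono fun x => ?_)
  have hexpand := abs_restoringForce_magnetization_sub_le (ν := ν) hθ hS N h x
  rw [abs_sub_comm] at hexpand
  linarith [abs_sub_abs_le_abs_sub (meanFieldDefect θ S h x + E)
    (restoringForce ν θ (magnetization S x))]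

theorem mul_le_sq_div_add_mul_sq {η : ℝ} (hη : 0 < η) (a b : ℝ) :
    a * b ≤ a ^ 2 / (2 * η) + η / 2 * b ^ 2 := by
  have hsq : a ^ 2 / (2 * η) + η / 2 * b ^ 2 - a * b = (a - η * b) ^ 2 / (2 * η) := by
    field_simp
    ring
  rw [← sub_nonneg, hsq]
  positivity

theorem abs_empiricalDev_tanh_le_gibbsMean_moments (hθ : 0 ≤ θ) (hS : 0 < S.card) {N : ℕ}
    {C η : ℝ} (hη : 0 < η) (hforce : ∀ m, |m| ≤ 1 → |restoringForce ν θ m| ≤ C * |m| ^ N)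
    (h : Fin n → ℝ) :
    |empiricalDev ν S Real.tanh h| ≤
      gibbsMean θ S h (fun x => C * |magnetization S x| ^ N +
        (θ + 4 * θ ^ (N + 1)) / (2 * η) * magnetization S x ^ 2 +
        2 * θ ^ (N + 1) * η * (magnetization S x ^ 2) ^ N) +
      (θ * η / 2 * coeffDev ν S N h ^ 2 + θ / S.card) := by
  refine (abs_empiricalDev_tanh_le hθ hS N h).trans ?_
  rw [← add_assoc, ← gibbsMean_const (θ := θ) (S := S) (h := h) (θ * η / 2 * _), ← gibbsMean_add]
  refine add_le_add_left (gibbsMean_mono fun x => ?_) _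
  set m := magnetization S x
  have hfluct := mul_le_mul_of_nonneg_left
    (mul_le_sq_div_add_mul_sq hη |m| (coeffDev ν S N h)) hθ
  have hremainder := mul_le_mul_of_nonneg_left
    (mul_le_sq_div_add_mul_sq hη |m| (|m| ^ N)) (by positivity : 0 ≤ 4 * θ ^ (N + 1))
  rw [← pow_succ', pow_right_comm] at hremainder
  rw [sq_abs] at hfluct hremainder
  refine (add_le_add (hforce m (abs_magnetization_le_one S x))
    (add_le_add hfluct hremainder)).trans_eq ?_
  ring

theorem integral_abs_empiricalDev_tanh_le (hθ : 0 ≤ θ) (hS : 0 < S.card) {N : ℕ} {C η : ℝ}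
    (hη : 0 < η) (hforce : ∀ m, |m| ≤ 1 → |restoringForce ν θ m| ≤ C * |m| ^ N) :
    ∫ h, |empiricalDev ν S Real.tanh h| ∂(iidField (Fin n) ν) ≤
      (C * ∫ x, |magnetization S x| ^ N ∂(plantedLaw ν θ S) +
        (θ + 4 * θ ^ (N + 1)) / (2 * η) * ∫ x, magnetization S x ^ 2 ∂(plantedLaw ν θ S) +
        2 * θ ^ (N + 1) * η * ∫ x, (magnetization S x ^ 2) ^ N ∂(plantedLaw ν θ S)) +
      (θ * η / 2 * ((N : ℝ) ^ 2 / S.card) + θ / S.card) := by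
  have hint_dev : Integrable (fun h => |empiricalDev ν S Real.tanh h|) (iidField (Fin n) ν) :=
    integrable_of_continuous_of_abs_le (continuous_empiricalDev continuous_tanh).abs fun h =>
      (abs_abs _).trans_le (abs_empiricalDev_le abs_tanh_le_one h)
  have hint_coeff :=
    (integrable_sq_coeffDev (ι := Fin n) (ν := ν) (S := S) N).const_mul (θ * η / 2)
  have hint_rest := hint_coeff.add (integrable_const (θ / S.card))
  have hint_gibbs := integrable_gibbsMean ν θ S fun x => C * |magnetization S x| ^ N +
    (θ + 4 * θ ^ (N + 1)) / (2 * η) * magnetization S x ^ 2 +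
      2 * θ ^ (N + 1) * η * (magnetization S x ^ 2) ^ N
  refine (integral_mono hint_dev (hint_gibbs.add hint_rest)
    (abs_empiricalDev_tanh_le_gibbsMean_moments hθ hS hη hforce)).trans ?_
  refine (integral_add hint_gibbs hint_rest).trans_le (add_le_add (le_of_eq ?_) ?_)
  · rw [← integral_plantedLaw, integral_add Integrable.of_finite Integrable.of_finite,
      integral_add Integrable.of_finite Integrable.of_finite, integral_const_mul,
      integral_const_mul, integral_const_mul]
  · refine (integral_add hint_coeff (integrable_const _)).trans_le ?_
    rw [integral_const_mul]
    gcongr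
    · exact integral_sq_coeffDev_le N hS
    · simp

theorem pow_le_sq_add_sq_pow {N : ℕ} (hN : 2 ≤ N) {y L : ℝ} (hy : 0 ≤ y) (hL : 0 < L) :
    y ^ N ≤ L ^ (N - 2) * y ^ 2 + (y ^ 2) ^ N / L ^ N := by
  rcases le_total y L with hyL | hLy
  · calc y ^ N = y ^ (N - 2) * y ^ 2 := (pow_sub_mul_pow y hN).symm
      _ ≤ L ^ (N - 2) * y ^ 2 := by gcongr
      _ ≤ L ^ (N - 2) * y ^ 2 + (y ^ 2) ^ N / L ^ N := le_add_of_nonneg_right (by positivity)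
  · calc y ^ N ≤ (y ^ 2) ^ N / L ^ N := by
          rw [le_div_iff₀ (by positivity), sq, mul_pow]
          gcongr
      _ ≤ L ^ (N - 2) * y ^ 2 + (y ^ 2) ^ N / L ^ N := le_add_of_nonneg_left (by positivity)

theorem integral_abs_magnetization_pow_le {N : ℕ} (hN : 2 ≤ N) {L : ℝ} (hL : 0 < L) :
    ∫ x, |magnetization S x| ^ N ∂(plantedLaw ν θ S) ≤
      L ^ (N - 2) * ∫ x, magnetization S x ^ 2 ∂(plantedLaw ν θ S) +
        (∫ x, (magnetization S x ^ 2) ^ N ∂(plantedLaw ν θ S)) / L ^ N := by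
  rw [← integral_const_mul, ← integral_div,
    ← integral_add Integrable.of_finite Integrable.of_finite]
  refine integral_mono Integrable.of_finite Integrable.of_finite fun x => ?_
  simpa only [sq_abs] using pow_le_sq_add_sq_pow hN (abs_nonneg (magnetization S x)) hL

theorem sqrt_corrScale_pow_mul_sqrt {N k : ℕ} (hN : N ≠ 0) (hk : 0 < k) :
    √(corrScale N k) ^ N * √k = 1 := by
  have hk' : (0 : ℝ) < k := by exact_mod_cast hk
  have hsq : (√(corrScale N k) ^ N * √k) ^ 2 = 1 := by
    rw [mul_pow, pow_right_comm, Real.sq_sqrt (corrScale_nonneg N k), Real.sq_sqrt hk'.le,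
      corrScale_pow hN, inv_mul_cancel₀ hk'.ne']
  exact (pow_eq_one_iff_of_nonneg (by positivity) two_ne_zero).1 hsq

theorem sqrt_mul_integral_abs_empiricalDev_tanh_le (hθ : 0 ≤ θ) (hS : 0 < S.card) {N : ℕ}
    (hN : N ≠ 0) {C C' : ℝ} (hC : 0 ≤ C)
    (hforce : ∀ m, |m| ≤ 1 → |restoringForce ν θ m| ≤ C' * |m| ^ N)
    (hmoment : ∫ x, (magnetization S x ^ 2) ^ N ∂(plantedLaw ν θ S) ≤ C / S.card) :
    √S.card * ∫ h, |empiricalDev ν S Real.tanh h| ∂(iidField (Fin n) ν) ≤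
      C' * (√S.card * ∫ x, |magnetization S x| ^ N ∂(plantedLaw ν θ S)) + (θ / √S.card +
        ((θ + 4 * θ ^ (N + 1)) / 2 * (1 + C) + 2 * θ ^ (N + 1) * C + θ / 2 * (N : ℝ) ^ 2) *
          √(corrScale N S.card)) := by
  have hsecond := integral_sq_magnetization_le hN hC hmoment
  rw [← Real.sq_sqrt (corrScale_nonneg N S.card)] at hsecond
  rw [← Real.sq_sqrt (Nat.cast_nonneg S.card)] at hmoment
  set w := √(S.card : ℝ)
  set s := √(corrScale N S.card)
  have hw : 0 < w := Real.sqrt_pos.2 (by exact_mod_cast hS)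
  have hs : 0 < s := Real.sqrt_pos.2 (corrScale_pos N hS)
  -- The scale `s * w` balances the two error terms carrying the second and the `2 N`-th moment.
  have hbound := integral_abs_empiricalDev_tanh_le hθ hS (mul_pos hs hw) hforce
  rw [← Real.sq_sqrt (Nat.cast_nonneg S.card)] at hbound
  calc w * ∫ h, |empiricalDev ν S Real.tanh h| ∂(iidField (Fin n) ν)
      ≤ w * ((C' * ∫ x, |magnetization S x| ^ N ∂(plantedLaw ν θ S) +
          (θ + 4 * θ ^ (N + 1)) / (2 * (s * w)) * ((1 + C) * s ^ 2) +
          2 * θ ^ (N + 1) * (s * w) * (C / w ^ 2)) +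
        (θ * (s * w) / 2 * ((N : ℝ) ^ 2 / w ^ 2) + θ / w ^ 2)) := by
        refine mul_le_mul_of_nonneg_left (hbound.trans ?_) hw.le
        gcongr
    _ = _ := by
        field_simp
        ring

theorem sqrt_mul_integral_abs_magnetization_pow_le (hS : 0 < S.card) {N : ℕ} (hN : 2 ≤ N)
    {C L : ℝ} (hL : 0 < L)
    (hmoment : ∫ x, (magnetization S x ^ 2) ^ N ∂(plantedLaw ν θ S) ≤ C / S.card) :
    √S.card * ∫ x, |magnetization S x| ^ N ∂(plantedLaw ν θ S) ≤
      L ^ (N - 2) * ((∫ x, magnetization S x ^ 2 ∂(plantedLaw ν θ S)) / corrScale N S.card) +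
        C / L ^ N := by
  have hscale := sqrt_corrScale_pow_mul_sqrt (by lia : N ≠ 0) hS
  have hlower := pow_sub_mul_pow √(corrScale N S.card) hN
  rw [← Real.sq_sqrt (corrScale_nonneg N S.card)]
  rw [← Real.sq_sqrt (Nat.cast_nonneg S.card)] at hmoment
  set w := √(S.card : ℝ)
  set s := √(corrScale N S.card)
  have hw : 0 < w := Real.sqrt_pos.2 (by exact_mod_cast hS)
  have hs : 0 < s := Real.sqrt_pos.2 (corrScale_pos N hS)
  set m₂ := ∫ x, magnetization S x ^ 2 ∂(plantedLaw ν θ S)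
  have hlow : w * s ^ (N - 2) = 1 / s ^ 2 := by
    rw [eq_div_iff (by positivity), mul_assoc, hlower, mul_comm, hscale]
  have hhigh : w / s ^ N = w ^ 2 := by
    rw [div_eq_iff (by positivity), sq, mul_assoc, mul_comm w (s ^ N), hscale, mul_one]
  calc w * ∫ x, |magnetization S x| ^ N ∂(plantedLaw ν θ S)
      ≤ w * ((L * s) ^ (N - 2) * m₂ + C / w ^ 2 / (L * s) ^ N) := by
        refine mul_le_mul_of_nonneg_left
          ((integral_abs_magnetization_pow_le hN (mul_pos hL hs)).trans ?_) hw.le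
        gcongr
    _ = L ^ (N - 2) * (w * s ^ (N - 2) * m₂) + C / w ^ 2 * (w / s ^ N) / L ^ N := by
        rw [mul_pow, mul_pow]
        field_simp
    _ = L ^ (N - 2) * (m₂ / s ^ 2) + C / L ^ N := by
        rw [hlow, hhigh, one_div_mul_eq_div, div_mul_cancel₀ C (by positivity)]

theorem tendsto_div_sqrt_add_mul_sqrt_corrScale {N : ℕ} (hN : N ≠ 0) (a b : ℝ) :
    Tendsto (fun k : ℕ => a / √k + b * √(corrScale N k)) atTop (𝓝 0) := by
  have hsqrt : Tendsto (fun k : ℕ => a / √k) atTop (𝓝 0) :=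
    tendsto_const_nhds.div_atTop (Real.tendsto_sqrt_atTop.comp tendsto_natCast_atTop_atTop)
  simpa using hsqrt.add ((tendsto_corrScale hN).sqrt.const_mul b)

/-- The fluctuation of the field, of order `1 / √k`, has to be balanced by the restoring force. -/
theorem exists_le_sqrt_mul_integral_abs_magnetization_pow [ν.IsNegInvariant] (hθ : 0 ≤ θ)
    (hν : ν ≠ Measure.dirac 0) {N : ℕ} (hN : N ≠ 0) {C C' : ℝ} (hC : 0 ≤ C) (hC' : 0 < C')
    (hforce : ∀ m, |m| ≤ 1 → |restoringForce ν θ m| ≤ C' * |m| ^ N)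
    (hmoment : ∀ᶠ k : ℕ in atTop, ∀ (n : ℕ) (S : Finset (Fin n)), S.card = k →
      ∫ x, (magnetization S x ^ 2) ^ N ∂(plantedLaw ν θ S) ≤ C / k) :
    ∃ c > 0, ∀ᶠ k : ℕ in atTop, ∀ (n : ℕ) (S : Finset (Fin n)), S.card = k →
      c ≤ √k * ∫ x, |magnetization S x| ^ N ∂(plantedLaw ν θ S) := by
  obtain ⟨c, hc, hdev⟩ := exists_le_integral_abs_empiricalDev_tanh hν
  refine ⟨c / (2 * C'), by positivity, ?_⟩
  filter_upwards [hmoment, eventually_gt_atTop 0,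
    (tendsto_div_sqrt_add_mul_sqrt_corrScale hN θ ((θ + 4 * θ ^ (N + 1)) / 2 * (1 + C) +
      2 * θ ^ (N + 1) * C + θ / 2 * (N : ℝ) ^ 2)).eventually_lt_const (half_pos hc)]
    with k hmoment hk hsmall n S rfl
  have hfluct := hdev n S
  rw [div_le_iff₀' (by positivity)] at hfluct
  have hbalance := sqrt_mul_integral_abs_empiricalDev_tanh_le hθ hk hN hC hforce (hmoment n S rfl)
  rw [div_le_iff₀ (by positivity)]
  linarith

theorem exists_le_integral_sq_magnetization [ν.IsNegInvariant]
    (hint : Integrable (fun h : ℝ => h) ν) (hθ : 0 < θ) (hmin : ZeroIsUniqueMinimum ν θ)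
    (hν : ν ≠ Measure.dirac 0) {τ : ℕ} (hτ2 : 2 ≤ τ) (hτ : HasFlatness ν θ τ) :
    ∃ c > 0, ∀ᶠ k : ℕ in atTop, ∀ (n : ℕ) (S : Finset (Fin n)), S.card = k →
      c * corrScale (2 * τ - 1) k ≤ ∫ x, magnetization S x ^ 2 ∂(plantedLaw ν θ S) := by
  obtain ⟨C, hC, hmoment⟩ := exists_integral_sq_magnetization_pow_le hint hθ hmin hτ
  obtain ⟨C', hC', hforce⟩ := exists_abs_restoringForce_le hτ
  have hN : 2 ≤ 2 * τ - 1 := by lia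
  generalize 2 * τ - 1 = N at *
  obtain ⟨c, hc, hlow⟩ := exists_le_sqrt_mul_integral_abs_magnetization_pow hθ.le hν
    (by lia) hC.le hC' hforce hmoment
  set L := max 1 (2 * C / c)
  have hL : 1 ≤ L := le_max_left _ _
  have htail : C / L ^ N ≤ c / 2 := by
    have hCL : 2 * C / c ≤ L ^ N := (le_max_right _ _).trans (le_self_pow₀ hL (by lia))
    rw [div_le_iff₀ hc] at hCL
    rw [div_le_iff₀ (by positivity)]
    linarith
  refine ⟨c / 2 / L ^ (N - 2), by positivity, ?_⟩
  filter_upwards [hmoment, hlow, eventually_gt_atTop 0] with k hmoment hlow hk n S rfl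
  have hinterp := sqrt_mul_integral_abs_magnetization_pow_le hk hN (zero_lt_one.trans_le hL)
    (hmoment n S rfl)
  rw [← le_div_iff₀ (corrScale_pos N hk), div_le_iff₀' (by positivity)]
  linarith [hlow n S rfl]

end LowerBound

/-! ### The scores at the three temperatures -/

section Temperature

variable {n : ℕ} {ν : Measure ℝ} {θ : ℝ} {S : Finset (Fin n)}

theorem integral_sq_sum_spin_eq_magnetization (hS : 0 < S.card) :
    ∫ x, (∑ i ∈ S, spin (x i)) ^ 2 ∂(plantedLaw ν θ S) =
      (S.card : ℝ) ^ 2 * ∫ x, magnetization S x ^ 2 ∂(plantedLaw ν θ S) := by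
  simp only [← integral_const_mul, ← mul_pow, card_mul_magnetization hS]

variable [IsProbabilityMeasure ν]

theorem sub_one_mul_pairCorr_eq {i j : Fin n} (hi : i ∈ S) (hj : j ∈ S) (hij : i ≠ j) :
    ((S.card : ℝ) - 1) * pairCorr ν θ S i j =
      S.card * ∫ x, magnetization S x ^ 2 ∂(plantedLaw ν θ S) - 1 := by
  have hS : 0 < S.card := Finset.card_pos.2 ⟨i, hi⟩
  have hsum := integral_sq_sum_spin_of_subset (ν := ν) (θ := θ) subset_rfl hi hj hij
  rw [integral_sq_sum_spin_eq_magnetization hS] at hsum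
  refine mul_left_cancel₀ (Nat.cast_ne_zero.2 hS.ne' : (S.card : ℝ) ≠ 0) ?_
  linarith

theorem pairCorr_le_of_integral_sq_magnetization_le {i j : Fin n} (hi : i ∈ S) (hj : j ∈ S)
    (hij : i ≠ j) {b : ℝ} (hb : 0 ≤ b)
    (hle : ∫ x, magnetization S x ^ 2 ∂(plantedLaw ν θ S) ≤ b) :
    pairCorr ν θ S i j ≤ 2 * b := by
  have hS : (2 : ℝ) ≤ S.card := by exact_mod_cast Finset.one_lt_card.2 ⟨i, hi, j, hj, hij⟩
  have hcorr := sub_one_mul_pairCorr_eq (ν := ν) (θ := θ) hi hj hij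
  refine le_of_mul_le_mul_left ?_ (by linarith : (0 : ℝ) < S.card - 1)
  calc ((S.card : ℝ) - 1) * pairCorr ν θ S i j ≤ S.card * b := by
        linarith [mul_le_mul_of_nonneg_left hle (Nat.cast_nonneg (α := ℝ) S.card)]
    _ ≤ (S.card - 1) * (2 * b) := by nlinarith

theorem signalAtLeast_of_le_pairCorr {a : ℕ → ℝ} (ha : ∀ k, 1 ≤ k → 1 ≤ a k) {μ : ℝ}
    (hle : ∀ᶠ k : ℕ in atTop, ∀ (n : ℕ) (S : Finset (Fin n)), S.card = k →
      ∀ i ∈ S, ∀ j ∈ S, i ≠ j → μ * a k ≤ ((k : ℝ) - 1) * pairCorr ν θ S i j) :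
    SignalAtLeast ν θ a μ := by
  filter_upwards [hle, eventually_ge_atTop 2] with k hle hk n S hS i hi
  obtain ⟨j, hj, hji⟩ := Finset.exists_mem_ne (by lia : 1 < S.card) i
  rw [integral_coordScore_clique (a k) hi hj hji.symm hi, hS,
    le_div_iff₀ (zero_lt_one.trans_le (ha k (by lia)))]
  exact hle n S hS i hi j hj hji.symm

theorem screeningGuarantee_of_pairCorr [ν.IsNegInvariant] {a r : ℕ → ℝ}
    (ha : ∀ k, 1 ≤ k → 1 ≤ a k) (hr : ∀ k, 1 ≤ k → 1 ≤ r k)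
    (har : ∀ k, 1 ≤ k → a k * r k = k) {K : ℝ} (hK : 0 ≤ K)
    (hρ : CorrelationAtMost ν θ fun k => K * a k / k) {μ : ℝ} (hμ : 0 < μ)
    (hle : ∀ᶠ k : ℕ in atTop, ∀ (n : ℕ) (S : Finset (Fin n)), S.card = k →
      ∀ i ∈ S, ∀ j ∈ S, i ≠ j → μ * a k ≤ ((k : ℝ) - 1) * pairCorr ν θ S i j) :
    ScreeningGuarantee ν θ a r :=
  ⟨⟨μ, hμ, signalAtLeast_of_le_pairCorr ha hle⟩, fun _ _ hsignal ht htμ =>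
    exists_screeningExact ha hr har hK hρ hsignal ht htμ⟩

theorem exists_correlationAtMost (hint : Integrable (fun h : ℝ => h) ν) (hθ : 0 < θ)
    (hmin : ZeroIsUniqueMinimum ν θ) {τ : ℕ} (hτ1 : 1 ≤ τ) (hτ : HasFlatness ν θ τ) :
    ∃ K ≥ 0, CorrelationAtMost ν θ fun k => K * corrScale (2 * τ - 1) k := by
  obtain ⟨C, hC, hmoment⟩ := exists_integral_sq_magnetization_pow_le hint hθ hmin hτ
  refine ⟨2 * (1 + C), by positivity, ?_⟩
  filter_upwards [hmoment] with k hmoment n S hS i hi j hj hij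
  have hsecond := integral_sq_magnetization_le (by lia) hC.le (hS ▸ hmoment n S hS)
  rw [hS] at hsecond
  have := corrScale_nonneg (2 * τ - 1) k
  rw [mul_assoc]
  exact pairCorr_le_of_integral_sq_magnetization_le hi hj hij (by positivity) hsecond

theorem meanSechSq_pos (ν : Measure ℝ) [IsProbabilityMeasure ν] : 0 < meanSechSq ν := by
  have hpos : ∀ s, 0 < 1 / Real.cosh s ^ 2 := fun s => by
    have := Real.cosh_pos s
    positivity
  refine (integral_pos_iff_support_of_nonneg (fun s => (hpos s).le)
    (integrable_of_continuous_of_abs_le continuous_sech_sq abs_sech_sq_le_one)).2 ?_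
  rw [Function.support_eq_univ fun s => (hpos s).ne', measure_univ]
  exact one_pos

theorem screeningGuarantee_of_highTemperature [ν.IsNegInvariant]
    (hint : Integrable (fun h : ℝ => h) ν) (hθ : 0 < θ) (hhigh : HighTemperature ν θ) :
    ScreeningGuarantee ν θ (fun _ => 1) (fun k => (k : ℝ)) := by
  obtain ⟨hlt, hmin⟩ := hhigh
  have := meanSechSq_pos ν
  obtain ⟨K, hK, hρ⟩ := exists_correlationAtMost hint hθ hmin le_rfl (hasFlatness_one hint hθ hlt)
  refine screeningGuarantee_of_pairCorr (fun _ _ => le_rfl) (fun k hk => by exact_mod_cast hk)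
    (fun k _ => one_mul _) hK ?_
    (by positivity : 0 < θ * Real.exp (-(4 * θ)) * meanSechSq ν / 2) ?_
  · have hscale : ∀ k, corrScale 1 k = (k : ℝ)⁻¹ := fun k => by
      simpa only [pow_one] using corrScale_pow one_ne_zero k
    simpa only [mul_one, div_eq_mul_inv, ← hscale] using hρ
  · filter_upwards [eventually_ge_atTop 2] with k hk n S hS i hi j hj hij
    have hk : (2 : ℝ) ≤ k := by exact_mod_cast hk
    have hcorr := hS ▸ le_pairCorr (ν := ν) hθ.le hi hj hij
    calc θ * Real.exp (-(4 * θ)) * meanSechSq ν / 2 * 1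
        ≤ θ * Real.exp (-(4 * θ)) * meanSechSq ν * (((k : ℝ) - 1) / k) := by
          rw [mul_one, div_eq_mul_inv]
          gcongr
          rw [le_div_iff₀ (by linarith)]
          linarith
      _ = ((k : ℝ) - 1) * (θ / k * Real.exp (-(4 * θ)) * meanSechSq ν) := by ring
      _ ≤ ((k : ℝ) - 1) * pairCorr ν θ S i j := by gcongr; linarith

theorem rpow_eq_mul_corrScale {τ k : ℕ} (hτ : 1 ≤ τ) (hk : 0 < k) :
    (k : ℝ) ^ ((2 * (τ : ℝ) - 2) / (2 * (τ : ℝ) - 1)) = k * corrScale (2 * τ - 1) k := by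
  have hk : (0 : ℝ) < k := by exact_mod_cast hk
  have hτ' : (1 : ℝ) ≤ τ := by exact_mod_cast hτ
  have hden : 2 * (τ : ℝ) - 1 ≠ 0 := by linarith
  have hexp : (2 * (τ : ℝ) - 2) / (2 * (τ : ℝ) - 1) = 1 + -(1 / (2 * (τ : ℝ) - 1)) := by
    field_simp
    ring
  rw [hexp, Real.rpow_add hk, Real.rpow_one, corrScale, Nat.cast_sub (by lia)]
  push_cast
  rfl

theorem rpow_eq_inv_corrScale {τ : ℕ} (hτ : 1 ≤ τ) (k : ℕ) :
    (k : ℝ) ^ (1 / (2 * (τ : ℝ) - 1)) = (corrScale (2 * τ - 1) k)⁻¹ := by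
  rw [corrScale, Real.rpow_neg k.cast_nonneg, inv_inv, Nat.cast_sub (by lia)]
  push_cast
  rfl

theorem exists_le_sub_one_mul_pairCorr [ν.IsNegInvariant]
    (hint : Integrable (fun h : ℝ => h) ν) (hθ : 0 < θ) (hmin : ZeroIsUniqueMinimum ν θ)
    (hν : ν ≠ Measure.dirac 0) {τ : ℕ} (hτ2 : 2 ≤ τ) (hτ : HasFlatness ν θ τ) :
    ∃ μ > 0, ∀ᶠ k : ℕ in atTop, ∀ (n : ℕ) (S : Finset (Fin n)), S.card = k →
      ∀ i ∈ S, ∀ j ∈ S, i ≠ j →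
        μ * (k : ℝ) ^ ((2 * (τ : ℝ) - 2) / (2 * (τ : ℝ) - 1)) ≤
          ((k : ℝ) - 1) * pairCorr ν θ S i j := by
  obtain ⟨c, hc, hle⟩ := exists_le_integral_sq_magnetization hint hθ hmin hν hτ2 hτ
  have hτ' : (2 : ℝ) ≤ τ := by exact_mod_cast hτ2
  have hlim : Tendsto (fun k : ℕ => (k : ℝ) ^ ((2 * (τ : ℝ) - 2) / (2 * (τ : ℝ) - 1)))
      atTop atTop :=
    (tendsto_rpow_atTop (div_pos (by linarith) (by linarith))).comp tendsto_natCast_atTop_atTop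
  refine ⟨c / 2, half_pos hc, ?_⟩
  filter_upwards [hle, eventually_gt_atTop 0, hlim.eventually_ge_atTop (2 / c)]
    with k hle hk hlarge n S hS i hi j hj hij
  have hcorr := hS ▸ sub_one_mul_pairCorr_eq (ν := ν) (θ := θ) hi hj hij
  rw [rpow_eq_mul_corrScale (by lia) hk] at hlarge ⊢
  rw [div_le_iff₀ hc] at hlarge
  rw [hcorr]
  linarith [mul_le_mul_of_nonneg_left (hle n S hS) (Nat.cast_nonneg (α := ℝ) k)]

theorem screeningGuarantee_of_criticalTemperature [ν.IsNegInvariant]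
    (hint : Integrable (fun h : ℝ => h) ν) (hθ : 0 < θ) {τ : ℕ}
    (hcrit : CriticalTemperature ν θ τ) (hν : ν ≠ Measure.dirac 0) :
    ScreeningGuarantee ν θ
      (fun k => (k : ℝ) ^ ((2 * (τ : ℝ) - 2) / (2 * (τ : ℝ) - 1)))
      (fun k => (k : ℝ) ^ (1 / (2 * (τ : ℝ) - 1))) := by
  have hτ2 := two_le_of_criticalTemperature hint hθ hcrit
  have hτ := hasFlatness_of_criticalTemperature hint hθ hcrit
  have hmin := hcrit.2.1
  have hτ' : (2 : ℝ) ≤ τ := by exact_mod_cast hτ2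
  obtain ⟨K, hK, hρ⟩ := exists_correlationAtMost hint hθ hmin (by lia) hτ
  obtain ⟨μ, hμ, hle⟩ := exists_le_sub_one_mul_pairCorr hint hθ hmin hν hτ2 hτ
  refine screeningGuarantee_of_pairCorr
    (fun k hk => Real.one_le_rpow (by exact_mod_cast hk) (div_nonneg (by linarith) (by linarith)))
    (fun k hk => Real.one_le_rpow (by exact_mod_cast hk) (div_nonneg one_pos.le (by linarith)))
    (fun k hk => ?_) hK ?_ hμ hle
  · rw [rpow_eq_mul_corrScale (by lia) hk, rpow_eq_inv_corrScale (by lia),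
      mul_inv_cancel_right₀ (corrScale_pos _ hk).ne']
  · filter_upwards [hρ, eventually_gt_atTop 0] with k hρ hk
    rwa [rpow_eq_mul_corrScale (by lia) hk, mul_left_comm,
      mul_div_cancel_left₀ _ (Nat.cast_ne_zero.2 hk.ne')]

theorem exists_potential_lt_of_lowTemperature [ν.IsNegInvariant]
    (hint : Integrable (fun h : ℝ => h) ν) (hθ : 0 < θ) (hlow : LowTemperature ν θ) :
    ∃ x, potential ν θ x < potential ν θ 0 := by
  rcases hlow with hlt | ⟨-, hexists⟩
  · by_contra! hmin
    have hsecond := (hasDerivAt_deriv_potential_zero (ν := ν) hint hθ.le).deriv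
    have hmax : IsLocalMax (potential ν θ) 0 :=
      isLocalMax_of_deriv_deriv_neg (by rw [hsecond]; linarith) (deriv_potential_zero hint θ)
        (hasDerivAt_potential hint θ 0).continuousAt
    have hconst : potential ν θ =ᶠ[𝓝 0] fun _ => potential ν θ 0 :=
      hmax.mono fun x hx => le_antisymm hx (hmin x)
    have hzero := hconst.deriv.deriv_eq
    simp only [hsecond, deriv_const'] at hzero
    linarith
  · exact hexists

theorem le_integral_sq_magnetization (hint : Integrable (fun h : ℝ => h) ν) (hθ : 0 < θ)
    (hS : 0 < S.card) (x : ℝ) :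
    2 * ((potential ν θ 0 - potential ν θ x) / θ) ≤
      ∫ y, magnetization S y ^ 2 ∂(plantedLaw ν θ S) := by
  have henergy := le_integral_sq_sum_spin hint hθ.le hS x
  have hS' : (0 : ℝ) < S.card := by exact_mod_cast hS
  rw [integral_sq_sum_spin_eq_magnetization hS] at henergy
  set m₂ := ∫ y, magnetization S y ^ 2 ∂(plantedLaw ν θ S)
  have hfactor : θ / (2 * S.card) * ((S.card : ℝ) ^ 2 * m₂) = S.card * (θ * m₂ / 2) := by
    field_simp
  rw [hfactor] at henergy
  rw [← mul_div_assoc, div_le_iff₀ hθ]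
  linarith [le_of_mul_le_mul_left henergy hS']

theorem screeningGuarantee_of_lowTemperature [ν.IsNegInvariant]
    (hint : Integrable (fun h : ℝ => h) ν) (hθ : 0 < θ) (hlow : LowTemperature ν θ) :
    ScreeningGuarantee ν θ (fun k => (k : ℝ)) (fun _ => 1) := by
  obtain ⟨x, hx⟩ := exists_potential_lt_of_lowTemperature hint hθ hlow
  have hμ : 0 < (potential ν θ 0 - potential ν θ x) / θ := div_pos (sub_pos.2 hx) hθ
  refine screeningGuarantee_of_pairCorr (fun k hk => by exact_mod_cast hk)
    (fun _ _ => le_rfl) (fun k _ => mul_one _) zero_le_one ?_ hμ ?_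
  · filter_upwards [eventually_ne_atTop 0] with k hk n S _ i _ j _ _
    rw [one_mul, div_self (Nat.cast_ne_zero.2 hk)]
    exact (le_abs_self _).trans (abs_pairCorr_le_one i j)
  · filter_upwards [eventually_gt_atTop 0, tendsto_natCast_atTop_atTop.eventually_ge_atTop
      (1 / ((potential ν θ 0 - potential ν θ x) / θ))] with k hk hlarge n S hS i hi j hj hij
    have hmoment := le_integral_sq_magnetization (S := S) hint hθ (hS ▸ hk) x
    rw [div_le_iff₀' hμ] at hlarge
    have hcorr := hS ▸ sub_one_mul_pairCorr_eq (ν := ν) (θ := θ) hi hj hij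
    rw [hcorr]
    linarith [mul_le_mul_of_nonneg_left hmoment (Nat.cast_nonneg (α := ℝ) k)]

end Temperature

end

theorem mainTheorem10 (ν : Measure ℝ) [IsProbabilityMeasure ν]
    (hint : Integrable (fun h : ℝ => h) ν) (hsymm : ν.map (fun h : ℝ => -h) = ν)
    (θ : ℝ) (hθ : 0 < θ) :
    (HighTemperature ν θ →
      ScreeningGuarantee ν θ (fun _ => 1) (fun k => (k : ℝ))) ∧
    (∀ τ : ℕ, CriticalTemperature ν θ τ → ν ≠ Measure.dirac 0 →
      ScreeningGuarantee ν θ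
        (fun k => (k : ℝ) ^ ((2 * (τ : ℝ) - 2) / (2 * (τ : ℝ) - 1)))
        (fun k => (k : ℝ) ^ (1 / (2 * (τ : ℝ) - 1)))) ∧
    (LowTemperature ν θ →
      ScreeningGuarantee ν θ (fun k => (k : ℝ)) (fun _ => 1)) := by
  have : ν.IsNegInvariant := ⟨hsymm⟩
  exact ⟨screeningGuarantee_of_highTemperature hint hθ,
    fun _ => screeningGuarantee_of_criticalTemperature hint hθ,
    screeningGuarantee_of_lowTemperature hint hθ⟩
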